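/- Let $\mathbb{R}^3_-=\{x\in\mathbb{R}^3: x_3<0\}$, $\varrho(x)=(1+|x|^2)^{1/2}$, and for $m\in\mathbb{N}_0$, $\alpha\in\mathbb{R}$ let $H^m_\alpha(\mathbb{R}^3_-)$ be the weighted Sobolev space of (here $\mathbb{R}^3$-valued) $v$ whose weak derivatives satisfy $\varrho^{\alpha-m+|\kappa|}\partial^\kappa v\in L^2(\mathbb{R}^3_-)$ for all multi-indices $|\kappa|\le m$, with norm $\|v\|_{H^m_\alpha}^2=\sum_{|\kappa|\le m}\|\varrho^{\alpha-m+|\kappa|}\partial^\kappa v\|_{L^2}^2$. Let $\lambda,\mu$ be Lipschitz functions on $\mathbb{R}^3_-$ such that, for constants $M,K>0$ and $\alpha_0,\beta_0>0$, $$\|\mu\|_{C^{0,1}}+\|\lambda\|_{C^{0,1}}\le M,\qquad |\nabla\lambda|,\ |\nabla\mu|\le \frac{K}{\varrho}\ \text{ a.e.},\qquad \mu\ge\alpha_0,\quad 3\lambda+2\mu\ge\beta_0\ \text{ in } \mathbb{R}^3_-,$$ where $\|g\|_{C^{0,1}}=\|g\|_{L^\infty}+\|\nabla g\|_{L^\infty}$.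 Write $\widehat\nabla v=\frac12(\nabla v+\nabla v^T)$ and $\mathbb{C}A=\lambda(\operatorname{tr}A)I+2\mu A$ for symmetric $A$. Let $$V=\{v\in H^2_1(\mathbb{R}^3_-):\ (\mathbb{C}\widehat\nabla v)e_3=0 \text{ on } \{x_3=0\} \text{ in the sense of traces}\},\qquad \|v\|_V=\|v\|_{H^2_1},$$ and let $V'$ be its dual with the dual norm. For $f\in V'$, a very weak solution of $$\operatorname{div}(\mathbb{C}\widehat\nabla u)=f\ \text{ in } \mathbb{R}^3_-,\qquad (\mathbb{C}\widehat\nabla u)e_3=0\ \text{ on } \{x_3=0\}\qquad (*)$$ is a $u\in H^0_{-1}(\mathbb{R}^3_-)$ that satisfies the equation in the sense of distributions, that is, $\int_{\mathbb{R}^3_-}u\cdot\operatorname{div}(\mathbb{C}\widehat\nabla\varphi)\,dx=\langle f,\varphi\rangle$ for all $\varphi\in C_c^\infty(\mathbb{R}^3_-)^3$, and whose generalized traction, defined through Green's formula by $\langle(\mathbb{C}\widehat\nabla u)e_3,v\rangle=\langle f,v\rangle-\int_{\mathbb{R}^3_-}u\cdot\operatorname{div}(\mathbb{C}\widehat\nabla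 v)\,dx$ for $v\in V$, vanishes; equivalently, $\int_{\mathbb{R}^3_-}u\cdot\operatorname{div}(\mathbb{C}\widehat\nabla v)\,dx=\langle f,v\rangle$ for all $v\in V$. **Theorem.** There is a constant $C>0$, depending only on $M,K,\alpha_0,\beta_0$, such that for all such $\lambda,\mu$ and every $f\in V'$ the problem $(*)$ has a unique very weak solution $u\in H^0_{-1}(\mathbb{R}^3_-)$, and $$\|u\|_{H^0_{-1}(\mathbb{R}^3_-)}\le C\,\|f\|_{V'}.$$ -/

import Mathlib

open MeasureTheory Set TopologicalSpace
open scoped ENNReal Distributions LineDeriv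

noncomputable section

namespace HalfSpaceElasticity

/-- Three-dimensional Euclidean space; coordinates are indexed by `0, 1, 2`, so that the third
coordinate of `x` is `x 2`. -/
abbrev E3 : Type := EuclideanSpace ℝ (Fin 3)

/-- The standard basis vectors. -/
def stdBasis (i : Fin 3) : E3 := EuclideanSpace.single i (1 : ℝ)

/-- The open lower half space. -/
def lowerHalf : Opens E3 where
  carrier := {x | x 2 < 0}
  is_open' := isOpen_lt (by fun_prop) continuous_const

/-- Lebesgue measure on the lower half space. -/
def halfVol : Measure E3 := volume.restrict (lowerHalf : Set E3)

/-- The weight `ϱ(x) = (1 + |x|²)^{1/2}`. -/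
def rho (x : E3) : ℝ := Real.sqrt (1 + ‖x‖ ^ 2)

/-! ### Multi-indices and weighted Sobolev spaces -/

/-- Multi-indices `κ ∈ ℕ³` with `|κ| ≤ m`. -/
abbrev MultiIdx (m : ℕ) : Type := {κ : Fin 3 → Fin (m + 1) // ∑ i, (κ i : ℕ) ≤ m}

/-- The length `|κ|`. -/
def MultiIdx.len {m : ℕ} (κ : MultiIdx m) : ℕ := ∑ i, (κ.1 i : ℕ)

/-- The multi-index `0`. -/
def idx0 (m : ℕ) : MultiIdx m := ⟨fun _ => 0, by simp⟩

/-- The multi-index of `∂_k`. -/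
def idx1 (k : Fin 3) : MultiIdx 2 := ⟨fun i => if i = k then 1 else 0, by revert k; decide⟩

/-- The multi-index of `∂_l ∂_k`. -/
def idx2 (l k : Fin 3) : MultiIdx 2 :=
  ⟨fun i => (if i = l then 1 else 0) + (if i = k then 1 else 0), by revert l k; decide⟩

/-- `∂^κ φ` for a scalar test function `φ`. -/
def testDeriv {Ω : Opens E3} {m : ℕ} (κ : MultiIdx m) (φ : 𝓓(Ω, ℝ)) : 𝓓(Ω, ℝ) :=
  (fun ψ : 𝓓(Ω, ℝ) => ∂_{stdBasis 0} ψ)^[κ.1 0]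
    ((fun ψ : 𝓓(Ω, ℝ) => ∂_{stdBasis 1} ψ)^[κ.1 1]
      ((fun ψ : 𝓓(Ω, ℝ) => ∂_{stdBasis 2} ψ)^[κ.1 2] φ))

/-- Families `(h_κ)_{|κ| ≤ m}` of square integrable vector fields on the lower half space, with the
Hilbert norm `(∑_κ ‖h_κ‖²_{L²})^{1/2}`. -/
abbrev JetL2 (m : ℕ) : Type := PiLp 2 (fun _ : MultiIdx m => Lp E3 2 halfVol)

/-- The vector field `ϱ^{-(α - m + |κ|)} h_κ`. When `h` is an element of `weightedSobolev m α`,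
this is the weak derivative `∂^κ u` of the vector field `u` that `h` stands for. -/
def wDeriv {m : ℕ} (α : ℝ) (h : JetL2 m) (κ : MultiIdx m) (x : E3) : E3 :=
  rho x ^ (-(α - m + κ.len)) • (h κ : E3 → E3) x

/-! ### Integrability facts -/

lemma rho_pos (x : E3) : 0 < rho x := Real.sqrt_pos.2 (by positivity)

lemma continuous_rho : Continuous rho := by unfold rho; fun_prop

lemma integrable_test_smul {Ω : Opens E3} {m : ℕ} (α : ℝ) (h : JetL2 m) (κ : MultiIdx m)
    (φ : 𝓓(Ω, ℝ)) : Integrable (fun x => φ x • wDeriv α h κ x) halfVol := by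
  have hc : Continuous (fun x => φ x * rho x ^ (-(α - m + κ.len))) :=
    φ.continuous.mul (continuous_rho.rpow_const fun x => Or.inl (rho_pos x).ne')
  have hs : HasCompactSupport (fun x => φ x * rho x ^ (-(α - m + κ.len))) :=
    φ.hasCompactSupport.mul_right
  have h1 : MemLp (fun x => φ x * rho x ^ (-(α - m + κ.len))) 2 halfVol :=
    (hc.memLp_of_hasCompactSupport (μ := volume) hs).restrict _
  have h2 : MemLp (h κ : E3 → E3) 2 halfVol := Lp.memLp _
  have h3 := h2.smul (r := 1) h1
  refine (memLp_one_iff_integrable.1 h3).congr (Filter.Eventually.of_forall fun x => ?_)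
  simp [wDeriv, smul_smul]

lemma wDeriv_add {m : ℕ} (α : ℝ) (h h' : JetL2 m) (κ : MultiIdx m) :
    wDeriv α (h + h') κ =ᵐ[halfVol] fun x => wDeriv α h κ x + wDeriv α h' κ x := by
  filter_upwards [Lp.coeFn_add (h κ) (h' κ)] with x hx
  simp only [wDeriv, PiLp.add_apply, hx, Pi.add_apply, smul_add]

lemma wDeriv_smul {m : ℕ} (α c : ℝ) (h : JetL2 m) (κ : MultiIdx m) :
    wDeriv α (c • h) κ =ᵐ[halfVol] fun x => c • wDeriv α h κ x := by
  filter_upwards [Lp.coeFn_smul c (h κ)] with x hx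
  simp only [wDeriv, PiLp.smul_apply, hx, Pi.smul_apply]
  rw [smul_comm]

lemma wDeriv_zero {m : ℕ} (α : ℝ) (κ : MultiIdx m) :
    wDeriv α (0 : JetL2 m) κ =ᵐ[halfVol] fun _ => 0 := by
  filter_upwards [Lp.coeFn_zero E3 2 halfVol] with x hx
  simp only [wDeriv, PiLp.zero_apply, hx, Pi.zero_apply, smul_zero]

/-- The weighted Sobolev space `H^m_α` of vector fields on the lower half space: the vector field
`u` with weak derivatives `∂^κ u`, `|κ| ≤ m`, satisfying `ϱ^{α-m+|κ|} ∂^κ u ∈ L²`, is represented by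
the family `(ϱ^{α-m+|κ|} ∂^κ u)_κ`. The norm inherited from `JetL2 m` is therefore
`‖u‖² = ∑_κ ‖ϱ^{α-m+|κ|} ∂^κ u‖²_{L²}`. The field `u` itself is `wDeriv α u (idx0 m)`. -/
def weightedSobolev (m : ℕ) (α : ℝ) : Submodule ℝ (JetL2 m) where
  carrier := {h | ∀ (κ : MultiIdx m) (φ : 𝓓(lowerHalf, ℝ)),
    ∫ x, testDeriv κ φ x • wDeriv α h (idx0 m) x ∂halfVol
      = (-1 : ℝ) ^ κ.len • ∫ x, φ x • wDeriv α h κ x ∂halfVol}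
  add_mem' := by
    intro a b ha hb κ φ
    have e : ∀ (κ : MultiIdx m) (ψ : 𝓓(lowerHalf, ℝ)),
        ∫ x, ψ x • wDeriv α (a + b) κ x ∂halfVol
          = ∫ x, ψ x • wDeriv α a κ x ∂halfVol + ∫ x, ψ x • wDeriv α b κ x ∂halfVol := by
      intro κ ψ
      rw [← integral_add (integrable_test_smul α a κ ψ) (integrable_test_smul α b κ ψ)]
      refine integral_congr_ae ?_
      filter_upwards [wDeriv_add α a b κ] with x hx
      simp only [hx, smul_add]
    rw [e, e, ha κ φ, hb κ φ, smul_add]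
  zero_mem' := by
    intro κ φ
    have e : ∀ (κ : MultiIdx m) (ψ : 𝓓(lowerHalf, ℝ)),
        ∫ x, ψ x • wDeriv α (0 : JetL2 m) κ x ∂halfVol = 0 := by
      intro κ ψ
      refine integral_eq_zero_of_ae ?_
      filter_upwards [wDeriv_zero (m := m) α κ] with x hx
      simp [hx]
    rw [e, e, smul_zero]
  smul_mem' := by
    intro c a ha κ φ
    have e : ∀ (κ : MultiIdx m) (ψ : 𝓓(lowerHalf, ℝ)),
        ∫ x, ψ x • wDeriv α (c • a) κ x ∂halfVol
          = c • ∫ x, ψ x • wDeriv α a κ x ∂halfVol := by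
      intro κ ψ
      rw [← integral_smul]
      refine integral_congr_ae ?_
      filter_upwards [wDeriv_smul α c a κ] with x hx
      simp only [hx]
      rw [smul_comm]
    rw [e, e, ha κ φ, smul_comm]

/-! ### The Lamé system -/

/-- `lam` and `mu` are Lamé parameters on the lower half space: Lipschitz, with
`‖mu‖_{C^{0,1}} + ‖lam‖_{C^{0,1}} ≤ M`, where `‖g‖_{C^{0,1}} = ‖g‖_{L^∞} + ‖∇g‖_{L^∞}`, with
gradients bounded a.e. by `K / ϱ`, and strongly convex with constants `α₀`, `β₀`. -/
structure IsLameMedium (M K α₀ β₀ : ℝ) (lam mu : E3 → ℝ) : Prop where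
  lipschitz_lam : ∃ L, LipschitzOnWith L lam lowerHalf
  lipschitz_mu : ∃ L, LipschitzOnWith L mu lowerHalf
  bound : (eLpNorm mu ∞ halfVol + eLpNorm (fderiv ℝ mu) ∞ halfVol)
    + (eLpNorm lam ∞ halfVol + eLpNorm (fderiv ℝ lam) ∞ halfVol) ≤ ENNReal.ofReal M
  decay_lam : ∀ᵐ x ∂halfVol, ‖fderiv ℝ lam x‖ ≤ K / rho x
  decay_mu : ∀ᵐ x ∂halfVol, ‖fderiv ℝ mu x‖ ≤ K / rho x
  convex_mu : ∀ x ∈ lowerHalf, α₀ ≤ mu x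
  convex_lam : ∀ x ∈ lowerHalf, β₀ ≤ 3 * lam x + 2 * mu x

/-- The partial derivative `∂_l g` of a Lamé parameter (it exists a.e. by Rademacher's theorem). -/
def pd (l : Fin 3) (g : E3 → ℝ) (x : E3) : ℝ := fderiv ℝ g x (stdBasis l)

/-- The entry `(i, j)` of the symmetric gradient, where `D k x i = ∂_k v_i (x)`. -/
def strain (D : Fin 3 → E3 → E3) (i j : Fin 3) (x : E3) : ℝ := (D j x i + D i x j) / 2

/-- The entry `(i, j)` of the stress `ℂ A = lam (tr A) I + 2 mu A`, where `A` is the symmetric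
gradient built from `D`. -/
def stress (lam mu : E3 → ℝ) (D : Fin 3 → E3 → E3) (i j : Fin 3) (x : E3) : ℝ :=
  lam x * (if i = j then ∑ k, strain D k k x else 0) + 2 * mu x * strain D i j x

/-- The derivative `∂_l` of the entry `(i, j)` of the stress, by the product rule
`∂_l (ℂ A) = (∂_l ℂ) A + ℂ (∂_l A)`, where `D k x i = ∂_k v_i (x)` and
`D₂ l k x i = ∂_l ∂_k v_i (x)`. -/
def dStress (lam mu : E3 → ℝ) (D : Fin 3 → E3 → E3) (D₂ : Fin 3 → Fin 3 → E3 → E3)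
    (l i j : Fin 3) (x : E3) : ℝ :=
  stress (pd l lam) (pd l mu) D i j x + stress lam mu (D₂ l) i j x

/-- The vector field `div (ℂ ∇̂v)`, with components `∑_j ∂_j (ℂ ∇̂v)_{ij}`. -/
def divStress (lam mu : E3 → ℝ) (D : Fin 3 → E3 → E3) (D₂ : Fin 3 → Fin 3 → E3 → E3)
    (x : E3) : E3 :=
  WithLp.toLp 2 fun i => ∑ j, dStress lam mu D D₂ j i j x

/-- First order weak derivatives of an element of `H²_1`. -/
def grad1 (v : weightedSobolev 2 1) (k : Fin 3) : E3 → E3 := wDeriv 1 (v : JetL2 2) (idx1 k)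

/-- Second order weak derivatives of an element of `H²_1`. -/
def grad2 (v : weightedSobolev 2 1) (l k : Fin 3) : E3 → E3 := wDeriv 1 (v : JetL2 2) (idx2 l k)

/-- The Lamé operator `div (ℂ ∇̂v)` for `v ∈ H²_1`. -/
def lameOp (lam mu : E3 → ℝ) (v : weightedSobolev 2 1) : E3 → E3 :=
  divStress lam mu (grad1 v) (grad2 v)

/-- The Lamé operator `div (ℂ ∇̂φ)` for a smooth compactly supported vector field `φ`. -/
def lameOpTest (lam mu : E3 → ℝ) (φ : 𝓓(lowerHalf, E3)) : E3 → E3 :=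
  divStress lam mu (fun k => ⇑(∂_{stdBasis k} φ : 𝓓(lowerHalf, E3)))
    (fun l k => ⇑(∂_{stdBasis l} (∂_{stdBasis k} φ : 𝓓(lowerHalf, E3)) : 𝓓(lowerHalf, E3)))

/-! ### Traces and the traction-free space -/

/-- `g` is the trace on `{x₃ = 0}` of the function `w` on the lower half space whose weak derivative
`∂₃ w` is `dw`, in the sense of the Gauss-Green formula. -/
def HasTrace (w dw : E3 → ℝ) (g : EuclideanSpace ℝ (Fin 2) → ℝ) : Prop :=
  ∀ φ : 𝓓((⊤ : Opens E3), ℝ),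
    ∫ x, ((∂_{stdBasis 2} φ : 𝓓((⊤ : Opens E3), ℝ)) x * w x + φ x * dw x) ∂halfVol
      = ∫ y : EuclideanSpace ℝ (Fin 2), φ !₂[y 0, y 1, 0] * g y

/-- The boundary condition `(ℂ ∇̂v) e₃ = 0` on `{x₃ = 0}`, in the sense of traces. -/
def IsTractionFree (lam mu : E3 → ℝ) (v : weightedSobolev 2 1) : Prop :=
  ∀ i : Fin 3, HasTrace (stress lam mu (grad1 v) i 2)
    (dStress lam mu (grad1 v) (grad2 v) 2 i 2) (fun _ => 0)

section Linearity

variable {M K α₀ β₀ : ℝ} {lam mu : E3 → ℝ}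

/-- Measurable and essentially bounded coefficients on the lower half space. -/
def IsBddCoeff (c : E3 → ℝ) : Prop :=
  AEStronglyMeasurable c halfVol ∧ ∃ B : ℝ, ∀ᵐ x ∂halfVol, ‖c x‖ ≤ B

lemma isBddCoeff_of {g : E3 → ℝ} (hg : ∃ L, LipschitzOnWith L g lowerHalf)
    (hb : eLpNorm g ∞ halfVol < ∞) : IsBddCoeff g := by
  obtain ⟨L, hL⟩ := hg
  refine ⟨hL.continuousOn.aestronglyMeasurable lowerHalf.isOpen.measurableSet,
    (eLpNorm g ∞ halfVol).toReal, ?_⟩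
  filter_upwards [ae_le_eLpNormEssSup (f := g) (μ := halfVol)] with x hx
  rw [← eLpNorm_exponent_top] at hx
  have := ENNReal.toReal_mono hb.ne hx
  simpa using this

lemma isBddCoeff_pd {g : E3 → ℝ} (l : Fin 3)
    (hb : ∀ᵐ x ∂halfVol, ‖fderiv ℝ g x‖ ≤ K / rho x) : IsBddCoeff (pd l g) := by
  refine ⟨(measurable_fderiv_apply_const ℝ g (stdBasis l)).aestronglyMeasurable, |K|, ?_⟩
  filter_upwards [hb] with x hx
  have h1 : 1 ≤ rho x := Real.one_le_sqrt.2 (by nlinarith [sq_nonneg ‖x‖])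
  have h2 : ‖stdBasis l‖ = 1 := by simp [stdBasis]
  calc ‖pd l g x‖ ≤ ‖fderiv ℝ g x‖ * ‖stdBasis l‖ := ContinuousLinearMap.le_opNorm _ _
    _ ≤ K / rho x := by rw [h2, mul_one]; exact hx
    _ ≤ |K| / rho x := by gcongr; exact le_abs_self K
    _ ≤ |K| := div_le_self (abs_nonneg K) h1

lemma IsLameMedium.coeffs (h : IsLameMedium M K α₀ β₀ lam mu) :
    IsBddCoeff lam ∧ IsBddCoeff mu ∧ ∀ l, IsBddCoeff (pd l lam) ∧ IsBddCoeff (pd l mu) := by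
  have hb := lt_of_le_of_lt h.bound ENNReal.ofReal_lt_top
  rw [ENNReal.add_lt_top, ENNReal.add_lt_top, ENNReal.add_lt_top] at hb
  exact ⟨isBddCoeff_of h.lipschitz_lam hb.2.1, isBddCoeff_of h.lipschitz_mu hb.1.1,
    fun l => ⟨isBddCoeff_pd l h.decay_lam, isBddCoeff_pd l h.decay_mu⟩⟩

lemma integrable_coeff {c : E3 → ℝ} (hc : IsBddCoeff c) {Ω : Opens E3} {m : ℕ} (α : ℝ)
    (v : JetL2 m) (κ : MultiIdx m) (i : Fin 3) (φ : 𝓓(Ω, ℝ)) :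
    Integrable (fun x => φ x * (c x * wDeriv α v κ x i)) halfVol := by
  obtain ⟨hm, B, hB⟩ := hc
  have h1 := (EuclideanSpace.proj (𝕜 := ℝ) i).integrable_comp (integrable_test_smul α v κ φ)
  refine (h1.bdd_mul hm hB).congr (Filter.Eventually.of_forall fun x => ?_)
  simp
  ring

lemma integrable_stress {c d : E3 → ℝ} (hc : IsBddCoeff c) (hd : IsBddCoeff d) {Ω : Opens E3}
    (v : JetL2 2) (κ : Fin 3 → MultiIdx 2) (i j : Fin 3) (φ : 𝓓(Ω, ℝ)) :
    Integrable (fun x => φ x * stress c d (fun k => wDeriv 1 v (κ k)) i j x) halfVol := by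
  have hs : Integrable (fun x => ∑ k, φ x * (c x * wDeriv 1 v (κ k) x k)) halfVol :=
    integrable_finsetSum _ fun k _ => integrable_coeff hc 1 v (κ k) k φ
  have ht := (integrable_coeff hd 1 v (κ j) i φ).add (integrable_coeff hd 1 v (κ i) j φ)
  by_cases hij : i = j
  · refine (hs.add ht).congr (Filter.Eventually.of_forall fun x => ?_)
    simp only [stress, strain, hij, if_true, Pi.add_apply, Fin.sum_univ_three]
    ring
  · refine ht.congr (Filter.Eventually.of_forall fun x => ?_)
    simp only [stress, strain, hij, if_false, Pi.add_apply]
    ring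

lemma stress_add (c d : E3 → ℝ) (D D' D'' : Fin 3 → E3 → E3) (i j : Fin 3) (x : E3)
    (h : ∀ k, D'' k x = D k x + D' k x) :
    stress c d D'' i j x = stress c d D i j x + stress c d D' i j x := by
  simp only [stress, strain, h, PiLp.add_apply, Fin.sum_univ_three]
  split_ifs <;> ring

lemma stress_smul (c d : E3 → ℝ) (a : ℝ) (D D' : Fin 3 → E3 → E3) (i j : Fin 3) (x : E3)
    (h : ∀ k, D' k x = a • D k x) : stress c d D' i j x = a * stress c d D i j x := by
  simp only [stress, strain, h, PiLp.smul_apply, Fin.sum_univ_three, smul_eq_mul]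
  split_ifs <;> ring

lemma IsTractionFree.integrable (h : IsLameMedium M K α₀ β₀ lam mu) (v : weightedSobolev 2 1)
    (i : Fin 3) (φ : 𝓓((⊤ : Opens E3), ℝ)) :
    Integrable (fun x => (∂_{stdBasis 2} φ : 𝓓((⊤ : Opens E3), ℝ)) x *
      stress lam mu (grad1 v) i 2 x
      + φ x * dStress lam mu (grad1 v) (grad2 v) 2 i 2 x) halfVol := by
  obtain ⟨hl, hm, hp⟩ := h.coeffs
  have h1 := integrable_stress hl hm (v : JetL2 2) idx1 i 2
    (∂_{stdBasis 2} φ : 𝓓((⊤ : Opens E3), ℝ))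
  have h2 := integrable_stress (hp 2).1 (hp 2).2 (v : JetL2 2) idx1 i 2 φ
  have h3 := integrable_stress hl hm (v : JetL2 2) (idx2 2) i 2 φ
  refine (h1.add (h2.add h3)).congr (Filter.Eventually.of_forall fun x => ?_)
  simp only [Pi.add_apply, dStress, mul_add]
  rfl

/-- The space `V` of traction-free elements of `H²_1`, with the norm of `H²_1`. -/
def tractionFree (h : IsLameMedium M K α₀ β₀ lam mu) :
    Submodule ℝ (weightedSobolev 2 1) where
  carrier := {v | IsTractionFree lam mu v}
  add_mem' := by
    intro a b ha hb i φ
    have e := (congrArg₂ (· + ·) (ha i φ) (hb i φ))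
    simp only [mul_zero, integral_zero, add_zero] at e ⊢
    rw [← e, ← integral_add (IsTractionFree.integrable h a i φ)
      (IsTractionFree.integrable h b i φ)]
    refine integral_congr_ae ?_
    have h1 : ∀ᵐ x ∂halfVol, ∀ k, grad1 (a + b) k x = grad1 a k x + grad1 b k x :=
      ae_all_iff.2 fun k => wDeriv_add 1 (a : JetL2 2) (b : JetL2 2) (idx1 k)
    have h2 : ∀ᵐ x ∂halfVol, ∀ k, grad2 (a + b) 2 k x = grad2 a 2 k x + grad2 b 2 k x :=
      ae_all_iff.2 fun k => wDeriv_add 1 (a : JetL2 2) (b : JetL2 2) (idx2 2 k)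
    filter_upwards [h1, h2] with x hx1 hx2
    simp only [dStress]
    rw [stress_add _ _ _ _ _ i 2 x hx1, stress_add _ _ _ _ _ i 2 x hx1,
      stress_add _ _ _ _ _ i 2 x hx2]
    ring
  zero_mem' := by
    intro i φ
    simp only [mul_zero, integral_zero]
    refine integral_eq_zero_of_ae ?_
    have h1 : ∀ᵐ x ∂halfVol, ∀ k, grad1 0 k x = (0 : ℝ) • grad1 0 k x :=
      ae_all_iff.2 fun k => by
        filter_upwards [wDeriv_zero (m := 2) 1 (idx1 k)] with x hx
        rw [zero_smul]
        exact hx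
    have h2 : ∀ᵐ x ∂halfVol, ∀ k, grad2 0 2 k x = (0 : ℝ) • grad2 0 2 k x :=
      ae_all_iff.2 fun k => by
        filter_upwards [wDeriv_zero (m := 2) 1 (idx2 2 k)] with x hx
        rw [zero_smul]
        exact hx
    filter_upwards [h1, h2] with x hx1 hx2
    simp only [dStress]
    rw [stress_smul lam mu _ _ _ i 2 x hx1, stress_smul (pd 2 lam) (pd 2 mu) _ _ _ i 2 x hx1,
      stress_smul lam mu _ _ _ i 2 x hx2]
    simp only [zero_mul, mul_zero, add_zero, Pi.zero_apply]
  smul_mem' := by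
    intro c a ha i φ
    have e := congrArg (c * ·) (ha i φ)
    simp only [mul_zero, integral_zero] at e ⊢
    rw [← e, ← integral_const_mul]
    refine integral_congr_ae ?_
    have h1 : ∀ᵐ x ∂halfVol, ∀ k, grad1 (c • a) k x = c • grad1 a k x :=
      ae_all_iff.2 fun k => wDeriv_smul 1 c (a : JetL2 2) (idx1 k)
    have h2 : ∀ᵐ x ∂halfVol, ∀ k, grad2 (c • a) 2 k x = c • grad2 a 2 k x :=
      ae_all_iff.2 fun k => wDeriv_smul 1 c (a : JetL2 2) (idx2 2 k)
    filter_upwards [h1, h2] with x hx1 hx2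
    simp only [dStress]
    rw [stress_smul _ _ _ _ _ i 2 x hx1, stress_smul _ _ _ _ _ i 2 x hx1,
      stress_smul _ _ _ _ _ i 2 x hx2]
    ring

/-! ### Very weak solutions -/

/-- The pairing `∫ u · div (ℂ ∇̂φ) dx` of `u ∈ H⁰_{-1}` with the vector field `Lφ = div (ℂ ∇̂φ)`. -/
def pairing (u : weightedSobolev 0 (-1)) (Lφ : E3 → E3) : ℝ :=
  ∫ x, inner ℝ (wDeriv (-1) (u : JetL2 0) (idx0 0) x) (Lφ x) ∂halfVol

/-- The generalized traction `(ℂ ∇̂u) e₃` on `{x₃ = 0}` of `u ∈ H⁰_{-1}` with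
`div (ℂ ∇̂u) = f ∈ V'`: the functional defined through Green's formula
`⟨(ℂ ∇̂u) e₃, v⟩ = ⟨f, v⟩ - ∫ u · div (ℂ ∇̂v) dx` for `v ∈ V`. -/
def traction (h : IsLameMedium M K α₀ β₀ lam mu) (f : StrongDual ℝ (tractionFree h))
    (u : weightedSobolev 0 (-1)) (v : tractionFree h) : ℝ :=
  f v - pairing u (lameOp lam mu (v : weightedSobolev 2 1))

/-- `u ∈ H⁰_{-1}` is a very weak solution of `div (ℂ ∇̂u) = f` in the lower half space,
`(ℂ ∇̂u) e₃ = 0` on `{x₃ = 0}`, where `f ∈ V'`. -/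
structure IsVeryWeakSolution (h : IsLameMedium M K α₀ β₀ lam mu)
    (f : StrongDual ℝ (tractionFree h)) (u : weightedSobolev 0 (-1)) : Prop where
  /-- `div (ℂ ∇̂u) = f` in the sense of distributions: every test field `φ` belongs to `V`, and
  `∫ u · div (ℂ ∇̂φ) dx = ⟨f, φ⟩`. -/
  equation : ∀ φ : 𝓓(lowerHalf, E3), ∃ v : tractionFree h,
    wDeriv 1 (v : JetL2 2) (idx0 2) =ᵐ[halfVol] φ ∧ pairing u (lameOpTest lam mu φ) = f v
  /-- The generalized traction vanishes. -/
  boundary : ∀ v : tractionFree h, traction h f u v = 0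

end Linearity

end HalfSpaceElasticity

end

/-! The proof is by transposition. Let `A v = ϱ div(ℂ ∇̂v)`, a linear map from the traction-free
space `V` to `L²` (`weightedLameOp`). A very weak solution `u = ϱ y` with `y ∈ L²` satisfies `⟨y, A
v⟩ = f v` for all `v ∈ V`, and the norm of `u` in `H⁰_{-1}` is the `L²` norm of `y`. If `‖v‖ ≤ C ‖A
v‖`, then `|f v| ≤ C ‖f‖ ‖A v‖`, so `f` is a functional of `A v`; Hahn–Banach and Riesz
(`exists_riesz`) give `y` with `‖y‖ ≤ C ‖f‖`. If `A` is onto, `y` is unique. Everything thus rests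
on regularity for the strong problem: the estimate `exists_norm_le_lameOp` and the surjectivity
`exists_lameOp_eq`.

Weak solutions live in the energy space `ϱ⁻¹ v ∈ L²`, `∇v ∈ L²`. Restrictions of test functions on
all of space are dense there, so inequalities need only be proved for smooth functions up to the
boundary. Hardy's inequality comes from the field `x / ϱ²`, which is tangential on the boundary and
has divergence at least `ϱ⁻²`. Korn's inequality comes from the pointwise identity between strain,
gradient, divergence and null Lagrangians: integrals of null Lagrangians see only boundary values,
so they can be moved to the other side of the boundary, where Nitsche's reflection bounds them by
the strain alone. With strong convexity the energy form is coercive and Lax–Milgram solves the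
problem for every `g` with `ϱ g ∈ L²`.

For second derivatives, tangential translations preserve the half space. The equation for the
difference `w = v(· + t e_k) - v` is tested with `η² w`, where `η = ϱ / (1 + δ ϱ)`. The weight `η`
is bounded with gradient at most `1`; the decay `K / ϱ` of the gradients of the coefficients exactly
compensates its growth, and `ϱ g ∈ L²` pairs with `ϱ⁻¹` times differences of the test field. The
resulting bound is uniform in `δ`, hence holds with weight `ϱ`, and duality turns it into weak
tangential derivatives of `∇v` (`IsWeakSol.exists_weakD_tangential`). The equation itself expresses
the normal derivative of the normal stress by tangential ones; since `mu` and `lam + 2 mu` are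
bounded below, the second normal derivative can be solved for.

Boundary conditions are handled by the predicate `HasWeak S k u w`: with `S = univ` the test
functions need not vanish on the boundary, and for the normal direction this expresses zero trace.
It makes traction-free elements of `H²_1` the same as regular weak solutions, so the regularity
theorem yields both the a priori estimate and surjectivity. All constants are explicit in `M`, `K`,
`α₀`, `β₀`, apart from numerical factors. -/

noncomputable section

namespace HalfSpaceElasticity

open Filter Topology
open scoped ContDiff Convolution NNReal

/-! ### `L²` bounds for functions dominated by averages. -/

section Averages

/-- Jensen's inequality for the square of an average. -/
lemma sq_lintegral_le {S : Type*} [MeasurableSpace S] (ν : Measure S) [IsProbabilityMeasure ν]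
    {g : S → ℝ≥0∞} (hg : AEMeasurable g ν) : (∫⁻ s, g s ∂ν) ^ 2 ≤ ∫⁻ s, g s ^ 2 ∂ν := by
  have h := ENNReal.lintegral_mul_le_Lp_mul_Lq ν (p := 2) (q := 2)
    (by constructor <;> norm_num) hg (aemeasurable_const (b := (1 : ℝ≥0∞)))
  simp only [Pi.mul_apply, mul_one, ENNReal.one_rpow, lintegral_const, measure_univ] at h
  calc (∫⁻ s, g s ∂ν) ^ 2 ≤ ((∫⁻ s, g s ^ (2 : ℝ) ∂ν) ^ (1 / (2 : ℝ))) ^ 2 := by gcongr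
    _ = ∫⁻ s, g s ^ 2 ∂ν := by
      rw [← ENNReal.rpow_natCast, ← ENNReal.rpow_mul]
      norm_num

lemma eLpNorm_two_sq {E : Type*} [MeasurableSpace E] {F : Type*} [NormedAddCommGroup F]
    (μ : Measure E) (f : E → F) : eLpNorm f 2 μ ^ 2 = ∫⁻ x, ‖f x‖ₑ ^ 2 ∂μ := by
  rw [eLpNorm_eq_lintegral_rpow_enorm_toReal (by norm_num) (by norm_num),
    ← ENNReal.rpow_natCast, ← ENNReal.rpow_mul]
  norm_num

lemma eLpNorm_two_le_of_sq {E : Type*} [MeasurableSpace E] {F : Type*} [NormedAddCommGroup F]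
    {μ : Measure E} {f : E → F} {A : ℝ≥0∞} (h : ∫⁻ x, ‖f x‖ₑ ^ 2 ∂μ ≤ A ^ 2) :
    eLpNorm f 2 μ ≤ A := by
  rw [← eLpNorm_two_sq] at h
  exact (ENNReal.pow_le_pow_left_iff two_ne_zero).1 h

/-- A function dominated by an average of functions is bounded in `L²` by the supremum of their
norms. -/
lemma eLpNorm_le_of_average {S E F : Type*} [MeasurableSpace S] [MeasurableSpace E]
    [NormedAddCommGroup F] (ν : Measure S) [IsProbabilityMeasure ν] {μ : Measure E} [SFinite μ]
    {f : E → F} {g : S → E → ℝ≥0∞} (hg : AEMeasurable (Function.uncurry g) (ν.prod μ))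
    (hf : ∀ᵐ x ∂μ, ‖f x‖ₑ ≤ ∫⁻ s, g s x ∂ν) {A : ℝ≥0∞}
    (hA : ∀ᵐ s ∂ν, ∫⁻ x, g s x ^ 2 ∂μ ≤ A ^ 2) : eLpNorm f 2 μ ≤ A := by
  apply eLpNorm_two_le_of_sq
  -- Joint a.e. measurability gives measurable sections only for almost every `x`, which suffices
  -- for Jensen's inequality.
  have hsec : ∀ᵐ x ∂μ, AEMeasurable (fun s => g s x) ν := by
    obtain ⟨g', hg'm, hgg'⟩ := hg
    have h2 : ∀ᵐ p ∂(μ.prod ν), Function.uncurry g p.swap = g' p.swap :=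
      (Measure.measurePreserving_swap (μ := μ) (ν := ν)).quasiMeasurePreserving.ae hgg'
    filter_upwards [Measure.ae_ae_of_ae_prod h2] with x hx
    exact ⟨fun s => g' (s, x), hg'm.comp measurable_prodMk_right, hx⟩
  calc ∫⁻ x, ‖f x‖ₑ ^ 2 ∂μ ≤ ∫⁻ x, ∫⁻ s, g s x ^ 2 ∂ν ∂μ := by
        apply lintegral_mono_ae
        filter_upwards [hf, hsec] with x hx hm
        exact (pow_le_pow_left₀ (by positivity) hx 2).trans (sq_lintegral_le ν hm)
    _ = ∫⁻ s, ∫⁻ x, g s x ^ 2 ∂μ ∂ν :=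
        lintegral_lintegral_swap (f := fun x s => g s x ^ 2) ((hg.pow_const 2).comp_quasiMeasurePreserving
          (Measure.measurePreserving_swap (μ := μ) (ν := ν)).quasiMeasurePreserving)
    _ ≤ ∫⁻ _, A ^ 2 ∂ν := lintegral_mono_ae hA
    _ = A ^ 2 := by simp

end Averages

/-! ### Convolution with small kernels in `L²`. -/

section Mollification

/-- Translations act continuously on `L²`. -/
lemma tendsto_eLpNorm_translate_sub {F : Type*} [NormedAddCommGroup F] {f : E3 → F} (hf : MemLp f 2 volume) :
    Tendsto (fun y => eLpNorm (fun x => f (x - y) - f x) 2 volume) (𝓝 0) (𝓝 0) := by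
  let g : E3 → C(E3, E3) := fun y => ⟨fun x => x - y, by fun_prop⟩
  have hg : Continuous g := ContinuousMap.continuous_of_continuous_uncurry _
    (by simp only [Function.uncurry_def, g, ContinuousMap.coe_mk]; fun_prop)
  have hgm : ∀ y, MeasurePreserving (g y) (volume : Measure E3) volume := fun y =>
    measurePreserving_sub_right volume y
  have h := (continuous_const (y := hf.toLp f)).compMeasurePreservingLp hg hgm (by norm_num)
  have h2 := (h.tendsto 0).sub (tendsto_const_nhds (x := hf.toLp f))
  have h0 : Lp.compMeasurePreserving (g 0) (hgm 0) (hf.toLp f) - hf.toLp f = 0 := by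
    rw [sub_eq_zero]
    apply Lp.ext
    refine (Lp.coeFn_compMeasurePreserving _ (hgm 0)).trans (Eventually.of_forall fun x => ?_)
    simp [g]
  rw [h0] at h2
  have h3 := (continuous_enorm.tendsto (0 : Lp F 2 (volume : Measure E3))).comp h2
  rw [enorm_zero] at h3
  refine h3.congr fun y => ?_
  simp only [Function.comp]
  rw [Lp.enorm_def]
  apply eLpNorm_congr_ae
  filter_upwards [Lp.coeFn_sub (Lp.compMeasurePreserving (g y) (hgm y) (hf.toLp f)) (hf.toLp f),
    Lp.coeFn_compMeasurePreserving (hf.toLp f) (hgm y), hf.coeFn_toLp,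
    (hgm y).quasiMeasurePreserving.ae hf.coeFn_toLp] with x h1 h2 h3 h4
  rw [h1, Pi.sub_apply, h2, h3, Function.comp, h4]
  rfl

variable {F : Type*} [NormedAddCommGroup F] [NormedSpace ℝ F]

/-- Convolutions with kernels of small support are close to the identity in `L²`. -/
lemma exists_eLpNorm_convolution_sub_le [CompleteSpace F] {f : E3 → F} (hf : MemLp f 2 volume)
    {ε : ℝ≥0∞} (hε : ε ≠ 0) : ∃ δ > 0, ∀ J : E3 → ℝ, Continuous J → HasCompactSupport J →
      (∀ x, 0 ≤ J x) → ∫ x, J x = 1 → (∀ x, J x ≠ 0 → ‖x‖ < δ) →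
      eLpNorm (fun x => (J ⋆[ContinuousLinearMap.lsmul ℝ ℝ, volume] f) x - f x) 2 volume ≤ ε := by
  obtain ⟨δ, hδ, h⟩ := Metric.eventually_nhds_iff.1
    ((tendsto_eLpNorm_translate_sub hf).eventually_le_const (pos_iff_ne_zero.2 hε))
  refine ⟨δ, hδ, fun J hJ hJc hJ0 hJ1 hJs => ?_⟩
  have hJi : Integrable J := hJ.integrable_of_hasCompactSupport hJc
  -- Since `J` is a probability density, `J ⋆ f - f` at `x` is the `ν`-average of `f (x - y) - f x`,
  -- and `ν` charges only `‖y‖ < δ`, where translation moves `f` by at most `ε` in `L²`.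
  let ν : Measure E3 := volume.withDensity fun x => ENNReal.ofReal (J x)
  have hν : IsProbabilityMeasure ν := ⟨by
    rw [withDensity_apply _ MeasurableSet.univ, Measure.restrict_univ,
      ← ofReal_integral_eq_lintegral_ofReal hJi (Eventually.of_forall hJ0), hJ1, ENNReal.ofReal_one]⟩
  have hac : ν ≪ volume := withDensity_absolutelyContinuous _ _
  have hfl : LocallyIntegrable f volume := hf.locallyIntegrable (by norm_num)
  have hmeas : AEStronglyMeasurable (fun p : E3 × E3 => f (p.2 - p.1) - f p.2)
      ((volume : Measure E3).prod volume) := by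
    refine AEStronglyMeasurable.sub ?_ hf.1.comp_snd
    have := (hf.1.comp_quasiMeasurePreserving
      (quasiMeasurePreserving_sub_of_right_invariant (volume : Measure E3) volume))
    exact this.comp_quasiMeasurePreserving
      (Measure.measurePreserving_swap (μ := (volume : Measure E3))
        (ν := (volume : Measure E3))).quasiMeasurePreserving
  refine eLpNorm_le_of_average ν (g := fun y x => ‖f (x - y) - f x‖ₑ) ?_ ?_ ?_
  · exact hmeas.enorm.mono_ac (hac.prod Measure.AbsolutelyContinuous.rfl)
  · filter_upwards with x
    have hc : ConvolutionExistsAt J f x (ContinuousLinearMap.lsmul ℝ ℝ) volume :=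
      hJc.convolutionExists_left _ hJ hfl x
    have h1 : (J ⋆[ContinuousLinearMap.lsmul ℝ ℝ, volume] f) x - f x
        = ∫ y, J y • (f (x - y) - f x) := by
      have h2 : f x = ∫ y, J y • f x := by rw [integral_smul_const, hJ1, one_smul]
      conv_lhs => rw [h2]
      have h3 := integral_sub hc.integrable (hJi.smul_const (f x))
      simp only [ContinuousLinearMap.lsmul_apply] at h3
      rw [convolution_lsmul, ← h3]
      simp only [smul_sub]
    rw [h1]
    refine (enorm_integral_le_lintegral_enorm _).trans_eq ?_
    rw [lintegral_withDensity_eq_lintegral_mul₀ (by fun_prop)]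
    · refine lintegral_congr fun y => ?_
      rw [Pi.mul_apply, enorm_smul, Real.enorm_of_nonneg (hJ0 y)]
    · have : Measure.QuasiMeasurePreserving (fun y : E3 => x - y) volume volume :=
        quasiMeasurePreserving_sub_left _ _
      exact ((hf.1.comp_quasiMeasurePreserving this).sub aestronglyMeasurable_const).enorm
  · have : ∀ᵐ y ∂ν, J y ≠ 0 := by
      have := (ae_withDensity_iff (μ := (volume : Measure E3))
        (f := fun x => ENNReal.ofReal (J x)) (by fun_prop) (p := fun y => J y ≠ 0)).2
      refine this (Eventually.of_forall fun y hy h0 => hy (by simp [h0]))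
    filter_upwards [this] with y hy
    rw [← eLpNorm_two_sq]
    gcongr
    exact h (by simpa using hJs y hy)

end Mollification

/-! ### Weak derivatives on the half space and one-sided mollification. -/

section WeakDerivatives

variable {F : Type*} [NormedAddCommGroup F] [NormedSpace ℝ F]

/-- The classical partial derivative `∂_k φ`. -/
def dd (k : Fin 3) (φ : E3 → F) (x : E3) : F := fderiv ℝ φ x (stdBasis k)

/-- Smooth compactly supported functions on the whole space. -/
structure IsTest (φ : E3 → F) : Prop where
  smooth : ContDiff ℝ ∞ φ
  compact : HasCompactSupport φ

/-- `w` is the weak derivative `∂_k u` on the lower half space. -/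
def WeakD (k : Fin 3) (u w : E3 → F) : Prop :=
  ∀ φ : E3 → ℝ, IsTest φ → tsupport φ ⊆ lowerHalf →
    ∫ x, dd k φ x • u x ∂halfVol = -∫ x, φ x • w x ∂halfVol

/-- Functions of finite energy: `ϱ⁻¹ u ∈ L²` with weak gradient `D` in `L²`. -/
structure IsEnergy (u : E3 → F) (D : Fin 3 → E3 → F) : Prop where
  mem0 : MemLp (fun x => (rho x)⁻¹ • u x) 2 halfVol
  mem1 : ∀ k, MemLp (D k) 2 halfVol
  weak : ∀ k, WeakD k u (D k)

lemma norm_stdBasis (k : Fin 3) : ‖stdBasis k‖ = 1 := by simp [stdBasis]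

lemma one_le_rho (x : E3) : 1 ≤ rho x := Real.one_le_sqrt.2 (by nlinarith [sq_nonneg ‖x‖])

lemma rho_inv_le_one (x : E3) : (rho x)⁻¹ ≤ 1 := inv_le_one_of_one_le₀ (one_le_rho x)

lemma norm_le_rho (x : E3) : ‖x‖ ≤ rho x := Real.le_sqrt_of_sq_le (by linarith)

lemma rho_le_one_add (x : E3) : rho x ≤ 1 + ‖x‖ :=
  Real.sqrt_le_iff.2 ⟨by positivity, by nlinarith [norm_nonneg x]⟩

lemma continuous_rho_inv : Continuous fun x => (rho x)⁻¹ :=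
  continuous_rho.inv₀ fun x => (rho_pos x).ne'

lemma isOpen_lowerHalf : IsOpen (lowerHalf : Set E3) := lowerHalf.isOpen

lemma measurableSet_lowerHalf : MeasurableSet (lowerHalf : Set E3) :=
  isOpen_lowerHalf.measurableSet

instance : IsLocallyFiniteMeasure halfVol := inferInstanceAs
  (IsLocallyFiniteMeasure (volume.restrict (lowerHalf : Set E3)))

instance : SFinite halfVol := inferInstanceAs (SFinite (volume.restrict (lowerHalf : Set E3)))

lemma IsTest.continuous {φ : E3 → F} (h : IsTest φ) : Continuous φ := h.smooth.continuous

lemma IsTest.differentiable {φ : E3 → F} (h : IsTest φ) : Differentiable ℝ φ :=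
  h.smooth.differentiable (by simp)

lemma contDiff_dd {φ : E3 → F} (h : ContDiff ℝ ∞ φ) (k : Fin 3) : ContDiff ℝ ∞ (dd k φ) :=
  (h.fderiv_right (m := ∞) (by simp)).clm_apply contDiff_const

lemma tsupport_dd_subset (φ : E3 → F) (k : Fin 3) : tsupport (dd k φ) ⊆ tsupport φ :=
  (closure_mono fun x (hx : dd k φ x ≠ 0) (h0 : fderiv ℝ φ x = 0) => hx (by simp [dd, h0])).trans (tsupport_fderiv_subset ℝ)

lemma IsTest.deriv {φ : E3 → F} (h : IsTest φ) (k : Fin 3) : IsTest (dd k φ) :=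
  ⟨contDiff_dd h.smooth k, h.compact.mono' (subset_closure.trans (tsupport_dd_subset φ k))⟩

lemma IsTest.smul {θ : E3 → ℝ} {φ : E3 → F} (hθ : ContDiff ℝ ∞ θ) (h : IsTest φ) :
    IsTest (fun x => θ x • φ x) := ⟨hθ.smul h.smooth, h.compact.smul_left⟩

lemma IsTest.smul' {θ : E3 → ℝ} {φ : E3 → F} (hθ : IsTest θ) (h : ContDiff ℝ ∞ φ) :
    IsTest (fun x => θ x • φ x) := ⟨hθ.smooth.smul h, hθ.compact.smul_right⟩

lemma IsTest.memLp {φ : E3 → F} (h : IsTest φ) : MemLp φ 2 halfVol :=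
  (h.continuous.memLp_of_hasCompactSupport (μ := volume) h.compact).restrict _

lemma dd_smul {θ : E3 → ℝ} {φ : E3 → F} {x : E3} (hθ : DifferentiableAt ℝ θ x)
    (hφ : DifferentiableAt ℝ φ x) (k : Fin 3) :
    dd k (fun x => θ x • φ x) x = θ x • dd k φ x + dd k θ x • φ x := by
  simp [dd, fderiv_fun_smul hθ hφ]

lemma dd_mul {θ φ : E3 → ℝ} {x : E3} (hθ : DifferentiableAt ℝ θ x)
    (hφ : DifferentiableAt ℝ φ x) (k : Fin 3) :
    dd k (fun x => θ x * φ x) x = θ x * dd k φ x + dd k θ x * φ x := dd_smul hθ hφ k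

lemma locallyIntegrable_of_memLp_rho_inv_smul {u : E3 → F}
    (h : MemLp (fun x => (rho x)⁻¹ • u x) 2 halfVol) : LocallyIntegrable u halfVol := by
  have := (h.locallyIntegrable (by norm_num)).continuous_smul continuous_rho
  refine this.congr (Eventually.of_forall fun x => ?_)
  simp [smul_smul, mul_inv_cancel₀ (rho_pos x).ne']

lemma IsEnergy.locallyIntegrable {u : E3 → F} {D : Fin 3 → E3 → F} (h : IsEnergy u D) :
    LocallyIntegrable u halfVol := locallyIntegrable_of_memLp_rho_inv_smul h.mem0

lemma IsTest.integrable_smul {φ : E3 → ℝ} (h : IsTest φ) {u : E3 → F}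
    (hu : LocallyIntegrable u halfVol) : Integrable (fun x => φ x • u x) halfVol :=
  hu.integrable_smul_left_of_hasCompactSupport h.continuous h.compact

/-- The product rule with a smooth function. -/
lemma WeakD.smul {k : Fin 3} {u w : E3 → F} (h : WeakD k u w) (hu : LocallyIntegrable u halfVol)
    (hw : LocallyIntegrable w halfVol) {θ : E3 → ℝ} (hθ : ContDiff ℝ ∞ θ) :
    WeakD k (fun x => θ x • u x) (fun x => θ x • w x + dd k θ x • u x) := by
  intro φ hφ hs
  have h1 : IsTest (fun x => φ x * θ x) := hφ.smul' hθ
  have h2 := h _ h1 ((tsupport_mul_subset_left (f := φ) (g := θ)).trans hs)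
  have hd : ∀ x, dd k (fun x => φ x * θ x) x = φ x * dd k θ x + dd k φ x * θ x := fun x =>
    dd_mul hφ.differentiable.differentiableAt
      (hθ.differentiable (by simp)).differentiableAt k
  have i1 : Integrable (fun x => (φ x * dd k θ x) • u x) halfVol :=
    (hφ.smul' (contDiff_dd hθ k)).integrable_smul hu
  have i2 : Integrable (fun x => (dd k φ x * θ x) • u x) halfVol :=
    ((hφ.deriv k).smul' hθ).integrable_smul hu
  have i3 : Integrable (fun x => (φ x * θ x) • w x) halfVol := h1.integrable_smul hw
  simp only [hd, add_smul] at h2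
  rw [integral_add i1 i2] at h2
  simp only [smul_smul, smul_add]
  rw [integral_add i3 i1, neg_add, ← h2]
  abel

lemma WeakD.congr {k : Fin 3} {u w u' w' : E3 → F} (h : WeakD k u w) (hu : u =ᵐ[halfVol] u')
    (hw : w =ᵐ[halfVol] w') : WeakD k u' w' := by
  intro φ hφ hs
  have := h φ hφ hs
  have e1 : ∫ x, dd k φ x • u x ∂halfVol = ∫ x, dd k φ x • u' x ∂halfVol :=
    integral_congr_ae (hu.mono fun x hx => by simp only [hx])
  have e2 : ∫ x, φ x • w x ∂halfVol = ∫ x, φ x • w' x ∂halfVol :=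
    integral_congr_ae (hw.mono fun x hx => by simp only [hx])
  rwa [e1, e2] at this

lemma eLpNorm_mollify_half_le {F : Type*} [NormedAddCommGroup F] (f g : E3 → F) :
    eLpNorm (fun x => g x - f x) 2 halfVol
      ≤ eLpNorm (fun x => g x - (lowerHalf : Set E3).indicator f x) 2 volume := by
  have h : eLpNorm (fun x => g x - (lowerHalf : Set E3).indicator f x) 2 halfVol
      ≤ eLpNorm (fun x => g x - (lowerHalf : Set E3).indicator f x) 2 volume :=
    eLpNorm_mono_measure _ Measure.restrict_le_self
  refine le_trans (le_of_eq ?_) h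
  apply eLpNorm_congr_ae
  filter_upwards [ae_restrict_mem measurableSet_lowerHalf] with x hx
  rw [indicator_of_mem hx]

lemma integral_indicator_conv (J : E3 → ℝ) (f : E3 → F) (x : E3) :
    ∫ t, J t • (lowerHalf : Set E3).indicator f (x - t) = ∫ z, J (x - z) • f z ∂halfVol := by
  rw [← integral_sub_left_eq_self (fun t => J t • (lowerHalf : Set E3).indicator f (x - t)) _ x]
  simp only [sub_sub_cancel]
  rw [halfVol, ← integral_indicator measurableSet_lowerHalf]
  refine integral_congr_ae (Eventually.of_forall fun z => ?_)
  simp only [indicator]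
  split_ifs <;> simp

/-- Mollification with a kernel supported in the upper half space commutes with weak derivatives
in the lower half space. -/
lemma dd_convolution_indicator [CompleteSpace F] {k : Fin 3} {u w : E3 → F} (h : WeakD k u w)
    (hu : LocallyIntegrable ((lowerHalf : Set E3).indicator u) volume) {J : E3 → ℝ}
    (hJ : IsTest J) (hJs : ∀ y ∈ tsupport J, 0 < y 2) {x : E3} (hx : x ∈ lowerHalf) :
    dd k (J ⋆[ContinuousLinearMap.lsmul ℝ ℝ, volume] ((lowerHalf : Set E3).indicator u)) x
      = (J ⋆[ContinuousLinearMap.lsmul ℝ ℝ, volume] ((lowerHalf : Set E3).indicator w)) x := by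
  have h1 := hJ.compact.hasFDerivAt_convolution_left (ContinuousLinearMap.lsmul ℝ ℝ)
    (hJ.smooth.of_le (by simp)) hu x
  rw [dd, h1.fderiv, convolution_lsmul, integral_indicator_conv]
  have hc := (hJ.compact.fderiv (𝕜 := ℝ)).convolutionExists_left
    (ContinuousLinearMap.precompL E3 (ContinuousLinearMap.lsmul ℝ ℝ : ℝ →L[ℝ] F →L[ℝ] F))
    (hJ.smooth.continuous_fderiv (by simp)) hu x
  rw [convolution_def, ContinuousLinearMap.integral_apply hc.integrable]
  have h2 : IsTest (fun z => J (x - z)) :=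
    ⟨hJ.smooth.comp (contDiff_const.sub contDiff_id),
      hJ.compact.comp_homeomorph (Homeomorph.subLeft x)⟩
  -- A point `z` with `x - z` in the support of `J` lies strictly below `x`, so for `x` in the half
  -- space this kernel is an admissible test function, although the zero extension of `u` jumps
  -- across the boundary.
  have h3 : tsupport (fun z => J (x - z)) ⊆ lowerHalf := by
    intro z hz
    have : x - z ∈ tsupport J := by
      have := tsupport_comp_subset_preimage J (f := fun z => x - z) (by fun_prop) hz
      exact this
    have h4 := hJs _ this
    have h5 : x 2 < 0 := hx
    have h6 : (x - z) 2 = x 2 - z 2 := rfl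
    show z 2 < 0
    linarith
  have h4 := h _ h2 h3
  have h5 : ∀ z, dd k (fun z => J (x - z)) z = -dd k J (x - z) := by
    intro z
    have := (hJ.differentiable (x - z)).hasFDerivAt.comp z ((hasFDerivAt_id z).const_sub x)
    rw [dd, HasFDerivAt.fderiv (f := fun z => J (x - z)) this]
    simp [dd]
  simp only [h5, neg_smul, integral_neg, neg_inj] at h4
  rw [← h4, ← integral_indicator_conv (dd k J) u x]
  rfl

/-- Density of smooth functions, for square integrable functions of bounded support. -/
lemma exists_isTest_near_of_bounded [CompleteSpace F] {u : E3 → F} {D : Fin 3 → E3 → F}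
    (hu : MemLp u 2 halfVol) (hD : ∀ k, MemLp (D k) 2 halfVol) (hw : ∀ k, WeakD k u (D k))
    {R : ℝ} (hR : ∀ x, R ≤ ‖x‖ → u x = 0) {ε : ℝ≥0∞} (hε : ε ≠ 0) :
    ∃ φ : E3 → F, IsTest φ ∧ eLpNorm (fun x => φ x - u x) 2 halfVol ≤ ε ∧
      ∀ k, eLpNorm (fun x => dd k φ x - D k x) 2 halfVol ≤ ε := by
  have hind : ∀ {f : E3 → F}, MemLp f 2 halfVol →
      MemLp ((lowerHalf : Set E3).indicator f) 2 volume := fun hf =>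
    (memLp_indicator_iff_restrict measurableSet_lowerHalf).2 hf
  obtain ⟨δ, hδ, h0⟩ := exists_eLpNorm_convolution_sub_le (hind hu) hε
  choose δ' hδ' h1 using fun k => exists_eLpNorm_convolution_sub_le (hind (hD k)) hε
  obtain ⟨t, ht, ht0, htk⟩ : ∃ t > 0, 2 * t ≤ δ ∧ ∀ k, 2 * t ≤ δ' k := by
    have : ∀ᶠ t in 𝓝[>] (0 : ℝ), 2 * t ≤ δ ∧ ∀ k, 2 * t ≤ δ' k := by
      have hc : Tendsto (fun t : ℝ => 2 * t) (𝓝[>] 0) (𝓝 0) := by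
        have : Tendsto (fun t : ℝ => 2 * t) (𝓝 0) (𝓝 (2 * 0)) := tendsto_id.const_mul 2
        rw [mul_zero] at this
        exact this.mono_left nhdsWithin_le_nhds
      exact (hc.eventually_le_const hδ).and (eventually_all.2 fun k => hc.eventually_le_const (hδ' k))
    obtain ⟨t, h, h'⟩ := (this.and self_mem_nhdsWithin).exists
    exact ⟨t, h', h⟩
  -- Centre `t e₃` and radius `t / 2` keep the kernel in the upper half space and in the ball of
  -- radius `3t / 2 < 2t`.
  let b : ContDiffBump (t • stdBasis 2) := ⟨t / 4, t / 2, by positivity, by linarith⟩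
  let J := b.normed (volume : Measure E3)
  have hJ : IsTest J := ⟨b.contDiff_normed, b.hasCompactSupport_normed⟩
  have hJ0 : ∀ x, 0 ≤ J x := fun x => b.nonneg_normed x
  have hJ1 : ∫ x, J x = 1 := b.integral_normed
  have hJb : ∀ x, x ∈ tsupport J → ‖x - t • stdBasis 2‖ ≤ t / 2 := by
    intro x hx
    have : x ∈ Metric.closedBall (t • stdBasis 2) (t / 2) := by
      have h := b.tsupport_normed_eq (μ := (volume : Measure E3))
      rw [← show b.rOut = t / 2 from rfl, ← h]; exact hx
    simpa [dist_eq_norm] using this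
  have hJs : ∀ y ∈ tsupport J, 0 < y 2 := by
    intro y hy
    have h1 := (PiLp.norm_apply_le (y - t • stdBasis 2) (2 : Fin 3)).trans (hJb y hy)
    have h2 : (y - t • stdBasis 2) 2 = y 2 - t := by simp [stdBasis]
    rw [h2, Real.norm_eq_abs] at h1
    linarith [(abs_le.1 h1).1]
  have hJn : ∀ {d : ℝ}, 2 * t ≤ d → ∀ x, J x ≠ 0 → ‖x‖ < d := by
    intro d hd x hx
    have h1 := hJb x (subset_tsupport J hx)
    have h2 : ‖t • stdBasis 2‖ = t := by rw [norm_smul, norm_stdBasis, mul_one, Real.norm_of_nonneg ht.le]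
    have h3 := norm_le_norm_add_norm_sub' x (t • stdBasis 2)
    linarith
  have hli : LocallyIntegrable ((lowerHalf : Set E3).indicator u) volume :=
    (hind hu).locallyIntegrable (by norm_num)
  refine ⟨J ⋆[ContinuousLinearMap.lsmul ℝ ℝ, volume] ((lowerHalf : Set E3).indicator u),
    ⟨hJ.compact.contDiff_convolution_left _ hJ.smooth hli, ?_⟩, ?_, fun k => ?_⟩
  · refine hJ.compact.convolution _ (HasCompactSupport.intro (isCompact_closedBall (0 : E3) R) ?_)
    intro x hx
    rw [Metric.mem_closedBall, dist_zero_right, not_le] at hx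
    simp [indicator, hR x hx.le]
  · exact (eLpNorm_mollify_half_le _ _).trans (h0 J hJ.continuous hJ.compact hJ0 hJ1 (hJn ht0))
  · refine le_trans (le_of_eq (eLpNorm_congr_ae ?_)) ((eLpNorm_mollify_half_le _ _).trans
      (h1 k J hJ.continuous hJ.compact hJ0 hJ1 (hJn (htk k))))
    filter_upwards [ae_restrict_mem measurableSet_lowerHalf] with x hx
    rw [dd_convolution_indicator (hw k) hli hJ hJs hx]

end WeakDerivatives

/-! ### Cutoffs and density of test functions in the energy space. -/

section Density

/-- One bump is rescaled, so its gradient is of order `1 / R`. On `‖x‖ ≤ 2R` with `R ≥ 1` one has `ϱ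
≤ 3R`, which turns this into a multiple of `ϱ⁻¹` independent of `R`. This is what bounds the
commutator `(∂χ) u` by a tail of `ϱ⁻¹ u`. -/
lemma exists_cutoff : ∃ B : ℝ, 0 ≤ B ∧ ∀ R : ℝ, 1 ≤ R → ∃ χ : E3 → ℝ, IsTest χ ∧
    (∀ x, 0 ≤ χ x) ∧ (∀ x, χ x ≤ 1) ∧ (∀ x, ‖x‖ ≤ R → χ x = 1) ∧ (∀ x, 2 * R ≤ ‖x‖ → χ x = 0) ∧
    (∀ k x, |dd k χ x| ≤ B * (rho x)⁻¹) ∧ ∀ k x, ‖x‖ < R → dd k χ x = 0 := by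
  let b : ContDiffBump (0 : E3) := ⟨1, 2, by norm_num, by norm_num⟩
  have hb : IsTest b := ⟨b.contDiff, b.hasCompactSupport⟩
  obtain ⟨B, hB⟩ := (hb.smooth.continuous_fderiv (by simp)).bounded_above_of_compact_support
    (hb.compact.fderiv (𝕜 := ℝ))
  have hB0 : 0 ≤ B := (norm_nonneg _).trans (hB 0)
  refine ⟨3 * B, by positivity, fun R hR => ?_⟩
  have hR0 : 0 < R := by linarith
  have hn : ∀ x : E3, ‖R⁻¹ • x‖ = ‖x‖ / R := fun x => by
    rw [norm_smul, norm_inv, Real.norm_of_nonneg hR0.le]; ring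
  have hone : ∀ x : E3, ‖x‖ ≤ R → b (R⁻¹ • x) = 1 := fun x hx => b.one_of_mem_closedBall (by
    rw [mem_closedBall_zero_iff, hn]; exact (div_le_one hR0).2 hx)
  have hzero : ∀ x : E3, 2 * R ≤ ‖x‖ → b (R⁻¹ • x) = 0 := fun x hx => b.zero_of_le_dist (by
    rw [dist_zero_right, hn]; exact (le_div_iff₀ hR0).2 hx)
  have hsm : ContDiff ℝ ∞ (fun x : E3 => b (R⁻¹ • x)) :=
    hb.smooth.comp (contDiff_const_smul R⁻¹)
  have hfd : ∀ k x, dd k (fun x : E3 => b (R⁻¹ • x)) x = R⁻¹ * dd k b (R⁻¹ • x) := by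
    intro k x
    simp only [dd]
    rw [fderiv_comp_smul]
    simp
  refine ⟨fun x => b (R⁻¹ • x), ⟨hsm, HasCompactSupport.intro (isCompact_closedBall (0 : E3) (2 * R))
    fun x hx => hzero x ?_⟩, fun x => b.nonneg, fun x => b.le_one, hone, hzero, fun k x => ?_,
    fun k x hx => ?_⟩
  · rw [mem_closedBall_zero_iff, not_le] at hx
    exact hx.le
  · by_cases hx : ‖x‖ ≤ 2 * R
    · rw [hfd, abs_mul, abs_of_pos (inv_pos.2 hR0)]
      have h1 : |dd k b (R⁻¹ • x)| ≤ B := by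
        refine ((fderiv ℝ b (R⁻¹ • x)).le_opNorm (stdBasis k)).trans ?_
        rw [norm_stdBasis, mul_one]
        exact hB _
      have h2 : R⁻¹ ≤ 3 * (rho x)⁻¹ := by
        rw [← div_eq_mul_inv, le_div_iff₀ (rho_pos x), inv_mul_le_iff₀ hR0]
        linarith [rho_le_one_add x]
      calc R⁻¹ * |dd k b (R⁻¹ • x)| ≤ 3 * (rho x)⁻¹ * B := by
            gcongr
            have := rho_pos x
            positivity
        _ = 3 * B * (rho x)⁻¹ := by ring
    · have : (fun x : E3 => b (R⁻¹ • x)) =ᶠ[𝓝 x] fun _ => 0 := by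
        filter_upwards [(isOpen_lt continuous_const continuous_norm).mem_nhds (not_le.1 hx)] with y hy
        exact hzero y (le_of_lt hy)
      have h0 : dd k (fun x : E3 => b (R⁻¹ • x)) x = 0 := by
        rw [dd, this.fderiv_eq]; simp
      have := rho_pos x
      rw [h0, abs_zero]
      positivity
  · have : (fun x : E3 => b (R⁻¹ • x)) =ᶠ[𝓝 x] fun _ => 1 := by
      filter_upwards [(isOpen_lt continuous_norm continuous_const).mem_nhds hx] with y hy
      exact hone y (le_of_lt hy)
    rw [dd, this.fderiv_eq]
    simp

variable {F : Type*} [NormedAddCommGroup F] [NormedSpace ℝ F]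

instance : Measure.Regular halfVol := inferInstanceAs
  (Measure.Regular (volume.restrict (lowerHalf : Set E3)))

lemma exists_tail_le {f : E3 → F} (hf : MemLp f 2 halfVol) {ε : ℝ≥0∞} (hε : ε ≠ 0) :
    ∃ R0 : ℝ, ∀ R, R0 ≤ R → eLpNorm ({x | R ≤ ‖x‖}.indicator f) 2 halfVol ≤ ε := by
  obtain ⟨g, hg, hfg, -, -⟩ := hf.exists_hasCompactSupport_eLpNorm_sub_le (by norm_num) hε
  obtain ⟨r, hr⟩ := hg.isCompact.isBounded.subset_closedBall (0 : E3)
  refine ⟨r + 1, fun R hR => le_trans (eLpNorm_mono fun x => ?_) hfg⟩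
  by_cases hx : x ∈ {x : E3 | R ≤ ‖x‖}
  · have h0 : g x = 0 := by
      by_contra h
      have h1 := hr (subset_tsupport g h)
      rw [mem_closedBall_zero_iff] at h1
      have : R ≤ ‖x‖ := hx
      linarith
    rw [indicator_of_mem hx, Pi.sub_apply, h0, sub_zero]
  · rw [indicator_of_notMem hx, norm_zero]
    positivity

lemma _root_.MeasureTheory.MemLp.bdd_smul {f : E3 → F} (hf : MemLp f 2 halfVol) {c : E3 → ℝ}
    (hc : AEStronglyMeasurable c halfVol) {B : ℝ} (hB : ∀ᵐ x ∂halfVol, |c x| ≤ B) :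
    MemLp (fun x => c x • f x) 2 halfVol := by
  refine hf.of_le_mul (c := B) (hc.smul hf.1) ?_
  filter_upwards [hB] with x hx
  rw [norm_smul]
  exact mul_le_mul_of_nonneg_right hx (norm_nonneg _)

/-- Smooth compactly supported functions on the whole space are dense in the energy space. -/
theorem IsEnergy.exists_isTest_near [CompleteSpace F] {u : E3 → F} {D : Fin 3 → E3 → F}
    (h : IsEnergy u D) {ε : ℝ≥0∞} (hε : ε ≠ 0) :
    ∃ φ : E3 → F, IsTest φ ∧ eLpNorm (fun x => (rho x)⁻¹ • (φ x - u x)) 2 halfVol ≤ ε ∧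
      ∀ k, eLpNorm (fun x => dd k φ x - D k x) 2 halfVol ≤ ε := by
  obtain ⟨B, hB, hcut⟩ := exists_cutoff
  have hε3 : ε / 3 ≠ 0 := (ENNReal.div_pos hε (by norm_num)).ne'
  -- Truncation at radius `R` costs three tails: of `ϱ⁻¹ u`, of `B ϱ⁻¹ u` (which dominates `(∂χ)
  -- u`), and of the gradient. The remaining `ε / 3` is spent on mollification.
  obtain ⟨R0, hR0⟩ := exists_tail_le h.mem0 hε3
  obtain ⟨R1, hR1⟩ := exists_tail_le (h.mem0.const_smul B) hε3
  choose R2 hR2 using fun k => exists_tail_le (h.mem1 k) hε3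
  obtain ⟨R, hRR0, hRR1, hRR2, hR⟩ : ∃ R, R0 ≤ R ∧ R1 ≤ R ∧ (∀ k, R2 k ≤ R) ∧ 1 ≤ R :=
    ((eventually_ge_atTop R0).and ((eventually_ge_atTop R1).and
      ((eventually_all.2 fun k => eventually_ge_atTop (R2 k)).and (eventually_ge_atTop 1)))).exists
  obtain ⟨χ, hχ, hχ0, hχ1, hχR, hχ2, hχd, hχd0⟩ := hcut R hR
  set u' : E3 → F := fun x => χ x • u x with hu'
  set D' : Fin 3 → E3 → F := fun k x => χ x • D k x + dd k χ x • u x with hD'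
  have hu'm : MemLp u' 2 halfVol := by
    have hc : Continuous fun x => χ x * rho x := hχ.continuous.mul continuous_rho
    obtain ⟨C, hC⟩ := hc.bounded_above_of_compact_support hχ.compact.mul_right
    refine (h.mem0.bdd_smul hc.aestronglyMeasurable (Eventually.of_forall hC)).ae_eq
      (Eventually.of_forall fun x => ?_)
    simp [hu', smul_smul, mul_assoc, mul_inv_cancel₀ (rho_pos x).ne']
  have hD'm : ∀ k, MemLp (D' k) 2 halfVol := by
    intro k
    refine ((h.mem1 k).bdd_smul hχ.continuous.aestronglyMeasurable (B := 1)
      (Eventually.of_forall fun x => by rw [abs_of_nonneg (hχ0 x)]; exact hχ1 x)).add ?_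
    have hc : Continuous fun x => dd k χ x * rho x := (hχ.deriv k).continuous.mul continuous_rho
    obtain ⟨C, hC⟩ := hc.bounded_above_of_compact_support (hχ.deriv k).compact.mul_right
    refine (h.mem0.bdd_smul hc.aestronglyMeasurable (Eventually.of_forall hC)).ae_eq
      (Eventually.of_forall fun x => ?_)
    simp [smul_smul, mul_assoc, mul_inv_cancel₀ (rho_pos x).ne']
  have hw' : ∀ k, WeakD k u' (D' k) := fun k => (h.weak k).smul h.locallyIntegrable
    ((h.mem1 k).locallyIntegrable (by norm_num)) hχ.smooth
  obtain ⟨φ, hφ, h1, h2⟩ := exists_isTest_near_of_bounded hu'm hD'm hw' (R := 2 * R)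
    (fun x hx => by simp [hu', hχ2 x hx]) hε3
  have hthird : ε / 3 + ε / 3 + ε / 3 = ε := ENNReal.add_thirds ε
  have hle : ε / 3 + ε / 3 ≤ ε := le_trans (le_add_right le_rfl) hthird.le
  have hind : ∀ (f : E3 → F) (x : E3), ‖(1 - χ x) • f x‖ ≤ ‖{x | R ≤ ‖x‖}.indicator f x‖ := by
    intro f x
    by_cases hx : x ∈ {x : E3 | R ≤ ‖x‖}
    · rw [indicator_of_mem hx, norm_smul, Real.norm_of_nonneg (by linarith [hχ1 x])]
      exact mul_le_of_le_one_left (norm_nonneg _) (by linarith [hχ0 x])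
    · have hx' : ‖x‖ < R := not_le.1 hx
      rw [indicator_of_notMem hx, hχR x hx'.le]
      simp
  refine ⟨φ, hφ, ?_, fun k => ?_⟩
  · have e : (fun x => (rho x)⁻¹ • (φ x - u x))
        = (fun x => (rho x)⁻¹ • (φ x - u' x)) + fun x => -((1 - χ x) • ((rho x)⁻¹ • u x)) := by
      ext1 x
      simp only [hu', Pi.add_apply, smul_sub, sub_smul, one_smul, smul_comm (χ x)]
      abel
    have hm : AEStronglyMeasurable (fun x => (rho x)⁻¹ • (φ x - u' x)) halfVol :=
      continuous_rho_inv.aestronglyMeasurable.smul (hφ.continuous.aestronglyMeasurable.sub hu'm.1)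
    have hm' : AEStronglyMeasurable (fun x => -((1 - χ x) • ((rho x)⁻¹ • u x))) halfVol :=
      ((continuous_const.sub hχ.continuous).aestronglyMeasurable.smul h.mem0.1).neg
    rw [e]
    refine (eLpNorm_add_le hm hm' (by norm_num)).trans (le_trans (add_le_add ?_ ?_) hle)
    · refine le_trans (eLpNorm_mono fun x => ?_) h1
      rw [norm_smul, Real.norm_of_nonneg (inv_nonneg.2 (rho_pos x).le)]
      exact mul_le_of_le_one_left (norm_nonneg _) (rho_inv_le_one x)
    · refine le_trans (eLpNorm_mono fun x => ?_) (hR0 R hRR0)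
      rw [norm_neg]
      exact hind (fun x => (rho x)⁻¹ • u x) x
  · have e : (fun x => dd k φ x - D k x) = (fun x => dd k φ x - D' k x)
        + (fun x => -((1 - χ x) • D k x)) + fun x => dd k χ x • u x := by
      ext1 x
      simp only [hD', Pi.add_apply, sub_smul, one_smul]
      abel
    have hm : AEStronglyMeasurable (fun x => dd k φ x - D' k x) halfVol :=
      (hφ.deriv k).continuous.aestronglyMeasurable.sub (hD'm k).1
    have hm' : AEStronglyMeasurable (fun x => -((1 - χ x) • D k x)) halfVol :=
      ((continuous_const.sub hχ.continuous).aestronglyMeasurable.smul (h.mem1 k).1).neg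
    have hm2 : AEStronglyMeasurable (fun x => dd k χ x • u x) halfVol :=
      (hχ.deriv k).continuous.aestronglyMeasurable.smul h.locallyIntegrable.aestronglyMeasurable
    rw [e]
    refine (eLpNorm_add_le (hm.add hm') hm2 (by norm_num)).trans
      (le_trans (add_le_add ((eLpNorm_add_le hm hm' (by norm_num)).trans
        (add_le_add (h2 k) ?_)) ?_) hthird.le)
    · refine le_trans (eLpNorm_mono fun x => ?_) (hR2 k R (hRR2 k))
      rw [norm_neg]
      exact hind _ x
    · refine le_trans (eLpNorm_mono fun x => ?_) (hR1 R hRR1)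
      by_cases hx : x ∈ {x : E3 | R ≤ ‖x‖}
      · rw [indicator_of_mem hx, Pi.smul_apply, norm_smul, norm_smul, norm_smul,
          Real.norm_of_nonneg hB, Real.norm_of_nonneg (inv_nonneg.2 (rho_pos x).le), ← mul_assoc]
        exact mul_le_mul_of_nonneg_right (hχd k x) (norm_nonneg _)
      · have hx' : ‖x‖ < R := not_le.1 hx
        rw [hχd0 k x hx']
        simp

end Density

/-! ### Integrals of derivatives over the half space. -/

section Boundary

lemma IsTest.exists_lipschitzWith {F : Type*} [NormedAddCommGroup F] [NormedSpace ℝ F] {φ : E3 → F}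
    (h : IsTest φ) : ∃ L, LipschitzWith L φ :=
  ContDiff.lipschitzWith_of_hasCompactSupport h.compact h.smooth (by simp)

lemma ae_dd_eq_lineDeriv {G : E3 → ℝ} {L : ℝ≥0} (hG : LipschitzWith L G) (k : Fin 3) :
    ∀ᵐ x, dd k G x = lineDeriv ℝ G x (stdBasis k) := by
  filter_upwards [hG.ae_differentiableAt (μ := volume)] with x hx
  exact hx.lineDeriv_eq_fderiv.symm

/-- Integration by parts against the constant `1`, where only one of the two Lipschitz factors has
to have compact support. -/
lemma integral_lineDeriv_eq_zero {G : E3 → ℝ} {L : ℝ≥0} (hG : LipschitzWith L G)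
    (hc : HasCompactSupport G) (v : E3) : ∫ x, lineDeriv ℝ G x v = 0 := by
  have h := (LipschitzWith.const (1 : ℝ)).integral_lineDeriv_mul_eq (μ := (volume : Measure E3))
    hG hc (-v)
  have h1 : ∀ x : E3, lineDeriv ℝ (fun _ : E3 => (1 : ℝ)) x (-v) = 0 := fun x => by simp [lineDeriv]
  simpa [h1] using h.symm

lemma IsTest.integral_dd_eq_zero {G : E3 → ℝ} (hG : IsTest G) (k : Fin 3) :
    ∫ x, dd k G x = 0 := by
  obtain ⟨L, hL⟩ := hG.exists_lipschitzWith
  rw [integral_congr_ae (ae_dd_eq_lineDeriv hL k), integral_lineDeriv_eq_zero hL hG.compact]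

lemma volume_boundary : volume {x : E3 | x 2 = 0} = 0 := by
  let p : E3 →ₗ[ℝ] ℝ := (EuclideanSpace.proj (𝕜 := ℝ) (2 : Fin 3)).toLinearMap
  have h : (LinearMap.ker p : Set E3) = {x : E3 | x 2 = 0} := by
    ext x; simp [p]
  rw [← h]
  refine Measure.addHaar_submodule _ _ fun ht => ?_
  have : stdBasis 2 ∈ LinearMap.ker p := by rw [ht]; trivial
  simp [p, stdBasis] at this

/-- The integral over the half space of the normal derivative of a function vanishing on the
boundary is zero. -/
lemma IsTest.integral_dd_two_eq_zero {G : E3 → ℝ} (hG : IsTest G)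
    (h0 : ∀ x : E3, x 2 = 0 → G x = 0) : ∫ x, dd 2 G x ∂halfVol = 0 := by
  obtain ⟨L, hL⟩ := hG.exists_lipschitzWith
  -- `G` vanishes at the vertical projection of `x` to the boundary, and that projection is no
  -- farther from `x` than any `y` on the other side. Hence the extension of `G` by zero is still
  -- Lipschitz.
  have hcross : ∀ x y : E3, x 2 < 0 → ¬ y 2 < 0 → |G x| ≤ L * ‖x - y‖ := by
    intro x y hx hy
    have hz : G (x - x 2 • stdBasis 2) = 0 := h0 _ (by simp [stdBasis])
    have h1 := hL.norm_sub_le x (x - x 2 • stdBasis 2)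
    rw [hz, sub_zero, sub_sub_cancel, norm_smul, norm_stdBasis, mul_one, Real.norm_eq_abs,
      Real.norm_eq_abs] at h1
    have h2 := PiLp.norm_apply_le (x - y) (2 : Fin 3)
    rw [PiLp.sub_apply, Real.norm_eq_abs] at h2
    refine h1.trans (mul_le_mul_of_nonneg_left (le_trans ?_ h2) L.2)
    rw [abs_of_neg hx, abs_of_neg (by linarith [not_lt.1 hy])]
    linarith [not_lt.1 hy]
  have hLip : LipschitzWith L ((lowerHalf : Set E3).indicator G) := by
    refine LipschitzWith.of_dist_le_mul fun x y => ?_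
    rw [dist_eq_norm, dist_eq_norm, Real.norm_eq_abs]
    by_cases hx : x ∈ (lowerHalf : Set E3) <;> by_cases hy : y ∈ (lowerHalf : Set E3)
    · rw [indicator_of_mem hx, indicator_of_mem hy]
      exact hL.norm_sub_le x y
    · rw [indicator_of_mem hx, indicator_of_notMem hy, sub_zero]
      exact hcross x y hx hy
    · rw [indicator_of_notMem hx, indicator_of_mem hy, zero_sub, abs_neg, norm_sub_rev]
      exact hcross y x hy hx
    · rw [indicator_of_notMem hx, indicator_of_notMem hy, sub_zero, abs_zero]
      positivity
  have hcs : HasCompactSupport ((lowerHalf : Set E3).indicator G) :=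
    hG.compact.mono (by rw [support_indicator]; exact inter_subset_right)
  have h1 := integral_lineDeriv_eq_zero hLip hcs (stdBasis 2)
  rw [halfVol, ← integral_indicator measurableSet_lowerHalf, ← h1]
  refine integral_congr_ae ?_
  filter_upwards [measure_eq_zero_iff_ae_notMem.1 volume_boundary, ae_dd_eq_lineDeriv hLip 2]
    with x hx hx2
  rw [← hx2]
  by_cases hxl : x ∈ (lowerHalf : Set E3)
  · rw [indicator_of_mem hxl, dd, dd, Filter.EventuallyEq.fderiv_eq]
    filter_upwards [isOpen_lowerHalf.mem_nhds hxl] with y hy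
    rw [indicator_of_mem hy]
  · have hxp : 0 < x 2 := lt_of_le_of_ne (not_lt.1 hxl) (Ne.symm hx)
    have : (lowerHalf : Set E3).indicator G =ᶠ[𝓝 x] fun _ => 0 := by
      filter_upwards [(isOpen_lt continuous_const (by fun_prop : Continuous fun x : E3 => x 2)).mem_nhds
        hxp] with y hy
      exact indicator_of_notMem (s := (lowerHalf : Set E3)) (fun h : y 2 < 0 => lt_asymm h hy) G
    rw [indicator_of_notMem hxl, dd, this.fderiv_eq]
    simp

lemma add_smul_stdBasis_mem {k : Fin 3} (hk : k ≠ 2) (x : E3) (t : ℝ) :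
    x + t • stdBasis k ∈ (lowerHalf : Set E3) ↔ x ∈ (lowerHalf : Set E3) := by
  show (x + t • stdBasis k) 2 < 0 ↔ x 2 < 0
  simp [stdBasis, hk.symm]

/-- Tangential translations preserve the measure of the half space. -/
lemma measurePreserving_add_tangential {k : Fin 3} (hk : k ≠ 2) (t : ℝ) :
    MeasurePreserving (fun x : E3 => x + t • stdBasis k) halfVol halfVol := by
  have h := (measurePreserving_add_right (volume : Measure E3) (t • stdBasis k)).restrict_preimage
    measurableSet_lowerHalf
  have e : (fun x : E3 => x + t • stdBasis k) ⁻¹' (lowerHalf : Set E3) = lowerHalf :=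
    Set.ext fun x => add_smul_stdBasis_mem hk x t
  rw [e] at h
  exact h

lemma integral_comp_add_tangential {F : Type*} [NormedAddCommGroup F] [NormedSpace ℝ F] {k : Fin 3}
    (hk : k ≠ 2) (t : ℝ) (f : E3 → F) :
    ∫ x, f (x + t • stdBasis k) ∂halfVol = ∫ x, f x ∂halfVol :=
  (measurePreserving_add_tangential hk t).integral_comp
    (Homeomorph.addRight (t • stdBasis k)).measurableEmbedding f

/-- Integrals over the half space of tangential derivatives vanish. -/
lemma integral_dd_tangential_eq_zero {G : E3 → ℝ} {L : ℝ≥0} (hG : LipschitzWith L G)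
    (hc : HasCompactSupport G) {k : Fin 3} (hk : k ≠ 2) : ∫ x, dd k G x ∂halfVol = 0 := by
  obtain ⟨r, hr⟩ := hc.isCompact.isBounded.subset_closedBall (0 : E3)
  have hG0 : ∀ x : E3, r < ‖x‖ → G x = 0 := by
    intro x hx
    by_contra h
    have := hr (subset_tsupport G h)
    rw [mem_closedBall_zero_iff] at this
    linarith
  -- The limit theorem for difference quotients needs an integrable weight, so the half space is cut
  -- off by a ball. Radius `r + 1` leaves room for the translates with `0 < t ≤ 1`.
  let S : Set E3 := (lowerHalf : Set E3) ∩ Metric.closedBall 0 (r + 1)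
  have hS : MeasurableSet S := measurableSet_lowerHalf.inter measurableSet_closedBall
  have hi : Integrable (S.indicator fun _ => (1 : ℝ)) (volume : Measure E3) := by
    rw [integrable_indicator_iff hS]
    refine integrableOn_const (ne_of_lt ?_)
    exact (measure_mono inter_subset_right).trans_lt measure_closedBall_lt_top
  have h1 := hG.integral_inv_smul_sub_mul_tendsto_integral_lineDeriv_mul hi (stdBasis k)
  -- Each difference quotient has integral exactly zero, by invariance under tangential
  -- translations; the derivative inherits this in the limit.
  have h2 : ∀ᶠ t in 𝓝[>] (0 : ℝ), ∫ x, (t⁻¹ • (G (x + t • stdBasis k) - G x)) *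
      S.indicator (fun _ => (1 : ℝ)) x = 0 := by
    filter_upwards [Ioc_mem_nhdsGT zero_lt_one] with t ht
    have e : (fun x => (t⁻¹ • (G (x + t • stdBasis k) - G x)) * S.indicator (fun _ => (1 : ℝ)) x)
        = (lowerHalf : Set E3).indicator fun x => t⁻¹ • (G (x + t • stdBasis k) - G x) := by
      ext x
      by_cases hx : x ∈ (lowerHalf : Set E3)
      · by_cases hxb : x ∈ Metric.closedBall (0 : E3) (r + 1)
        · rw [indicator_of_mem hx, indicator_of_mem (show x ∈ S from ⟨hx, hxb⟩), mul_one]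
        · rw [mem_closedBall_zero_iff, not_le] at hxb
          have h3 : ‖x‖ ≤ ‖x + t • stdBasis k‖ + ‖t • stdBasis k‖ := by
            have := norm_sub_le (x + t • stdBasis k) (t • stdBasis k)
            rwa [add_sub_cancel_right] at this
          rw [norm_smul, norm_stdBasis, mul_one, Real.norm_of_nonneg ht.1.le] at h3
          rw [indicator_of_mem hx, hG0 x (by linarith), hG0 _ (by linarith [ht.2])]
          simp
      · rw [indicator_of_notMem hx, indicator_of_notMem (fun h : x ∈ S => hx h.1), mul_zero]
    rw [e, integral_indicator measurableSet_lowerHalf]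
    change ∫ x, _ ∂halfVol = 0
    rw [integral_smul, integral_sub, integral_comp_add_tangential hk, sub_self, smul_zero]
    · exact ((hG.continuous.comp (continuous_add_const _)).integrable_of_hasCompactSupport
        (hc.comp_homeomorph (Homeomorph.addRight (t • stdBasis k)))).restrict
    · exact (hG.continuous.integrable_of_hasCompactSupport hc).restrict
  have h3 := tendsto_nhds_unique (h1.congr' (h2.mono fun t ht => ht)) tendsto_const_nhds
  rw [halfVol, ← integral_indicator measurableSet_lowerHalf, ← h3]
  refine integral_congr_ae ?_
  filter_upwards [ae_dd_eq_lineDeriv hG k] with x hx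
  rw [← hx]
  by_cases hxl : x ∈ (lowerHalf : Set E3)
  · by_cases hxb : x ∈ Metric.closedBall (0 : E3) (r + 1)
    · rw [indicator_of_mem hxl, indicator_of_mem (show x ∈ S from ⟨hxl, hxb⟩), mul_one]
    · rw [mem_closedBall_zero_iff, not_le] at hxb
      have : G =ᶠ[𝓝 x] fun _ => 0 := by
        filter_upwards [(isOpen_lt continuous_const continuous_norm).mem_nhds
          (show r < ‖x‖ by linarith)] with y hy
        exact hG0 y hy
      have h0 : dd k G x = 0 := by rw [dd, this.fderiv_eq]; simp
      rw [indicator_of_mem hxl, h0, zero_mul]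
  · rw [indicator_of_notMem hxl, indicator_of_notMem (fun h : x ∈ S => hxl h.1), mul_zero]

end Boundary

/-! ### The real-valued `L²` norm and Cauchy–Schwarz. -/

section Norms

variable {F : Type*} [NormedAddCommGroup F]

/-- The norm of `L²` of the lower half space, as a real number. -/
def nrm (f : E3 → F) : ℝ := (eLpNorm f 2 halfVol).toReal

lemma nrm_nonneg (f : E3 → F) : 0 ≤ nrm f := ENNReal.toReal_nonneg

lemma ofReal_nrm {f : E3 → F} (hf : MemLp f 2 halfVol) :
    ENNReal.ofReal (nrm f) = eLpNorm f 2 halfVol := ENNReal.ofReal_toReal hf.2.ne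

lemma nrm_le_of_eLpNorm_le {f : E3 → F} {c : ℝ} (hc : 0 ≤ c)
    (h : eLpNorm f 2 halfVol ≤ ENNReal.ofReal c) : nrm f ≤ c :=
  ENNReal.toReal_le_of_le_ofReal hc h

lemma nrm_sq {f : E3 → F} (hf : MemLp f 2 halfVol) : nrm f ^ 2 = ∫ x, ‖f x‖ ^ 2 ∂halfVol := by
  have hm : AEStronglyMeasurable (fun x => ‖f x‖ ^ 2) halfVol := hf.1.norm.pow 2
  rw [nrm, ← ENNReal.toReal_pow, eLpNorm_two_sq, integral_eq_lintegral_of_nonneg_ae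
    (Eventually.of_forall fun x => by positivity) hm]
  congr 1
  refine lintegral_congr fun x => ?_
  rw [ENNReal.ofReal_pow (norm_nonneg _), ofReal_norm]

lemma nrm_congr {f g : E3 → F} (h : f =ᵐ[halfVol] g) : nrm f = nrm g := by
  rw [nrm, nrm, eLpNorm_congr_ae h]

lemma nrm_add_le {f g : E3 → F} (hf : MemLp f 2 halfVol) (hg : MemLp g 2 halfVol) :
    nrm (fun x => f x + g x) ≤ nrm f + nrm g := by
  rw [nrm, nrm, nrm, ← ENNReal.toReal_add hf.2.ne hg.2.ne]
  exact ENNReal.toReal_mono (ENNReal.add_ne_top.2 ⟨hf.2.ne, hg.2.ne⟩)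
    (eLpNorm_add_le hf.1 hg.1 (by norm_num))

lemma nrm_le_mul {G : Type*} [NormedAddCommGroup G] {f : E3 → F} {g : E3 → G} {c : ℝ}
    (hg : MemLp g 2 halfVol) (hc : 0 ≤ c) (h : ∀ᵐ x ∂halfVol, ‖f x‖ ≤ c * ‖g x‖) :
    nrm f ≤ c * nrm g := by
  have := eLpNorm_le_mul_eLpNorm_of_ae_le_mul h 2
  rw [← ofReal_nrm hg, ← ENNReal.ofReal_mul hc] at this
  exact nrm_le_of_eLpNorm_le (mul_nonneg hc (nrm_nonneg _)) this

lemma nrm_mono {G : Type*} [NormedAddCommGroup G] {f : E3 → F} {g : E3 → G}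
    (hg : MemLp g 2 halfVol) (h : ∀ᵐ x ∂halfVol, ‖f x‖ ≤ ‖g x‖) : nrm f ≤ nrm g := by
  simpa using nrm_le_mul hg zero_le_one (by simpa using h)

lemma nrm_norm (f : E3 → F) : nrm (fun x => ‖f x‖) = nrm f := by
  rw [nrm, nrm, eLpNorm_norm]

lemma nrm_neg (f : E3 → F) : nrm (fun x => -f x) = nrm f := by
  rw [nrm, nrm]
  exact congrArg _ (eLpNorm_neg f 2 halfVol)

lemma nrm_sub_rev (f g : E3 → F) : nrm (fun x => f x - g x) = nrm fun x => g x - f x := by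
  rw [← nrm_neg]
  simp only [neg_sub]

lemma nrm_smul [NormedSpace ℝ F] (c : ℝ) (f : E3 → F) : nrm (fun x => c • f x) = |c| * nrm f := by
  rw [nrm, nrm]
  have := eLpNorm_const_smul c f 2 halfVol
  rw [show (fun x => c • f x) = c • f from rfl, this, ENNReal.toReal_mul]
  simp

lemma integrable_norm_mul_norm {G : Type*} [NormedAddCommGroup G] {f : E3 → F} {g : E3 → G}
    (hf : MemLp f 2 halfVol) (hg : MemLp g 2 halfVol) :
    Integrable (fun x => ‖f x‖ * ‖g x‖) halfVol := hf.norm.integrable_mul hg.norm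

lemma integral_norm_mul_norm_le {G : Type*} [NormedAddCommGroup G] {f : E3 → F} {g : E3 → G}
    (hf : MemLp f 2 halfVol) (hg : MemLp g 2 halfVol) :
    ∫ x, ‖f x‖ * ‖g x‖ ∂halfVol ≤ nrm f * nrm g := by
  have h := integral_mul_norm_le_Lp_mul_Lq (μ := halfVol) (f := fun x => ‖f x‖)
    (g := fun x => ‖g x‖) (p := 2) (q := 2) (by constructor <;> norm_num)
    (by simpa using hf.norm) (by simpa using hg.norm)
  simp only [norm_norm, Real.rpow_two] at h
  rw [← nrm_sq hf, ← nrm_sq hg, ← Real.sqrt_eq_rpow, ← Real.sqrt_eq_rpow, Real.sqrt_sq (nrm_nonneg _),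
    Real.sqrt_sq (nrm_nonneg _)] at h
  exact h

/-- The Cauchy–Schwarz inequality for integrands dominated by a product. -/
lemma abs_integral_le_of_le_mul {G : Type*} [NormedAddCommGroup G] {f : E3 → F} {g : E3 → G}
    (hf : MemLp f 2 halfVol) (hg : MemLp g 2 halfVol) {h : E3 → ℝ} {c : ℝ} (hc : 0 ≤ c)
    (hh : ∀ᵐ x ∂halfVol, |h x| ≤ c * (‖f x‖ * ‖g x‖)) :
    |∫ x, h x ∂halfVol| ≤ c * (nrm f * nrm g) := by
  refine (norm_integral_le_integral_norm h).trans ?_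
  calc ∫ x, ‖h x‖ ∂halfVol ≤ ∫ x, c * (‖f x‖ * ‖g x‖) ∂halfVol :=
        integral_mono_of_nonneg (Eventually.of_forall fun x => norm_nonneg _)
          ((integrable_norm_mul_norm hf hg).const_mul c) hh
    _ = c * ∫ x, ‖f x‖ * ‖g x‖ ∂halfVol := integral_const_mul _ _
    _ ≤ c * (nrm f * nrm g) := mul_le_mul_of_nonneg_left (integral_norm_mul_norm_le hf hg) hc

lemma integrable_of_le_mul {G : Type*} [NormedAddCommGroup G] {f : E3 → F} {g : E3 → G}
    (hf : MemLp f 2 halfVol) (hg : MemLp g 2 halfVol) {h : E3 → ℝ}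
    (hm : AEStronglyMeasurable h halfVol) {c : ℝ}
    (hh : ∀ᵐ x ∂halfVol, |h x| ≤ c * (‖f x‖ * ‖g x‖)) : Integrable h halfVol :=
  ((integrable_norm_mul_norm hf hg).const_mul c).mono' hm hh

end Norms

/-! ### Hardy's inequality for smooth functions. -/

section Hardy

variable {F : Type*} [NormedAddCommGroup F] [InnerProductSpace ℝ F]

lemma rho_sq (x : E3) : rho x ^ 2 = 1 + ‖x‖ ^ 2 := Real.sq_sqrt (by positivity)

lemma contDiff_rho : ContDiff ℝ ∞ rho :=
  (contDiff_const.add (contDiff_norm_sq ℝ)).sqrt fun x => by positivity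

lemma dd_rho (k : Fin 3) (x : E3) : dd k rho x = x k / rho x := by
  have h : HasFDerivAt (fun x : E3 => 1 + ‖x‖ ^ 2) (2 • innerSL ℝ x) x :=
    (hasStrictFDerivAt_norm_sq x).hasFDerivAt.const_add 1
  have h2 := h.sqrt (by positivity)
  rw [dd, show rho = fun x : E3 => √(1 + ‖x‖ ^ 2) from rfl, h2.fderiv]
  simp [stdBasis, EuclideanSpace.inner_single_right]
  field_simp

lemma IsTest.memLp_rho_inv_smul {F : Type*} [NormedAddCommGroup F] [NormedSpace ℝ F] {φ : E3 → F} (h : IsTest φ) :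
    MemLp (fun x => (rho x)⁻¹ • φ x) 2 halfVol :=
  h.memLp.bdd_smul continuous_rho_inv.aestronglyMeasurable (B := 1)
    (Eventually.of_forall fun x => by
      rw [abs_of_nonneg (inv_nonneg.2 (rho_pos x).le)]; exact rho_inv_le_one x)

lemma contDiff_coord (k : Fin 3) : ContDiff ℝ ∞ (fun x : E3 => x k) :=
  (EuclideanSpace.proj (𝕜 := ℝ) k).contDiff

lemma dd_norm_sq {φ : E3 → F} {x : E3} (h : DifferentiableAt ℝ φ x) (k : Fin 3) :
    dd k (fun x => ‖φ x‖ ^ 2) x = 2 * inner ℝ (φ x) (dd k φ x) := by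
  rw [dd, h.hasFDerivAt.norm_sq.fderiv]
  simp [dd]

/-- Summed over `k` this is the divergence of `x / ϱ²`, namely `3 ϱ⁻² - 2 |x|² ϱ⁻⁴ = ϱ⁻² + 2 ϱ⁻⁴`,
which is at least `ϱ⁻²`. -/
lemma dd_mul_rho_inv_sq (k : Fin 3) (x : E3) :
    dd k (fun x => x k * (rho x ^ 2)⁻¹) x = (rho x ^ 2)⁻¹ - 2 * x k ^ 2 * (rho x ^ 2)⁻¹ ^ 2 := by
  have h1 : HasFDerivAt (fun x : E3 => 1 + ‖x‖ ^ 2) (2 • innerSL ℝ x) x :=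
    (hasStrictFDerivAt_norm_sq x).hasFDerivAt.const_add 1
  have h2 : HasFDerivAt (fun x : E3 => x k) (EuclideanSpace.proj (𝕜 := ℝ) k) x :=
    (EuclideanSpace.proj (𝕜 := ℝ) k).hasFDerivAt
  have h3 := h2.mul ((hasDerivAt_inv (show (1 + ‖x‖ ^ 2 : ℝ) ≠ 0 by positivity)).comp_hasFDerivAt x h1)
  simp only [rho_sq]
  have h4 : fderiv ℝ (fun x : E3 => x k * (1 + ‖x‖ ^ 2)⁻¹) x = _ := h3.fderiv
  rw [dd, h4]
  simp [stdBasis, EuclideanSpace.inner_single_right]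
  ring

/-- Hardy's inequality for smooth functions, up to the boundary. -/
lemma IsTest.hardy {φ : E3 → F} (h : IsTest φ) :
    nrm (fun x => (rho x)⁻¹ • φ x) ≤ 2 * ∑ k, nrm (dd k φ) := by
  set a := nrm (fun x => (rho x)⁻¹ • φ x) with ha
  have hρ : ContDiff ℝ ∞ fun x => (rho x ^ 2)⁻¹ :=
    (contDiff_rho.pow 2).inv fun x => (pow_pos (rho_pos x) 2).ne'
  have hφ2 : IsTest fun x => ‖φ x‖ ^ 2 := ⟨h.smooth.norm_sq ℝ, h.compact.comp_left
    (g := fun y => ‖y‖ ^ 2) (by simp)⟩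
  have hf : ∀ k, ContDiff ℝ ∞ fun x : E3 => x k * (rho x ^ 2)⁻¹ := fun k => (contDiff_coord k).mul hρ
  have hG : ∀ k, IsTest fun x => (x k * (rho x ^ 2)⁻¹) * ‖φ x‖ ^ 2 := fun k => IsTest.smul (hf k) hφ2
  -- The field `x |φ|² / ϱ²` has no normal component on the boundary, so there is no boundary term
  -- although `φ` need not vanish there.
  have hG0 : ∀ k, ∫ x, dd k (fun x => (x k * (rho x ^ 2)⁻¹) * ‖φ x‖ ^ 2) x ∂halfVol = 0 := by
    intro k
    by_cases hk : k = 2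
    · subst hk
      exact (hG 2).integral_dd_two_eq_zero fun x hx => by simp [hx]
    · obtain ⟨L, hL⟩ := (hG k).exists_lipschitzWith
      exact integral_dd_tangential_eq_zero hL (hG k).compact hk
  have hdd : ∀ k x, dd k (fun x => (x k * (rho x ^ 2)⁻¹) * ‖φ x‖ ^ 2) x
      = (x k * (rho x ^ 2)⁻¹) * (2 * inner ℝ (φ x) (dd k φ x))
        + ((rho x ^ 2)⁻¹ - 2 * x k ^ 2 * (rho x ^ 2)⁻¹ ^ 2) * ‖φ x‖ ^ 2 := by
    intro k x
    rw [dd_mul ((hf k).differentiable (by simp)).differentiableAt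
      hφ2.differentiable.differentiableAt, dd_norm_sq h.differentiable.differentiableAt,
      dd_mul_rho_inv_sq]
  have hint : ∀ k, Integrable (fun x => dd k (fun x => (x k * (rho x ^ 2)⁻¹) * ‖φ x‖ ^ 2) x) halfVol :=
    fun k => (((hG k).deriv k).continuous.integrable_of_hasCompactSupport
      ((hG k).deriv k).compact).restrict
  have hint2 : ∀ k, Integrable (fun x => ‖(rho x)⁻¹ • φ x‖ * ‖dd k φ x‖) halfVol := fun k =>
    integrable_norm_mul_norm h.memLp_rho_inv_smul (h.deriv k).memLp
  have key : a ^ 2 ≤ 2 * ∑ k, a * nrm (dd k φ) := by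
    calc a ^ 2 = ∫ x, ‖(rho x)⁻¹ • φ x‖ ^ 2 ∂halfVol := nrm_sq h.memLp_rho_inv_smul
      _ ≤ ∫ x, (∑ k, dd k (fun x => (x k * (rho x ^ 2)⁻¹) * ‖φ x‖ ^ 2) x
            + 2 * ∑ k, ‖(rho x)⁻¹ • φ x‖ * ‖dd k φ x‖) ∂halfVol := by
          refine integral_mono ?_ ?_ fun x => ?_
          · exact h.memLp_rho_inv_smul.integrable_norm_pow (by norm_num)
          · exact (integrable_finsetSum _ fun k _ => hint k).add
              ((integrable_finsetSum _ fun k _ => hint2 k).const_mul 2)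
          · have hρ0 := rho_pos x
            have h1 : ∀ k, -(‖(rho x)⁻¹ • φ x‖ * ‖dd k φ x‖)
                ≤ (x k * (rho x ^ 2)⁻¹) * inner ℝ (φ x) (dd k φ x) := by
              intro k
              refine (abs_le.1 ?_).1
              rw [abs_mul, abs_mul, norm_smul, Real.norm_of_nonneg (by positivity),
                abs_of_pos (by positivity : 0 < (rho x ^ 2)⁻¹)]
              have h2 : |x k| ≤ rho x := (PiLp.norm_apply_le x k).trans (norm_le_rho x)
              have h3 : |x k| * (rho x ^ 2)⁻¹ ≤ (rho x)⁻¹ := by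
                rw [← div_eq_mul_inv, div_le_iff₀ (by positivity)]
                calc |x k| ≤ rho x := h2
                  _ = (rho x)⁻¹ * rho x ^ 2 := by field_simp
              calc |x k| * (rho x ^ 2)⁻¹ * |inner ℝ (φ x) (dd k φ x)|
                  ≤ (rho x)⁻¹ * (‖φ x‖ * ‖dd k φ x‖) := by
                    gcongr
                    exact abs_real_inner_le_norm _ _
                _ = (rho x)⁻¹ * ‖φ x‖ * ‖dd k φ x‖ := by ring
            have h4 : ‖x‖ ^ 2 = x 0 ^ 2 + x 1 ^ 2 + x 2 ^ 2 := by
              rw [EuclideanSpace.norm_sq_eq, Fin.sum_univ_three]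
              simp
            have h5 : ‖(rho x)⁻¹ • φ x‖ ^ 2 ≤ (3 * (rho x ^ 2)⁻¹
                - 2 * ‖x‖ ^ 2 * (rho x ^ 2)⁻¹ ^ 2) * ‖φ x‖ ^ 2 := by
              rw [norm_smul, Real.norm_of_nonneg (by positivity), mul_pow]
              gcongr
              rw [inv_pow]
              have h6 : (rho x ^ 2)⁻¹ * rho x ^ 2 = 1 := inv_mul_cancel₀ (by positivity)
              have h7 : 0 < (rho x ^ 2)⁻¹ := by positivity
              have h8 : ‖x‖ ^ 2 = rho x ^ 2 - 1 := by rw [rho_sq]; ring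
              rw [h8]
              generalize (rho x ^ 2)⁻¹ = r at *
              generalize rho x ^ 2 = s at *
              have : 3 * r - 2 * (s - 1) * r ^ 2 = 3 * r - 2 * r * (r * s) + 2 * r ^ 2 := by ring
              rw [this, h6]
              nlinarith
            simp only [hdd, Fin.sum_univ_three]
            have := h1 0
            have := h1 1
            have := h1 2
            rw [h4] at h5
            linarith
      _ = 2 * ∑ k, ∫ x, ‖(rho x)⁻¹ • φ x‖ * ‖dd k φ x‖ ∂halfVol := by
          rw [integral_add (integrable_finsetSum _ fun k _ => hint k)
              ((integrable_finsetSum _ fun k _ => hint2 k).const_mul 2),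
            integral_finsetSum _ fun k _ => hint k, integral_const_mul,
            integral_finsetSum _ fun k _ => hint2 k]
          simp [hG0]
      _ ≤ 2 * ∑ k, a * nrm (dd k φ) := by
          gcongr with k
          exact integral_norm_mul_norm_le h.memLp_rho_inv_smul (h.deriv k).memLp
  rw [← Finset.mul_sum] at key
  by_contra hlt
  rw [not_le] at hlt
  have : 0 ≤ ∑ k, nrm (dd k φ) := Finset.sum_nonneg fun k _ => nrm_nonneg _
  nlinarith

end Hardy

/-! ### Korn's inequality by null Lagrangians and Nitsche's reflection. -/

section Korn

/-- The diagonal linear map `x ↦ (d₀ x₀, d₁ x₁, d₂ x₂)`. -/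
def diagMap (d : Fin 3 → ℝ) : E3 →L[ℝ] E3 :=
  LinearMap.toContinuousLinearMap
    { toFun := fun x => WithLp.toLp 2 fun i => d i * x i
      map_add' := fun x y => by ext i; simp [mul_add]
      map_smul' := fun c x => by ext i; simp; ring }

@[simp] lemma diagMap_apply (d : Fin 3 → ℝ) (x : E3) (i : Fin 3) : diagMap d x i = d i * x i := rfl

lemma diagMap_stdBasis (d : Fin 3 → ℝ) (k : Fin 3) : diagMap d (stdBasis k) = d k • stdBasis k := by
  ext i
  by_cases h : i = k
  · subst h; simp [stdBasis]
  · simp [stdBasis, h]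

lemma map_diagMap_volume (d : Fin 3 → ℝ) (hd : |∏ i, d i| ≠ 0) :
    (volume : Measure E3).map (diagMap d) = ENNReal.ofReal (|∏ i, d i|⁻¹) • volume := by
  have hdet : LinearMap.det (diagMap d : E3 →ₗ[ℝ] E3) = ∏ i, d i := by
    have h : (diagMap d : E3 →ₗ[ℝ] E3) = Matrix.toLin (EuclideanSpace.basisFun (Fin 3) ℝ).toBasis
        (EuclideanSpace.basisFun (Fin 3) ℝ).toBasis (Matrix.diagonal d) := by
      refine (EuclideanSpace.basisFun (Fin 3) ℝ).toBasis.ext fun k => ?_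
      rw [Matrix.toLin_self]
      have := diagMap_stdBasis d k
      simp only [stdBasis] at this
      simp [Matrix.diagonal_apply, this]
    rw [h, LinearMap.det_toLin, Matrix.det_diagonal]
  have := Measure.map_linearMap_addHaar_eq_smul_addHaar (volume : Measure E3)
    (f := (diagMap d : E3 →ₗ[ℝ] E3)) (by rw [hdet]; exact abs_ne_zero.1 hd)
  rw [hdet, abs_inv] at this
  exact this

/-- Change of variables by a reflection of the complement of the half space into its closure. -/
lemma setIntegral_compl_comp_diagMap_le {d : Fin 3 → ℝ} (h2 : d 2 < 0) (hd : 1 ≤ |∏ i, d i|)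
    {f : E3 → ℝ} (hf0 : ∀ x, 0 ≤ f x) :
    ∫ x in (lowerHalf : Set E3)ᶜ, f (diagMap d x) ≤ ∫ x, f x ∂halfVol := by
  have hd0 : |∏ i, d i| ≠ 0 := by positivity
  have hinj : Function.Injective (diagMap d) := by
    intro x y hxy
    ext i
    have h := congrArg (fun z : E3 => z i) hxy
    simp only [diagMap_apply] at h
    have hi : d i ≠ 0 := fun h0 => hd0 (by rw [Finset.prod_eq_zero (Finset.mem_univ i) h0, abs_zero])
    exact mul_left_cancel₀ hi h
  have hemb : MeasurableEmbedding (diagMap d) := (diagMap d).continuous.measurableEmbedding hinj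
  have hpre : (lowerHalf : Set E3)ᶜ = diagMap d ⁻¹' {x : E3 | x 2 ≤ 0} := by
    ext x
    show ¬ x 2 < 0 ↔ d 2 * x 2 ≤ 0
    constructor
    · intro h; nlinarith [not_lt.1 h]
    · intro h h'; nlinarith
  have h1 := hemb.setIntegral_map (μ := (volume : Measure E3)) f {x : E3 | x 2 ≤ 0}
  rw [hpre, ← h1, map_diagMap_volume d hd0, Measure.restrict_smul, integral_smul_measure]
  have h3 : ∫ x in {x : E3 | x 2 ≤ 0}, f x = ∫ x, f x ∂halfVol := by
    refine setIntegral_congr_set ?_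
    filter_upwards [measure_eq_zero_iff_ae_notMem.1 volume_boundary] with x hx
    refine propext ⟨fun h => ?_, fun h => le_of_lt h⟩
    exact lt_of_le_of_ne h hx
  rw [h3, ENNReal.toReal_ofReal (by positivity), smul_eq_mul]
  exact mul_le_of_le_one_left (integral_nonneg hf0) (inv_le_one_of_one_le₀ hd)

lemma dd_comp_diagMap {F : Type*} [NormedAddCommGroup F] [NormedSpace ℝ F] {φ : E3 → F}
    (h : Differentiable ℝ φ) (d : Fin 3 → ℝ) (k : Fin 3) (x : E3) :
    dd k (fun x => φ (diagMap d x)) x = d k • dd k φ (diagMap d x) := by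
  have := (h (diagMap d x)).hasFDerivAt.comp x (diagMap d).hasFDerivAt
  rw [dd, HasFDerivAt.fderiv (f := fun x => φ (diagMap d x)) this]
  simp [dd, diagMap_stdBasis]

lemma dd_clm_comp {F G : Type*} [NormedAddCommGroup F] [NormedSpace ℝ F] [NormedAddCommGroup G]
    [NormedSpace ℝ G] (L : F →L[ℝ] G) {φ : E3 → F} {x : E3} (h : DifferentiableAt ℝ φ x)
    (k : Fin 3) : dd k (fun x => L (φ x)) x = L (dd k φ x) := by
  rw [dd, HasFDerivAt.fderiv (f := fun x => L (φ x)) (L.hasFDerivAt.comp x h.hasFDerivAt)]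
  rfl

lemma dd_comp_coord {φ : E3 → E3} {x : E3} (h : DifferentiableAt ℝ φ x) (k i : Fin 3) :
    dd k (fun x => φ x i) x = dd k φ x i :=
  dd_clm_comp (EuclideanSpace.proj (𝕜 := ℝ) i) h k

lemma IsTest.clm_comp {F G : Type*} [NormedAddCommGroup F] [NormedSpace ℝ F] [NormedAddCommGroup G]
    [NormedSpace ℝ G] (L : F →L[ℝ] G) {φ : E3 → F} (h : IsTest φ) : IsTest fun x => L (φ x) :=
  ⟨L.contDiff.comp h.smooth, h.compact.comp_left (map_zero L)⟩

lemma IsTest.coord {φ : E3 → E3} (h : IsTest φ) (i : Fin 3) : IsTest fun x => φ x i :=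
  h.clm_comp (EuclideanSpace.proj (𝕜 := ℝ) i)

lemma IsTest.mul {a b : E3 → ℝ} (ha : IsTest a) (hb : IsTest b) : IsTest fun x => a x * b x :=
  ha.smul' hb.smooth

lemma IsTest.sub {F : Type*} [NormedAddCommGroup F] [NormedSpace ℝ F] {a b : E3 → F}
    (ha : IsTest a) (hb : IsTest b) : IsTest fun x => a x - b x :=
  ⟨ha.smooth.sub hb.smooth, ha.compact.sub hb.compact⟩

lemma IsTest.integrable {a : E3 → ℝ} (ha : IsTest a) : Integrable a :=
  ha.continuous.integrable_of_hasCompactSupport ha.compact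

lemma IsTest.integrable_half {a : E3 → ℝ} (ha : IsTest a) : Integrable a halfVol :=
  ha.integrable.restrict

lemma dd_comm {F : Type*} [NormedAddCommGroup F] [NormedSpace ℝ F] {φ : E3 → F}
    (h : ContDiff ℝ ∞ φ) (i j : Fin 3) (x : E3) : dd i (dd j φ) x = dd j (dd i φ) x := by
  have hd : DifferentiableAt ℝ (fderiv ℝ φ) x :=
    ((h.fderiv_right (m := ∞) (by simp)).differentiable (by simp)).differentiableAt
  have e : ∀ i j, dd i (dd j φ) x = fderiv ℝ (fderiv ℝ φ) x (stdBasis i) (stdBasis j) := by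
    intro i j
    have := (hd.hasFDerivAt.clm_apply (hasFDerivAt_const (stdBasis j) x))
    rw [dd, HasFDerivAt.fderiv (f := dd j φ) this]
    simp
  rw [e, e]
  exact (h.contDiffAt.isSymmSndFDerivAt (by
    rw [minSmoothness_of_isRCLikeNormedField]; exact WithTop.coe_le_coe.2 le_top)).eq _ _

/-- The null Lagrangian `∂_i b ∂_j a - ∂_i a ∂_j b` of two functions. -/
def nullLag (i j : Fin 3) (a b : E3 → ℝ) (x : E3) : ℝ := dd i b x * dd j a x - dd i a x * dd j b x

/-- Equality of mixed derivatives removes the second order terms and leaves a divergence, so the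
integral can only depend on boundary values. -/
lemma nullLag_eq {a b : E3 → ℝ} (ha : IsTest a) (hb : IsTest b) (i j : Fin 3) (x : E3) :
    nullLag i j a b x = dd j (fun x => a x * dd i b x) x - dd i (fun x => a x * dd j b x) x := by
  rw [dd_mul ha.differentiable.differentiableAt (hb.deriv i).differentiable.differentiableAt,
    dd_mul ha.differentiable.differentiableAt (hb.deriv j).differentiable.differentiableAt,
    dd_comm hb.smooth i j, nullLag]
  ring

lemma integrable_nullLag {a b : E3 → ℝ} (ha : IsTest a) (hb : IsTest b) (i j : Fin 3) :
    Integrable (nullLag i j a b) :=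
  (((hb.deriv i).mul (ha.deriv j)).sub ((ha.deriv i).mul (hb.deriv j))).integrable

lemma integral_nullLag {a b : E3 → ℝ} (ha : IsTest a) (hb : IsTest b) (i j : Fin 3) :
    ∫ x, nullLag i j a b x = 0 := by
  simp only [nullLag_eq ha hb]
  rw [integral_sub ((ha.mul (hb.deriv i)).deriv j).integrable
    ((ha.mul (hb.deriv j)).deriv i).integrable, (ha.mul (hb.deriv i)).integral_dd_eq_zero,
    (ha.mul (hb.deriv j)).integral_dd_eq_zero, sub_zero]

lemma dd_eq_of_eq_boundary {a b : E3 → ℝ} (ha : IsTest a) (hb : IsTest b)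
    (h : ∀ x : E3, x 2 = 0 → a x = b x) {i : Fin 3} (hi : i ≠ 2) {x : E3} (hx : x 2 = 0) :
    dd i a x = dd i b x := by
  have e : ∀ {c : E3 → ℝ}, IsTest c → dd i c x = deriv (fun t : ℝ => c (x + t • stdBasis i)) 0 := by
    intro c hc
    have := hc.differentiable.differentiableAt (x := x).lineDeriv_eq_fderiv (v := stdBasis i)
    rw [dd, ← this]
    rfl
  rw [e ha, e hb]
  congr 1
  ext t
  exact h _ (by simp [stdBasis, hx, hi.symm])

/-- As `i` is tangential, only `∂_j (a ∂_i b)` contributes. Its boundary term involves `a` and the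
tangential derivative of `b`, both determined by boundary values. -/
lemma halfVol_integral_nullLag_eq {a b a' b' : E3 → ℝ} (ha : IsTest a) (hb : IsTest b)
    (ha' : IsTest a') (hb' : IsTest b') (haa : ∀ x : E3, x 2 = 0 → a x = a' x)
    (hbb : ∀ x : E3, x 2 = 0 → b x = b' x) {i : Fin 3} (hi : i ≠ 2) (j : Fin 3) :
    ∫ x, nullLag i j a b x ∂halfVol = ∫ x, nullLag i j a' b' x ∂halfVol := by
  have e : ∀ {a b : E3 → ℝ}, IsTest a → IsTest b → ∫ x, nullLag i j a b x ∂halfVol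
      = ∫ x, dd j (fun x => a x * dd i b x) x ∂halfVol := by
    intro a b ha hb
    simp only [nullLag_eq ha hb]
    obtain ⟨L, hL⟩ := (ha.mul (hb.deriv j)).exists_lipschitzWith
    rw [integral_sub ((ha.mul (hb.deriv i)).deriv j).integrable_half
      ((ha.mul (hb.deriv j)).deriv i).integrable_half,
      integral_dd_tangential_eq_zero hL (ha.mul (hb.deriv j)).compact hi, sub_zero]
  have h1 := ha.mul (hb.deriv i)
  have h2 := ha'.mul (hb'.deriv i)
  rw [e ha hb, e ha' hb', ← sub_eq_zero, ← integral_sub (h1.deriv j).integrable_half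
    (h2.deriv j).integrable_half]
  have e2 : ∀ x, dd j (fun x => a x * dd i b x) x - dd j (fun x => a' x * dd i b' x) x
      = dd j (fun x => a x * dd i b x - a' x * dd i b' x) x := by
    intro x
    rw [dd, dd, dd, fderiv_fun_sub h1.differentiable.differentiableAt
      h2.differentiable.differentiableAt]
    rfl
  simp only [e2]
  by_cases hj : j = 2
  · subst hj
    refine (h1.sub h2).integral_dd_two_eq_zero fun x hx => ?_
    rw [haa x hx, dd_eq_of_eq_boundary hb hb' hbb hi hx, sub_self]
  · obtain ⟨L, hL⟩ := (h1.sub h2).exists_lipschitzWith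
    exact integral_dd_tangential_eq_zero hL (h1.sub h2).compact hj

/-- The pointwise core of Korn's inequality: the mixed products in the squared strain are traded for
the squared divergence and null Lagrangians, so the full gradient is controlled once the null
Lagrangians are. -/
lemma strain_identity (D : Fin 3 → E3 → E3) (x : E3) :
    2 * ∑ i, ∑ j, strain D i j x ^ 2 = ∑ k, ‖D k x‖ ^ 2 + (∑ k, D k x k) ^ 2
      + 2 * ((D 0 x 1 * D 1 x 0 - D 0 x 0 * D 1 x 1) + (D 0 x 2 * D 2 x 0 - D 0 x 0 * D 2 x 2)
        + (D 1 x 2 * D 2 x 1 - D 1 x 1 * D 2 x 2)) := by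
  simp only [EuclideanSpace.norm_sq_eq, Fin.sum_univ_three, Real.norm_eq_abs, sq_abs, strain]
  ring

/-- The squares of gradient and divergence are dropped. This form is applied to the reflected field
above the boundary, where only its strain is controlled. -/
lemma strain_sq_le (D : Fin 3 → E3 → E3) (x : E3) :
    2 * ((D 0 x 1 * D 1 x 0 - D 0 x 0 * D 1 x 1) + (D 0 x 2 * D 2 x 0 - D 0 x 0 * D 2 x 2)
        + (D 1 x 2 * D 2 x 1 - D 1 x 1 * D 2 x 2)) ≤ 2 * ∑ i, ∑ j, strain D i j x ^ 2 := by
  rw [strain_identity]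
  have : 0 ≤ ∑ k, ‖D k x‖ ^ 2 := by positivity
  have := sq_nonneg (∑ k, D k x k)
  linarith

lemma IsTest.strain {φ : E3 → E3} (h : IsTest φ) (i j : Fin 3) :
    IsTest fun x => strain (fun k => dd k φ) i j x := by
  have h1 := ((h.deriv j).coord i)
  have h2 := ((h.deriv i).coord j)
  refine ⟨(h1.smooth.add h2.smooth).div_const 2, ?_⟩
  have := (h1.compact.add h2.compact).mul_right (f' := fun _ => (2 : ℝ)⁻¹)
  exact this

lemma IsTest.strain_sq_sum {φ : E3 → E3} (h : IsTest φ) :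
    IsTest fun x => ∑ i, ∑ j, HalfSpaceElasticity.strain (fun k => dd k φ) i j x ^ 2 := by
  have h1 : ∀ i j, IsTest fun x => HalfSpaceElasticity.strain (fun k => dd k φ) i j x ^ 2 := by
    intro i j
    simpa only [sq] using (h.strain i j).mul (h.strain i j)
  have h2 : ∀ {f g : E3 → ℝ}, IsTest f → IsTest g → IsTest fun x => f x + g x := fun hf hg =>
    ⟨hf.smooth.add hg.smooth, hf.compact.add hg.compact⟩
  simp only [Fin.sum_univ_three]
  exact h2 (h2 (h2 (h2 (h1 _ _) (h1 _ _)) (h1 _ _)) (h2 (h2 (h1 _ _) (h1 _ _)) (h1 _ _)))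
    (h2 (h2 (h1 _ _) (h1 _ _)) (h1 _ _))

/-- Nitsche's reflection of a vector field across the boundary of the half space. -/
def nitsche (φ : E3 → E3) (x : E3) : E3 :=
  (3 : ℝ) • diagMap ![1, 1, -1] (φ (diagMap ![1, 1, -1] x))
    - (2 : ℝ) • diagMap ![1, 1, -2] (φ (diagMap ![1, 1, -2] x))

lemma IsTest.comp_diagMap {F : Type*} [NormedAddCommGroup F] [NormedSpace ℝ F] {φ : E3 → F}
    (h : IsTest φ) {d : Fin 3 → ℝ} (hd : ∀ i, 1 ≤ |d i|) : IsTest fun x => φ (diagMap d x) := by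
  refine ⟨h.smooth.comp (diagMap d).contDiff, ?_⟩
  obtain ⟨r, hr⟩ := h.compact.isCompact.isBounded.subset_closedBall (0 : E3)
  refine HasCompactSupport.intro (isCompact_closedBall (0 : E3) r) fun x hx => ?_
  by_contra h0
  have h1 := hr (subset_tsupport φ h0)
  rw [mem_closedBall_zero_iff] at h1 hx
  refine hx (le_trans ?_ h1)
  rw [EuclideanSpace.norm_eq, EuclideanSpace.norm_eq]
  refine Real.sqrt_le_sqrt (Finset.sum_le_sum fun i _ => ?_)
  rw [diagMap_apply, norm_mul, Real.norm_eq_abs (d i)]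
  exact pow_le_pow_left₀ (norm_nonneg _) (le_mul_of_one_le_left (norm_nonneg _) (hd i)) 2

lemma IsTest.nitsche {φ : E3 → E3} (h : IsTest φ) : IsTest (nitsche φ) := by
  have h1 : IsTest fun x => φ (diagMap ![1, 1, -1] x) :=
    h.comp_diagMap fun i => by fin_cases i <;> simp
  have h2 : IsTest fun x => φ (diagMap ![1, 1, -2] x) :=
    h.comp_diagMap fun i => by fin_cases i <;> simp
  exact (h1.clm_comp ((3 : ℝ) • diagMap ![1, 1, -1])).sub (h2.clm_comp ((2 : ℝ) • diagMap ![1, 1, -2]))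

/-- The weights `3` and `-2` are determined by the boundary values: `3 - 2 = 1` for tangential
components and `3 · (-1) - 2 · (-2) = 1` for the normal one. -/
lemma nitsche_boundary (φ : E3 → E3) {x : E3} (hx : x 2 = 0) (i : Fin 3) : φ x i = nitsche φ x i := by
  have h : ∀ s : ℝ, diagMap ![1, 1, s] x = x := by
    intro s
    ext j
    fin_cases j <;> simp [hx]
  simp only [nitsche, h]
  fin_cases i <;> simp <;> ring

/-- For a diagonal `R` the gradient of `R φ(R x)` is `R (∇φ) R`, whose symmetric part is `R` applied
on both sides of the strain. Applying `R` to the values as well as to the points is what keeps the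
antisymmetric part of `∇φ` out. -/
lemma strain_nitsche {φ : E3 → E3} (h : IsTest φ) (i j : Fin 3) (x : E3) :
    strain (fun k => dd k (nitsche φ)) i j x
      = 3 * (![1, 1, -1] i * ![1, 1, -1] j) * strain (fun k => dd k φ) i j (diagMap ![1, 1, -1] x)
      - 2 * (![1, 1, -2] i * ![1, 1, -2] j) * strain (fun k => dd k φ) i j (diagMap ![1, 1, -2] x) := by
  have hd : ∀ k, dd k (nitsche φ) x
      = (3 : ℝ) • diagMap ![1, 1, -1] (![(1 : ℝ), 1, -1] k • dd k φ (diagMap ![1, 1, -1] x))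
      - (2 : ℝ) • diagMap ![1, 1, -2] (![(1 : ℝ), 1, -2] k • dd k φ (diagMap ![1, 1, -2] x)) := by
    intro k
    have e : ∀ (d : Fin 3 → ℝ) (c : ℝ), DifferentiableAt ℝ (fun x => (c • diagMap d) (φ (diagMap d x))) x :=
      fun d c => ((c • diagMap d).differentiable.comp
        (h.differentiable.comp (diagMap d).differentiable)).differentiableAt
    have e2 : ∀ (d : Fin 3 → ℝ) (c : ℝ), fderiv ℝ (fun x => (c • diagMap d) (φ (diagMap d x))) x
        (stdBasis k) = c • diagMap d (d k • dd k φ (diagMap d x)) := by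
      intro d c
      have := dd_clm_comp (c • diagMap d) (φ := fun x => φ (diagMap d x)) (x := x)
        (h.differentiable.comp (diagMap d).differentiable).differentiableAt k
      rw [dd, dd_comp_diagMap h.differentiable] at this
      exact this
    have e3 := fderiv_fun_sub (e ![1, 1, -1] 3) (e ![1, 1, -2] 2)
    rw [dd, show fderiv ℝ (nitsche φ) x = _ from e3, sub_apply, e2, e2]
  simp only [strain, hd, PiLp.sub_apply, PiLp.smul_apply, diagMap_apply, smul_eq_mul]
  ring

/-- The products of diagonal entries have modulus at most `1` and `4` respectively, and `(3pa -
2qb)² ≤ 18 p²a² + 8 q²b²`. -/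
lemma strain_nitsche_sq_le {φ : E3 → E3} (h : IsTest φ) (x : E3) :
    ∑ i, ∑ j, strain (fun k => dd k (nitsche φ)) i j x ^ 2
      ≤ 18 * ∑ i, ∑ j, strain (fun k => dd k φ) i j (diagMap ![1, 1, -1] x) ^ 2
      + 128 * ∑ i, ∑ j, strain (fun k => dd k φ) i j (diagMap ![1, 1, -2] x) ^ 2 := by
  have key : ∀ (p q a b : ℝ), p ^ 2 ≤ 1 → q ^ 2 ≤ 16 →
      (3 * p * a - 2 * q * b) ^ 2 ≤ 18 * a ^ 2 + 128 * b ^ 2 := by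
    intro p q a b hp hq
    have h1 := mul_le_mul_of_nonneg_right hp (sq_nonneg a)
    have h2 := mul_le_mul_of_nonneg_right hq (sq_nonneg b)
    nlinarith [sq_nonneg (3 * p * a + 2 * q * b)]
  rw [Finset.mul_sum, Finset.mul_sum, ← Finset.sum_add_distrib]
  refine Finset.sum_le_sum fun i _ => ?_
  rw [Finset.mul_sum, Finset.mul_sum, ← Finset.sum_add_distrib]
  refine Finset.sum_le_sum fun j _ => ?_
  rw [strain_nitsche h]
  refine key _ _ _ _ ?_ ?_
  · fin_cases i <;> fin_cases j <;> norm_num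
  · fin_cases i <;> fin_cases j <;> norm_num

/-- Korn's inequality on the half space for smooth vector fields, up to the boundary. -/
lemma IsTest.korn_sq {φ : E3 → E3} (h : IsTest φ) :
    ∫ x, ∑ k, ‖dd k φ x‖ ^ 2 ∂halfVol
      ≤ 294 * ∫ x, ∑ i, ∑ j, HalfSpaceElasticity.strain (fun k => dd k φ) i j x ^ 2 ∂halfVol := by
  let N : (E3 → E3) → E3 → ℝ := fun u x =>
    nullLag 0 1 (fun x => u x 0) (fun x => u x 1) x + nullLag 0 2 (fun x => u x 0) (fun x => u x 2) x
      + nullLag 1 2 (fun x => u x 1) (fun x => u x 2) x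
  have hN : ∀ {u : E3 → E3}, IsTest u → Integrable (N u) := fun hu =>
    ((integrable_nullLag (hu.coord 0) (hu.coord 1) 0 1).add
      (integrable_nullLag (hu.coord 0) (hu.coord 2) 0 2)).add
      (integrable_nullLag (hu.coord 1) (hu.coord 2) 1 2)
  have hNsum : ∀ {u : E3 → E3}, IsTest u → ∀ μ : Measure E3, μ ≤ volume → ∫ x, N u x ∂μ
      = ∫ x, nullLag 0 1 (fun x => u x 0) (fun x => u x 1) x ∂μ
        + ∫ x, nullLag 0 2 (fun x => u x 0) (fun x => u x 2) x ∂μ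
        + ∫ x, nullLag 1 2 (fun x => u x 1) (fun x => u x 2) x ∂μ := by
    intro u hu μ hμ
    have i1 := (integrable_nullLag (hu.coord 0) (hu.coord 1) 0 1).mono_measure hμ
    have i2 := (integrable_nullLag (hu.coord 0) (hu.coord 2) 0 2).mono_measure hμ
    have i3 := (integrable_nullLag (hu.coord 1) (hu.coord 2) 1 2).mono_measure hμ
    have e1 := integral_add (i1.add i2) i3
    have e2 := integral_add i1 i2
    simp only [Pi.add_apply] at e1
    rw [← e2, ← e1]
  have hNeq : ∀ {u : E3 → E3}, IsTest u → ∀ x, N u x = (dd 0 u x 1 * dd 1 u x 0 - dd 0 u x 0 * dd 1 u x 1)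
      + (dd 0 u x 2 * dd 2 u x 0 - dd 0 u x 0 * dd 2 u x 2)
      + (dd 1 u x 2 * dd 2 u x 1 - dd 1 u x 1 * dd 2 u x 2) := by
    intro u hu x
    simp only [N, nullLag, dd_comp_coord hu.differentiable.differentiableAt]
  set w := HalfSpaceElasticity.nitsche φ with hwdef
  have hw : IsTest w := h.nitsche
  have hb : ∀ i, ∀ x : E3, x 2 = 0 → φ x i = w x i := fun i x hx => nitsche_boundary φ hx i
  -- `φ` and `w` share boundary values, and `N w` integrates to zero over the whole space. Hence `-∫
  -- N φ` below the boundary equals `∫ N w` above it.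
  have h1 : ∫ x, N φ x ∂halfVol = ∫ x, N w x ∂halfVol := by
    rw [hNsum h halfVol Measure.restrict_le_self, hNsum hw halfVol Measure.restrict_le_self,
      halfVol_integral_nullLag_eq (h.coord 0) (h.coord 1) (hw.coord 0) (hw.coord 1) (hb 0) (hb 1)
        (by decide),
      halfVol_integral_nullLag_eq (h.coord 0) (h.coord 2) (hw.coord 0) (hw.coord 2) (hb 0) (hb 2)
        (by decide),
      halfVol_integral_nullLag_eq (h.coord 1) (h.coord 2) (hw.coord 1) (hw.coord 2) (hb 1) (hb 2)
        (by decide)]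
  have h2 : ∫ x, N w x ∂halfVol + ∫ x in (lowerHalf : Set E3)ᶜ, N w x = 0 := by
    have := integral_add_compl measurableSet_lowerHalf (hN hw)
    rw [halfVol, this, hNsum hw _ le_rfl, integral_nullLag (hw.coord 0) (hw.coord 1),
      integral_nullLag (hw.coord 0) (hw.coord 2), integral_nullLag (hw.coord 1) (hw.coord 2)]
    simp
  set E : E3 → ℝ := fun x => ∑ i, ∑ j, HalfSpaceElasticity.strain (fun k => dd k φ) i j x ^ 2 with hE
  have hEt : IsTest E := h.strain_sq_sum
  have hE0 : ∀ x, 0 ≤ E x := fun x => by positivity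
  have hEi : Integrable E halfVol := hEt.integrable_half
  -- `292 = 2 · (18 + 128)`; both reflections have Jacobian of modulus at least `1`, so changing
  -- variables does not increase the integrals.
  have h3 : 2 * ∫ x in (lowerHalf : Set E3)ᶜ, N w x ≤ 292 * ∫ x, E x ∂halfVol := by
    have t1 : IsTest fun x => E (diagMap ![1, 1, -1] x) :=
      hEt.comp_diagMap fun i => by fin_cases i <;> simp
    have t2 : IsTest fun x => E (diagMap ![1, 1, -2] x) :=
      hEt.comp_diagMap fun i => by fin_cases i <;> simp
    have s1 := setIntegral_compl_comp_diagMap_le (d := ![1, 1, -1]) (by simp)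
      (by simp [Fin.prod_univ_three]) hE0
    have s2 := setIntegral_compl_comp_diagMap_le (d := ![1, 1, -2]) (by simp)
      (by simp [Fin.prod_univ_three]) hE0
    have s3 : ∫ x in (lowerHalf : Set E3)ᶜ, 2 * N w x ≤ ∫ x in (lowerHalf : Set E3)ᶜ,
        (36 * E (diagMap ![1, 1, -1] x) + 256 * E (diagMap ![1, 1, -2] x)) := by
      refine integral_mono ((hN hw).integrableOn.const_mul 2)
        ((t1.integrable.integrableOn.const_mul 36).add (t2.integrable.integrableOn.const_mul 256))
        fun x => ?_
      have e1 := strain_nitsche_sq_le h x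
      have e2 := strain_sq_le (fun k => dd k w) x
      rw [← hNeq hw x] at e2
      simp only [hE]
      linarith
    rw [integral_add (t1.integrable.integrableOn.const_mul 36)
      (t2.integrable.integrableOn.const_mul 256), integral_const_mul, integral_const_mul,
      integral_const_mul] at s3
    linarith
  have h4 : ∫ x, ∑ k, ‖dd k φ x‖ ^ 2 ∂halfVol ≤ ∫ x, (2 * E x - 2 * N φ x) ∂halfVol := by
    refine integral_mono_of_nonneg (Eventually.of_forall fun x => by positivity)
      ((hEi.const_mul 2).sub ((hN h).restrict.const_mul 2)) (Eventually.of_forall fun x => ?_)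
    have e1 := strain_identity (fun k => dd k φ) x
    rw [← hNeq h x] at e1
    have := sq_nonneg (∑ k, dd k φ x k)
    simp only [hE]
    linarith
  rw [integral_sub (hEi.const_mul 2) ((hN h).restrict.const_mul 2), integral_const_mul,
    integral_const_mul] at h4
  linarith

lemma IsTest.korn {φ : E3 → E3} (h : IsTest φ) (k : Fin 3) :
    nrm (dd k φ) ≤ 18 * ∑ i, ∑ j, nrm (HalfSpaceElasticity.strain (fun k => dd k φ) i j) := by
  have h1 := h.korn_sq
  have i1 : ∀ k, Integrable (fun x => ‖dd k φ x‖ ^ 2) halfVol := fun k =>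
    (h.deriv k).memLp.integrable_norm_pow (by norm_num)
  have hm : ∀ i j, MemLp (HalfSpaceElasticity.strain (fun k => dd k φ) i j) 2 halfVol :=
    fun i j => (h.strain i j).memLp
  have i2 : ∀ i j, Integrable (fun x => HalfSpaceElasticity.strain (fun k => dd k φ) i j x ^ 2) halfVol :=
    fun i j => (hm i j).integrable_sq
  rw [integral_finsetSum _ fun k _ => i1 k,
    integral_finsetSum _ fun i _ => integrable_finsetSum _ fun j _ => i2 i j] at h1
  have e1 : ∀ i j, ∫ x, HalfSpaceElasticity.strain (fun k => dd k φ) i j x ^ 2 ∂halfVol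
      = nrm (HalfSpaceElasticity.strain (fun k => dd k φ) i j) ^ 2 := by
    intro i j
    rw [nrm_sq (hm i j)]
    simp
  simp only [← nrm_sq (h.deriv _).memLp, integral_finsetSum _ fun j _ => i2 _ j, e1] at h1
  have h2 : nrm (dd k φ) ^ 2 ≤ ∑ k, nrm (dd k φ) ^ 2 :=
    Finset.single_le_sum (f := fun k => nrm (dd k φ) ^ 2) (fun k _ => sq_nonneg _) (Finset.mem_univ k)
  have h3 : ∑ i, ∑ j, nrm (HalfSpaceElasticity.strain (fun k => dd k φ) i j) ^ 2
      ≤ (∑ i, ∑ j, nrm (HalfSpaceElasticity.strain (fun k => dd k φ) i j)) ^ 2 := by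
    refine le_trans (Finset.sum_le_sum fun i _ => Finset.sum_sq_le_sq_sum_of_nonneg fun j _ => nrm_nonneg _) ?_
    exact Finset.sum_sq_le_sq_sum_of_nonneg (f := fun i => ∑ j, nrm (HalfSpaceElasticity.strain (fun k => dd k φ) i j))
      fun i _ => Finset.sum_nonneg fun j _ => nrm_nonneg _
  have h4 : 0 ≤ ∑ i, ∑ j, nrm (HalfSpaceElasticity.strain (fun k => dd k φ) i j) :=
    Finset.sum_nonneg fun i _ => Finset.sum_nonneg fun j _ => nrm_nonneg _
  -- The constant `18` works because `294 ≤ 18²`.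
  refine abs_le_of_sq_le_sq' (a := nrm (dd k φ)) ?_ (by positivity) |>.2
  nlinarith

end Korn

/-! ### Hardy and Korn inequalities in the energy space, by density. -/

section EnergyInequalities

lemma nrm_le_add_sub {F : Type*} [NormedAddCommGroup F] {f g : E3 → F} (hf : MemLp f 2 halfVol)
    (hg : MemLp g 2 halfVol) : nrm f ≤ nrm g + nrm fun x => g x - f x := by
  have h := nrm_add_le hg (hf.sub hg)
  rw [nrm_sub_rev g f]
  simpa [Pi.sub_def] using h

lemma nrm_finset_sum_le {F ι : Type*} [NormedAddCommGroup F] (s : Finset ι) {f : ι → E3 → F}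
    (hf : ∀ i ∈ s, MemLp (f i) 2 halfVol) : nrm (fun x => ∑ i ∈ s, f i x) ≤ ∑ i ∈ s, nrm (f i) := by
  classical
  induction s using Finset.induction_on with
  | empty => simp [nrm]
  | insert a s ha ih =>
    simp only [Finset.sum_insert ha]
    refine (nrm_add_le (hf a (Finset.mem_insert_self a s))
      (memLp_finsetSum s fun i hi => hf i (Finset.mem_insert_of_mem hi))).trans ?_
    gcongr
    exact ih fun i hi => hf i (Finset.mem_insert_of_mem hi)

lemma IsEnergy.exists_near {F : Type*} [NormedAddCommGroup F] [NormedSpace ℝ F] [CompleteSpace F]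
    {u : E3 → F} {D : Fin 3 → E3 → F} (h : IsEnergy u D) {ε : ℝ} (hε : 0 < ε) :
    ∃ φ : E3 → F, IsTest φ ∧ nrm (fun x => (rho x)⁻¹ • (φ x - u x)) ≤ ε ∧
      ∀ k, nrm (fun x => dd k φ x - D k x) ≤ ε := by
  obtain ⟨φ, hφ, h1, h2⟩ := h.exists_isTest_near (ε := ENNReal.ofReal ε) (by simpa using hε)
  exact ⟨φ, hφ, nrm_le_of_eLpNorm_le hε.le h1, fun k => nrm_le_of_eLpNorm_le hε.le (h2 k)⟩

/-- Hardy's inequality on the half space. -/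
theorem IsEnergy.hardy {F : Type*} [NormedAddCommGroup F] [InnerProductSpace ℝ F] [CompleteSpace F]
    {u : E3 → F} {D : Fin 3 → E3 → F} (h : IsEnergy u D) :
    nrm (fun x => (rho x)⁻¹ • u x) ≤ 2 * ∑ k, nrm (D k) := by
  refine le_of_forall_pos_le_add fun ε hε => ?_
  -- One error from the left-hand side and `2 · 3` from the three gradient components.
  obtain ⟨φ, hφ, h1, h2⟩ := h.exists_near (ε := ε / 7) (by positivity)
  have e1 := nrm_le_add_sub h.mem0 hφ.memLp_rho_inv_smul
  simp only [← smul_sub] at e1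
  have e2 : ∀ k, nrm (dd k φ) ≤ nrm (D k) + ε / 7 := fun k => by
    refine (nrm_le_add_sub (hφ.deriv k).memLp (h.mem1 k)).trans ?_
    rw [nrm_sub_rev]
    linarith [h2 k]
  have e3 : ∑ k, nrm (dd k φ) ≤ ∑ k, (nrm (D k) + ε / 7) := Finset.sum_le_sum fun k _ => e2 k
  rw [Finset.sum_add_distrib] at e3
  simp only [Finset.sum_const, Finset.card_univ, Fintype.card_fin, nsmul_eq_mul] at e3
  have e4 := hφ.hardy
  push_cast at e3
  linarith

lemma memLp_strain {D : Fin 3 → E3 → E3} (h : ∀ k, MemLp (D k) 2 halfVol) (i j : Fin 3) :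
    MemLp (strain D i j) 2 halfVol := by
  have e : ∀ k i : Fin 3, MemLp (fun x => D k x i) 2 halfVol := fun k i =>
    (EuclideanSpace.proj (𝕜 := ℝ) i).comp_memLp' (h k)
  refine (((e j i).add (e i j)).const_mul 2⁻¹).ae_eq (Eventually.of_forall fun x => ?_)
  simp only [strain, Pi.add_apply]
  ring

lemma abs_strain_le (D : Fin 3 → E3 → E3) (i j : Fin 3) (x : E3) :
    |strain D i j x| ≤ ∑ k, ‖D k x‖ := by
  have h : ∀ k i : Fin 3, |D k x i| ≤ ∑ k, ‖D k x‖ := fun k i =>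
    (PiLp.norm_apply_le (D k x) i).trans
      (Finset.single_le_sum (f := fun k => ‖D k x‖) (fun k _ => norm_nonneg _) (Finset.mem_univ k))
  rw [strain, abs_div, abs_two, div_le_iff₀ two_pos]
  linarith [abs_add_le (D j x i) (D i x j), h j i, h i j]

/-- Korn's inequality on the half space. -/
theorem IsEnergy.korn {u : E3 → E3} {D : Fin 3 → E3 → E3} (h : IsEnergy u D) (k : Fin 3) :
    nrm (D k) ≤ 18 * ∑ i, ∑ j, nrm (strain D i j) := by
  refine le_of_forall_pos_le_add fun ε hε => ?_
  -- One error from the left-hand side and `18 · 9 · 3` from the nine strain entries, each costing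
  -- at most three gradient errors.
  obtain ⟨φ, hφ, -, h2⟩ := h.exists_near (ε := ε / 487) (by positivity)
  have hd : ∀ k, MemLp (fun x => dd k φ x - D k x) 2 halfVol := fun k =>
    (hφ.deriv k).memLp.sub (h.mem1 k)
  have e1 := nrm_le_add_sub (h.mem1 k) (hφ.deriv k).memLp
  have e2 : ∀ i j, nrm (strain (fun k => dd k φ) i j) ≤ nrm (strain D i j) + 3 * (ε / 487) := by
    intro i j
    refine (nrm_le_add_sub (memLp_strain (fun k => (hφ.deriv k).memLp) i j)
      (memLp_strain h.mem1 i j)).trans ?_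
    rw [nrm_sub_rev]
    gcongr
    have e : (fun x => strain (fun k => dd k φ) i j x - strain D i j x)
        = strain (fun k x => dd k φ x - D k x) i j := by
      ext x
      simp only [strain, PiLp.sub_apply]
      ring
    rw [e]
    have hs : MemLp (fun x => ∑ k, ‖dd k φ x - D k x‖) 2 halfVol :=
      memLp_finsetSum _ fun k _ => (hd k).norm
    calc nrm (strain (fun k x => dd k φ x - D k x) i j)
        ≤ nrm fun x => ∑ k, ‖dd k φ x - D k x‖ := nrm_mono hs (Eventually.of_forall fun x =>
          (abs_strain_le _ i j x).trans (le_abs_self _))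
      _ ≤ ∑ k, nrm fun x => ‖dd k φ x - D k x‖ := nrm_finset_sum_le _ fun k _ => (hd k).norm
      _ ≤ ∑ _k : Fin 3, ε / 487 := Finset.sum_le_sum fun k _ => by rw [nrm_norm]; exact h2 k
      _ = 3 * (ε / 487) := by simp
  have e3 := hφ.korn k
  have e4 : ∑ i, ∑ j, nrm (strain (fun k => dd k φ) i j)
      ≤ ∑ i, ∑ j, (nrm (strain D i j) + 3 * (ε / 487)) :=
    Finset.sum_le_sum fun i _ => Finset.sum_le_sum fun j _ => e2 i j
  simp only [Finset.sum_add_distrib, Finset.sum_const, Finset.card_univ, Fintype.card_fin,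
    nsmul_eq_mul] at e4
  push_cast at e4
  linarith [h2 k]

end EnergyInequalities

/-! ### The elastic energy density: bounds and coercivity. -/

section Form

/-- The density `ℂ A : A'` of the elastic energy form, where `A` and `A'` are built from the
gradients `D` and `D'`. -/
def form (lam mu : E3 → ℝ) (D D' : Fin 3 → E3 → E3) (x : E3) : ℝ :=
  ∑ i, ∑ j, stress lam mu D i j x * D' j x i

/-- The stress is symmetric and so pairs only with the symmetric part of `D'`. This shows the
symmetry of the form, on which `form_weight_identity` depends. -/
lemma form_eq (lam mu : E3 → ℝ) (D D' : Fin 3 → E3 → E3) (x : E3) :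
    form lam mu D D' x = lam x * ((∑ k, strain D k k x) * ∑ k, strain D' k k x)
      + 2 * mu x * ∑ i, ∑ j, strain D i j x * strain D' i j x := by
  simp [form, stress, strain, Fin.sum_univ_three]
  ring

/-- Splitting the strain into trace and trace-free part gives `2 mu (S - t² / 3) + (3 lam + 2 mu) t²
/ 3` with `t² ≤ 3S`, so the two convexity constants bound the two parts separately. -/
lemma form_self_ge {α₀ β₀ : ℝ} {lam mu : E3 → ℝ} {x : E3} (h1 : α₀ ≤ mu x)
    (h2 : β₀ ≤ 3 * lam x + 2 * mu x) (D : Fin 3 → E3 → E3) :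
    min (2 * α₀) β₀ * ∑ i, ∑ j, strain D i j x ^ 2 ≤ form lam mu D D x := by
  rw [form_eq]
  set t := ∑ k, strain D k k x with ht
  set S := ∑ i, ∑ j, strain D i j x ^ 2 with hS
  have e : ∑ i, ∑ j, strain D i j x * strain D i j x = S := by simp only [hS, sq]
  have h3 : t ^ 2 ≤ 3 * S := by
    simp only [ht, hS, Fin.sum_univ_three]
    nlinarith [sq_nonneg (strain D 0 0 x - strain D 1 1 x), sq_nonneg (strain D 0 0 x - strain D 2 2 x),
      sq_nonneg (strain D 1 1 x - strain D 2 2 x), sq_nonneg (strain D 0 1 x),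
      sq_nonneg (strain D 0 2 x), sq_nonneg (strain D 1 2 x), sq_nonneg (strain D 1 0 x),
      sq_nonneg (strain D 2 0 x), sq_nonneg (strain D 2 1 x)]
  rw [e]
  have m1 : min (2 * α₀) β₀ ≤ 2 * mu x := (min_le_left _ _).trans (by linarith)
  have m2 : min (2 * α₀) β₀ ≤ 3 * lam x + 2 * mu x := (min_le_right _ _).trans h2
  nlinarith [mul_nonneg (sub_nonneg.2 m1) (sub_nonneg.2 h3), mul_nonneg (sub_nonneg.2 m2) (sq_nonneg t)]

lemma abs_stress_le (lam mu : E3 → ℝ) (D : Fin 3 → E3 → E3) (i j : Fin 3) (x : E3) {b : ℝ}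
    (h1 : |lam x| ≤ b) (h2 : |mu x| ≤ b) : |stress lam mu D i j x| ≤ 3 * b * ∑ k, ‖D k x‖ := by
  have hb : 0 ≤ b := (abs_nonneg _).trans h1
  have hs : 0 ≤ ∑ k, ‖D k x‖ := Finset.sum_nonneg fun k _ => norm_nonneg _
  have ht : |if i = j then ∑ k, strain D k k x else 0| ≤ ∑ k, ‖D k x‖ := by
    split_ifs
    · have h : ∀ k, |strain D k k x| ≤ ‖D k x‖ := by
        intro k
        rw [strain, add_self_div_two]
        exact PiLp.norm_apply_le (D k x) k
      exact (Finset.abs_sum_le_sum_abs _ _).trans (Finset.sum_le_sum fun k _ => h k)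
    · simpa using hs
  calc |stress lam mu D i j x| ≤ |lam x * (if i = j then ∑ k, strain D k k x else 0)|
        + |2 * mu x * strain D i j x| := abs_add_le _ _
    _ = |lam x| * |if i = j then ∑ k, strain D k k x else 0| + 2 * |mu x| * |strain D i j x| := by
        rw [abs_mul, abs_mul, abs_mul, abs_two]
    _ ≤ b * (∑ k, ‖D k x‖) + 2 * b * ∑ k, ‖D k x‖ := by
        gcongr
        exact abs_strain_le D i j x
    _ = 3 * b * ∑ k, ‖D k x‖ := by ring

lemma abs_form_le (lam mu : E3 → ℝ) (D D' : Fin 3 → E3 → E3) (x : E3) {b : ℝ}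
    (h1 : |lam x| ≤ b) (h2 : |mu x| ≤ b) :
    |form lam mu D D' x| ≤ 9 * b * ((∑ k, ‖D k x‖) * ∑ k, ‖D' k x‖) := by
  have hb : 0 ≤ b := (abs_nonneg _).trans h1
  have hs : 0 ≤ ∑ k, ‖D k x‖ := Finset.sum_nonneg fun k _ => norm_nonneg _
  calc |form lam mu D D' x| ≤ ∑ i, ∑ j, |stress lam mu D i j x * D' j x i| :=
        (Finset.abs_sum_le_sum_abs _ _).trans
          (Finset.sum_le_sum fun i _ => Finset.abs_sum_le_sum_abs _ _)
    _ ≤ ∑ _i : Fin 3, ∑ j, 3 * b * (∑ k, ‖D k x‖) * ‖D' j x‖ := by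
        gcongr with i _ j _
        rw [abs_mul]
        gcongr
        · exact abs_stress_le lam mu D i j x h1 h2
        · exact PiLp.norm_apply_le (D' j x) i
    _ = 9 * b * ((∑ k, ‖D k x‖) * ∑ k, ‖D' k x‖) := by
        rw [← Finset.mul_sum]
        simp
        ring

lemma aestronglyMeasurable_coord {f : E3 → E3} (hf : AEStronglyMeasurable f halfVol) (i : Fin 3) :
    AEStronglyMeasurable (fun x => f x i) halfVol :=
  (EuclideanSpace.proj (𝕜 := ℝ) i).continuous.comp_aestronglyMeasurable hf

lemma aestronglyMeasurable_strain {D : Fin 3 → E3 → E3}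
    (hD : ∀ k, AEStronglyMeasurable (D k) halfVol) (i j : Fin 3) :
    AEStronglyMeasurable (strain D i j) halfVol :=
  (((aestronglyMeasurable_coord (hD j) i).add (aestronglyMeasurable_coord (hD i) j)).const_mul
    2⁻¹).congr (Eventually.of_forall fun x => by simp only [strain, Pi.add_apply]; ring)

lemma aestronglyMeasurable_stress {lam mu : E3 → ℝ} (hl : AEStronglyMeasurable lam halfVol)
    (hm : AEStronglyMeasurable mu halfVol) {D : Fin 3 → E3 → E3}
    (hD : ∀ k, AEStronglyMeasurable (D k) halfVol) (i j : Fin 3) :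
    AEStronglyMeasurable (stress lam mu D i j) halfVol := by
  have h1 : AEStronglyMeasurable (fun x => if i = j then ∑ k, strain D k k x else 0) halfVol := by
    split_ifs
    · exact Finset.aestronglyMeasurable_fun_sum _ fun k _ => aestronglyMeasurable_strain hD k k
    · exact aestronglyMeasurable_const
  exact (hl.mul h1).add ((hm.const_mul 2).mul (aestronglyMeasurable_strain hD i j))

lemma aestronglyMeasurable_form {lam mu : E3 → ℝ} (hl : AEStronglyMeasurable lam halfVol)
    (hm : AEStronglyMeasurable mu halfVol) {D D' : Fin 3 → E3 → E3}
    (hD : ∀ k, AEStronglyMeasurable (D k) halfVol) (hD' : ∀ k, AEStronglyMeasurable (D' k) halfVol) :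
    AEStronglyMeasurable (form lam mu D D') halfVol :=
  Finset.aestronglyMeasurable_fun_sum _ fun i _ => Finset.aestronglyMeasurable_fun_sum _ fun j _ =>
    (aestronglyMeasurable_stress hl hm hD i j).mul (aestronglyMeasurable_coord (hD' j) i)

lemma memLp_sum_norm {D : Fin 3 → E3 → E3} (h : ∀ k, MemLp (D k) 2 halfVol) :
    MemLp (fun x => ∑ k, ‖D k x‖) 2 halfVol := memLp_finsetSum _ fun k _ => (h k).norm

lemma nrm_sum_norm_le {D : Fin 3 → E3 → E3} (h : ∀ k, MemLp (D k) 2 halfVol) :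
    nrm (fun x => ∑ k, ‖D k x‖) ≤ ∑ k, nrm (D k) :=
  (nrm_finset_sum_le _ fun k _ => (h k).norm).trans
    (Finset.sum_le_sum fun k _ => (nrm_norm (D k)).le)

/-- Boundedness of the energy form, with a weight that bounds the coefficients. -/
lemma abs_integral_form_le {lam mu q : E3 → ℝ} (hq : ∀ᵐ x ∂halfVol, |lam x| ≤ q x ∧ |mu x| ≤ q x)
    {D D' : Fin 3 → E3 → E3} (hD : ∀ k, MemLp (D k) 2 halfVol)
    (hD' : ∀ k, MemLp (fun x => q x • D' k x) 2 halfVol) :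
    |∫ x, form lam mu D D' x ∂halfVol|
      ≤ 9 * ((∑ k, nrm (D k)) * ∑ k, nrm fun x => q x • D' k x) := by
  refine (abs_integral_le_of_le_mul (memLp_sum_norm hD) (memLp_sum_norm hD') (c := 9) (by norm_num)
    ?_).trans ?_
  · filter_upwards [hq] with x hx
    refine (abs_form_le lam mu D D' x hx.1 hx.2).trans (le_of_eq ?_)
    have hb : 0 ≤ q x := (abs_nonneg _).trans hx.1
    have h0 : ∀ D : Fin 3 → E3 → E3, 0 ≤ ∑ k, ‖D k x‖ := fun D =>
      Finset.sum_nonneg fun k _ => norm_nonneg _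
    rw [Real.norm_of_nonneg (h0 D), Real.norm_of_nonneg (h0 fun k x => q x • D' k x)]
    simp only [norm_smul, Real.norm_of_nonneg hb, ← Finset.mul_sum]
    ring
  · gcongr
    · exact nrm_nonneg _
    · exact Finset.sum_nonneg fun k _ => nrm_nonneg _
    · exact nrm_sum_norm_le hD
    · exact nrm_sum_norm_le hD'

lemma integrable_form {lam mu : E3 → ℝ} (hl : IsBddCoeff lam) (hm : IsBddCoeff mu)
    {D D' : Fin 3 → E3 → E3} (hD : ∀ k, MemLp (D k) 2 halfVol) (hD' : ∀ k, MemLp (D' k) 2 halfVol) :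
    Integrable (form lam mu D D') halfVol := by
  obtain ⟨B, hB⟩ := hl.2
  obtain ⟨B', hB'⟩ := hm.2
  refine integrable_of_le_mul (memLp_sum_norm hD) (memLp_sum_norm hD')
    (aestronglyMeasurable_form hl.1 hm.1 (fun k => (hD k).1) fun k => (hD' k).1)
    (c := 9 * max B B') ?_
  filter_upwards [hB, hB'] with x hx hx'
  refine (abs_form_le lam mu D D' x (hx.trans (le_max_left _ _)) (hx'.trans (le_max_right _ _))).trans
    (le_of_eq ?_)
  have h0 : ∀ D : Fin 3 → E3 → E3, 0 ≤ ∑ k, ‖D k x‖ := fun D =>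
    Finset.sum_nonneg fun k _ => norm_nonneg _
  rw [Real.norm_of_nonneg (h0 D), Real.norm_of_nonneg (h0 D')]

/-- Coercivity of the energy form. -/
lemma IsEnergy.coercive {M K α₀ β₀ : ℝ} {lam mu : E3 → ℝ} (h : IsLameMedium M K α₀ β₀ lam mu)
    (hα₀ : 0 < α₀) (hβ₀ : 0 < β₀) {u : E3 → E3} {D : Fin 3 → E3 → E3} (hu : IsEnergy u D) :
    (∑ k, nrm (D k)) ^ 2 ≤ 26244 / min (2 * α₀) β₀ * ∫ x, form lam mu D D x ∂halfVol := by
  obtain ⟨hl, hm, -⟩ := h.coeffs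
  have hc : 0 < min (2 * α₀) β₀ := lt_min (by linarith) hβ₀
  have hs := fun i j => memLp_strain hu.mem1 i j
  have i1 : ∀ i j, Integrable (fun x => strain D i j x ^ 2) halfVol := fun i j => (hs i j).integrable_sq
  have h1 : min (2 * α₀) β₀ * ∑ i, ∑ j, nrm (strain D i j) ^ 2 ≤ ∫ x, form lam mu D D x ∂halfVol := by
    have e : ∑ i, ∑ j, nrm (strain D i j) ^ 2 = ∫ x, ∑ i, ∑ j, strain D i j x ^ 2 ∂halfVol := by
      rw [integral_finsetSum _ fun i _ => integrable_finsetSum _ fun j _ => i1 i j]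
      refine Finset.sum_congr rfl fun i _ => ?_
      rw [integral_finsetSum _ fun j _ => i1 i j]
      refine Finset.sum_congr rfl fun j _ => ?_
      rw [nrm_sq (hs i j)]
      simp
    rw [e, ← integral_const_mul]
    refine integral_mono_ae ((integrable_finsetSum _ fun i _ => integrable_finsetSum _ fun j _ =>
      i1 i j).const_mul _) (integrable_form hl hm hu.mem1 hu.mem1) ?_
    filter_upwards [ae_restrict_mem measurableSet_lowerHalf] with x hx
    exact form_self_ge (h.convex_mu x hx) (h.convex_lam x hx) D
  -- Korn's constant `18` is summed over three derivatives. Together with Cauchy–Schwarz over nine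
  -- entries below, `54² · 9 = 26244`.
  have h2 : ∑ k, nrm (D k) ≤ 54 * ∑ i, ∑ j, nrm (strain D i j) := by
    refine (Finset.sum_le_sum fun k _ => hu.korn k).trans (le_of_eq ?_)
    simp
    ring
  have h3 : (∑ i, ∑ j, nrm (strain D i j)) ^ 2 ≤ 9 * ∑ i, ∑ j, nrm (strain D i j) ^ 2 := by
    calc (∑ i, ∑ j, nrm (strain D i j)) ^ 2 ≤ 3 * ∑ i, (∑ j, nrm (strain D i j)) ^ 2 := by
          simpa using sq_sum_le_card_mul_sum_sq (s := Finset.univ)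
            (f := fun i => ∑ j, nrm (strain D i j))
      _ ≤ 3 * ∑ i, 3 * ∑ j, nrm (strain D i j) ^ 2 := by
          gcongr with i
          simpa using sq_sum_le_card_mul_sum_sq (s := Finset.univ) (f := fun j => nrm (strain D i j))
      _ = 9 * ∑ i, ∑ j, nrm (strain D i j) ^ 2 := by rw [← Finset.mul_sum]; ring
  have h4 : 0 ≤ ∑ k, nrm (D k) := Finset.sum_nonneg fun k _ => nrm_nonneg _
  calc (∑ k, nrm (D k)) ^ 2 ≤ (54 * ∑ i, ∑ j, nrm (strain D i j)) ^ 2 := pow_le_pow_left₀ h4 h2 2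
    _ ≤ 26244 * ∑ i, ∑ j, nrm (strain D i j) ^ 2 := by rw [mul_pow]; linarith
    _ = 26244 / min (2 * α₀) β₀ * (min (2 * α₀) β₀ * ∑ i, ∑ j, nrm (strain D i j) ^ 2) := by
        field_simp
    _ ≤ _ := by gcongr

end Form

/-! ### The energy space as a Hilbert space of jets. -/

section WeakSolutions

variable {F : Type*} [NormedAddCommGroup F] [NormedSpace ℝ F]

lemma norm_integral_smul_le {θ : E3 → ℝ} {f : E3 → F} (hθ : MemLp θ 2 halfVol)
    (hf : MemLp f 2 halfVol) : ‖∫ x, θ x • f x ∂halfVol‖ ≤ nrm θ * nrm f := by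
  refine (norm_integral_le_integral_norm _).trans ?_
  simp only [norm_smul]
  exact integral_norm_mul_norm_le hθ hf

lemma integrable_smul_of_memLp {θ : E3 → ℝ} {f : E3 → F} (hθ : MemLp θ 2 halfVol)
    (hf : MemLp f 2 halfVol) : Integrable (fun x => θ x • f x) halfVol :=
  memLp_one_iff_integrable.1 (hf.smul (r := 1) hθ)

lemma WeakD.add {k : Fin 3} {u w u' w' : E3 → F} (h : WeakD k u w) (h' : WeakD k u' w')
    (hu : LocallyIntegrable u halfVol) (hw : LocallyIntegrable w halfVol)
    (hu' : LocallyIntegrable u' halfVol) (hw' : LocallyIntegrable w' halfVol) :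
    WeakD k (fun x => u x + u' x) (fun x => w x + w' x) := by
  intro φ hφ hs
  simp only [smul_add]
  rw [integral_add ((hφ.deriv k).integrable_smul hu) ((hφ.deriv k).integrable_smul hu'),
    integral_add (hφ.integrable_smul hw) (hφ.integrable_smul hw'), h φ hφ hs, h' φ hφ hs, neg_add]

lemma WeakD.const_smul {k : Fin 3} {u w : E3 → F} (h : WeakD k u w) (c : ℝ) :
    WeakD k (fun x => c • u x) (fun x => c • w x) := by
  intro φ hφ hs
  simp only [smul_comm _ c]
  rw [integral_smul, integral_smul, h φ hφ hs, smul_neg]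

lemma IsEnergy.add {u u' : E3 → F} {D D' : Fin 3 → E3 → F} (h : IsEnergy u D)
    (h' : IsEnergy u' D') : IsEnergy (fun x => u x + u' x) (fun k x => D k x + D' k x) where
  mem0 := (h.mem0.add h'.mem0).ae_eq (Eventually.of_forall fun x => by simp [smul_add])
  mem1 k := (h.mem1 k).add (h'.mem1 k)
  weak k := (h.weak k).add (h'.weak k) h.locallyIntegrable
    ((h.mem1 k).locallyIntegrable (by norm_num)) h'.locallyIntegrable
    ((h'.mem1 k).locallyIntegrable (by norm_num))

lemma IsEnergy.const_smul {u : E3 → F} {D : Fin 3 → E3 → F} (h : IsEnergy u D) (c : ℝ) :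
    IsEnergy (fun x => c • u x) (fun k x => c • D k x) where
  mem0 := (h.mem0.const_smul c).ae_eq (Eventually.of_forall fun x => by simp [smul_comm c])
  mem1 k := (h.mem1 k).const_smul c
  weak k := (h.weak k).const_smul c

/-- Weak derivatives are preserved by limits. -/
lemma WeakD.of_approx {k : Fin 3} {u w : E3 → F} (hu : MemLp (fun x => (rho x)⁻¹ • u x) 2 halfVol)
    (hw : MemLp w 2 halfVol)
    (h : ∀ ε > 0, ∃ u' w', WeakD k u' w' ∧ MemLp (fun x => (rho x)⁻¹ • u' x) 2 halfVol ∧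
      MemLp w' 2 halfVol ∧ nrm (fun x => (rho x)⁻¹ • (u' x - u x)) ≤ ε ∧
      nrm (fun x => w' x - w x) ≤ ε) : WeakD k u w := by
  intro φ hφ hs
  rw [← sub_eq_zero, ← norm_le_zero_iff, sub_neg_eq_add]
  have hφρ : MemLp (fun x => dd k φ x * rho x) 2 halfVol :=
    (IsTest.smul' (hφ.deriv k) contDiff_rho).memLp
  set A := nrm (fun x => dd k φ x * rho x) + nrm φ with hA
  have hA0 : 0 ≤ A := add_nonneg (nrm_nonneg _) (nrm_nonneg _)
  refine le_of_forall_pos_le_add fun ε hε => ?_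
  obtain ⟨u', w', h1, hu', hw', h2, h3⟩ := h (ε / (A + 1)) (by positivity)
  have e := h1 φ hφ hs
  have hue : ∀ v : E3 → F, (fun x => dd k φ x • v x) = fun x => (dd k φ x * rho x) • ((rho x)⁻¹ • v x) := by
    intro v
    ext x
    rw [smul_smul, mul_assoc, mul_inv_cancel₀ (rho_pos x).ne', mul_one]
  have hus : MemLp (fun x => (rho x)⁻¹ • (u' x - u x)) 2 halfVol := 
    (hu'.sub hu).ae_eq (Eventually.of_forall fun x => by simp [smul_sub])
  have e1 : ∫ x, dd k φ x • u x ∂halfVol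
      = ∫ x, dd k φ x • u' x ∂halfVol - ∫ x, (dd k φ x * rho x) • ((rho x)⁻¹ • (u' x - u x)) ∂halfVol := by
    have i1 := integrable_smul_of_memLp hφρ hu'
    have i2 := integrable_smul_of_memLp hφρ hus
    rw [hue u, hue u', ← integral_sub i1 i2]
    refine integral_congr_ae (Eventually.of_forall fun x => ?_)
    simp only [← smul_sub, sub_sub_cancel]
  have e2 : ∫ x, φ x • w x ∂halfVol
      = ∫ x, φ x • w' x ∂halfVol - ∫ x, φ x • (w' x - w x) ∂halfVol := by
    have i1 := integrable_smul_of_memLp hφ.memLp hw'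
    have i2 := integrable_smul_of_memLp hφ.memLp (hw'.sub hw)
    simp only [Pi.sub_apply] at i2
    rw [← integral_sub i1 i2]
    refine integral_congr_ae (Eventually.of_forall fun x => ?_)
    simp only [← smul_sub, sub_sub_cancel]
  have b1 := norm_integral_smul_le hφρ hus
  have b2 := norm_integral_smul_le hφ.memLp (hw'.sub hw)
  simp only [Pi.sub_apply] at b2
  have b3 : nrm (fun x => dd k φ x * rho x) * nrm (fun x => (rho x)⁻¹ • (u' x - u x))
      ≤ nrm (fun x => dd k φ x * rho x) * (ε / (A + 1)) :=
    mul_le_mul_of_nonneg_left h2 (nrm_nonneg _)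
  have b4 : nrm φ * nrm (w' - w) ≤ nrm φ * (ε / (A + 1)) :=
    mul_le_mul_of_nonneg_left h3 (nrm_nonneg _)
  have b5 : A * (ε / (A + 1)) ≤ ε := by
    rw [mul_div_assoc', div_le_iff₀ (by positivity)]
    nlinarith
  rw [e1, e2, e]
  have e3 : ∀ a b c : F, -a - b + (a - c) = -(b + c) := fun a b c => by abel
  rw [e3, norm_neg, zero_add]
  refine (norm_add_le _ _).trans ((add_le_add (b1.trans b3) (b2.trans b4)).trans ?_)
  rw [← add_mul]
  exact b5

/-- Pointwise values of the jets `(ϱ⁻¹ v, ∂₁ v, ∂₂ v, ∂₃ v)`. -/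
abbrev JetPt : Type := PiLp 2 (fun _ : Fin 4 => E3)

/-- The vector field `v` encoded by a square integrable jet. -/
def jetField (j : Lp JetPt 2 halfVol) (x : E3) : E3 := rho x • (j : E3 → JetPt) x 0

/-- The gradient encoded by a square integrable jet. -/
def jetGrad (j : Lp JetPt 2 halfVol) (k : Fin 3) (x : E3) : E3 := (j : E3 → JetPt) x k.succ

lemma memLp_jet (j : Lp JetPt 2 halfVol) (c : Fin 4) :
    MemLp (fun x => (j : E3 → JetPt) x c) 2 halfVol := (Lp.memLp j).eval_piLp c

lemma rho_inv_smul_jetField (j : Lp JetPt 2 halfVol) :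
    (fun x => (rho x)⁻¹ • jetField j x) = fun x => (j : E3 → JetPt) x 0 := by
  ext1 x
  rw [jetField, smul_smul, inv_mul_cancel₀ (rho_pos x).ne', one_smul]

lemma nrm_eq_norm {G : Type*} [NormedAddCommGroup G] (j : Lp G 2 halfVol) : nrm (j : E3 → G) = ‖j‖ :=
  rfl

lemma nrm_jet_le (j : Lp JetPt 2 halfVol) (c : Fin 4) :
    nrm (fun x => (j : E3 → JetPt) x c) ≤ ‖j‖ :=
  nrm_mono (Lp.memLp j) (Eventually.of_forall fun _ => PiLp.norm_apply_le _ c)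

lemma norm_jet_le (j : Lp JetPt 2 halfVol) : ‖j‖ ≤ ∑ c, nrm (fun x => (j : E3 → JetPt) x c) := by
  have h : nrm (j : E3 → JetPt) ≤ nrm fun x => ∑ c, ‖(j : E3 → JetPt) x c‖ := by
    refine nrm_mono (memLp_finsetSum _ fun c _ => (memLp_jet j c).norm) (Eventually.of_forall fun x => ?_)
    have h0 : 0 ≤ ∑ c, ‖(j : E3 → JetPt) x c‖ := Finset.sum_nonneg fun c _ => norm_nonneg _
    rw [Real.norm_of_nonneg h0]
    refine abs_le_of_sq_le_sq' (a := ‖(j : E3 → JetPt) x‖) ?_ h0 |>.2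
    rw [PiLp.norm_sq_eq_of_L2]
    exact Finset.sum_sq_le_sq_sum_of_nonneg fun c _ => norm_nonneg _
  rw [← nrm_eq_norm]
  refine h.trans ((nrm_finset_sum_le _ fun c _ => (memLp_jet j c).norm).trans (le_of_eq ?_))
  simp only [nrm_norm]

lemma jetField_add (j j' : Lp JetPt 2 halfVol) :
    jetField (j + j') =ᵐ[halfVol] fun x => jetField j x + jetField j' x := by
  filter_upwards [Lp.coeFn_add j j'] with x hx
  simp only [jetField]
  rw [hx]
  simp

lemma jetGrad_add (j j' : Lp JetPt 2 halfVol) (k : Fin 3) :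
    jetGrad (j + j') k =ᵐ[halfVol] fun x => jetGrad j k x + jetGrad j' k x := by
  filter_upwards [Lp.coeFn_add j j'] with x hx
  simp only [jetGrad]
  rw [hx]
  simp

lemma jetField_smul (c : ℝ) (j : Lp JetPt 2 halfVol) :
    jetField (c • j) =ᵐ[halfVol] fun x => c • jetField j x := by
  filter_upwards [Lp.coeFn_smul c j] with x hx
  simp only [jetField]
  rw [hx]
  simp [smul_comm c]

lemma jetGrad_smul (c : ℝ) (j : Lp JetPt 2 halfVol) (k : Fin 3) :
    jetGrad (c • j) k =ᵐ[halfVol] fun x => c • jetGrad j k x := by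
  filter_upwards [Lp.coeFn_smul c j] with x hx
  simp only [jetGrad]
  rw [hx]
  simp

lemma IsEnergy.congr {u u' : E3 → F} {D D' : Fin 3 → E3 → F} (h : IsEnergy u D)
    (hu : u =ᵐ[halfVol] u') (hD : ∀ k, D k =ᵐ[halfVol] D' k) : IsEnergy u' D' where
  mem0 := h.mem0.ae_eq (hu.mono fun x hx => by simp only [hx])
  mem1 k := (h.mem1 k).ae_eq (hD k)
  weak k := (h.weak k).congr hu (hD k)

lemma isEnergy_zero : IsEnergy (fun _ => (0 : F)) (fun _ _ => 0) where
  mem0 := by simp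
  mem1 k := by simp
  weak k := fun φ _ _ => by simp

/-- The Hilbert space of jets of vector fields of finite energy. -/
def energySpace : Submodule ℝ (Lp JetPt 2 halfVol) where
  carrier := {j | IsEnergy (jetField j) (jetGrad j)}
  add_mem' := fun {a b} ha hb =>
    (ha.add hb).congr (jetField_add a b).symm fun k => (jetGrad_add a b k).symm
  zero_mem' := by
    refine (isEnergy_zero (F := E3)).congr ?_ fun k => ?_
    · filter_upwards [Lp.coeFn_zero JetPt 2 halfVol] with x hx
      simp only [jetField]
      rw [hx]
      simp
    · filter_upwards [Lp.coeFn_zero JetPt 2 halfVol] with x hx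
      simp only [jetGrad]
      rw [hx]
      simp
  smul_mem' := fun c {a} ha =>
    (ha.const_smul c).congr (jetField_smul c a).symm fun k => (jetGrad_smul c a k).symm

/-- The weak derivative relation passes to `L²` limits of jets. Closedness gives the completeness
that Lax–Milgram requires. -/
lemma isClosed_energySpace : IsClosed (energySpace : Set (Lp JetPt 2 halfVol)) := by
  refine isClosed_of_closure_subset fun j hj => ?_
  have h0 : MemLp (fun x => (rho x)⁻¹ • jetField j x) 2 halfVol := by
    rw [rho_inv_smul_jetField]; exact memLp_jet j 0
  refine ⟨h0, fun k => memLp_jet j k.succ, fun k => WeakD.of_approx h0 (memLp_jet j k.succ) ?_⟩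
  intro ε hε
  obtain ⟨j', hj', hd⟩ := Metric.mem_closure_iff.1 hj ε hε
  have hj'' : IsEnergy (jetField j') (jetGrad j') := hj'
  rw [dist_eq_norm, norm_sub_rev] at hd
  have e : ∀ c : Fin 4, nrm (fun x => (j' : E3 → JetPt) x c - (j : E3 → JetPt) x c) ≤ ε := by
    intro c
    refine (nrm_congr ?_).le.trans ((nrm_jet_le (j' - j) c).trans hd.le)
    filter_upwards [Lp.coeFn_sub j' j] with x hx
    rw [hx]
    simp
  refine ⟨jetField j', jetGrad j' k, hj''.weak k, hj''.mem0, hj''.mem1 k, ?_, e k.succ⟩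
  refine (nrm_congr (Eventually.of_forall fun x => ?_)).le.trans (e 0)
  simp only [jetField, ← smul_sub, smul_smul, inv_mul_cancel₀ (rho_pos x).ne', one_smul]

instance : CompleteSpace energySpace := isClosed_energySpace.completeSpace_coe

lemma exists_energySpace {u : E3 → E3} {D : Fin 3 → E3 → E3} (h : IsEnergy u D) :
    ∃ j : energySpace, jetField j =ᵐ[halfVol] u ∧ ∀ k, jetGrad j k =ᵐ[halfVol] D k := by
  let f : E3 → JetPt := fun x => WithLp.toLp 2 (Fin.cons ((rho x)⁻¹ • u x) fun k => D k x)
  have hf : MemLp f 2 halfVol := by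
    refine MemLp.of_eval_piLp fun c => ?_
    refine Fin.cases ?_ (fun k => ?_) c
    · exact h.mem0
    · exact h.mem1 k
  have h0 : jetField (hf.toLp f) =ᵐ[halfVol] u := by
    filter_upwards [hf.coeFn_toLp] with x hx
    simp [jetField, hx, f, smul_smul, mul_inv_cancel₀ (rho_pos x).ne']
  have h1 : ∀ k, jetGrad (hf.toLp f) k =ᵐ[halfVol] D k := fun k => by
    filter_upwards [hf.coeFn_toLp] with x hx
    simp [jetGrad, hx, f]
  exact ⟨⟨hf.toLp f, h.congr h0.symm fun k => (h1 k).symm⟩, h0, h1⟩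

end WeakSolutions

/-! ### Existence of weak solutions and the energy estimate. -/

section LaxMilgram

variable {M K α₀ β₀ : ℝ} {lam mu : E3 → ℝ}

lemma IsLameMedium.ae_abs_le (h : IsLameMedium M K α₀ β₀ lam mu) :
    ∀ᵐ x ∂halfVol, |lam x| ≤ |M| ∧ |mu x| ≤ |M| := by
  have key : ∀ g : E3 → ℝ, eLpNorm g ∞ halfVol ≤ ENNReal.ofReal M → ∀ᵐ x ∂halfVol, |g x| ≤ |M| := by
    intro g hg
    filter_upwards [ae_le_eLpNormEssSup (f := g) (μ := halfVol)] with x hx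
    rw [← eLpNorm_exponent_top] at hx
    have h1 := (hx.trans hg).trans (ENNReal.ofReal_le_ofReal (le_abs_self M))
    rw [← ofReal_norm, ENNReal.ofReal_le_ofReal_iff (abs_nonneg M)] at h1
    exact h1
  have hb := h.bound
  filter_upwards [key lam (le_trans (le_trans le_self_add le_add_self) hb),
    key mu (le_trans (le_trans le_self_add le_self_add) hb)] with x h1 h2
  exact ⟨h1, h2⟩

lemma form_congr {D D' E E' : Fin 3 → E3 → E3} {x : E3} (h : ∀ k, D k x = D' k x)
    (h' : ∀ k, E k x = E' k x) : form lam mu D E x = form lam mu D' E' x := by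
  simp only [form, stress, strain, h, h']

lemma form_add_left {D D' E : Fin 3 → E3 → E3} {x : E3} :
    form lam mu (fun k x => D k x + D' k x) E x = form lam mu D E x + form lam mu D' E x := by
  simp only [form_eq, strain, PiLp.add_apply, Fin.sum_univ_three]; ring

lemma form_add_right {D E E' : Fin 3 → E3 → E3} {x : E3} :
    form lam mu D (fun k x => E k x + E' k x) x = form lam mu D E x + form lam mu D E' x := by
  simp only [form_eq, strain, PiLp.add_apply, Fin.sum_univ_three]; ring

lemma form_smul_left {D E : Fin 3 → E3 → E3} {x : E3} (c : E3 → ℝ) :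
    form lam mu (fun k x => c x • D k x) E x = c x * form lam mu D E x := by
  simp only [form_eq, strain, PiLp.smul_apply, smul_eq_mul, Fin.sum_univ_three]; ring

lemma form_smul_right {D E : Fin 3 → E3 → E3} {x : E3} (c : E3 → ℝ) :
    form lam mu D (fun k x => c x • E k x) x = c x * form lam mu D E x := by
  simp only [form_eq, strain, PiLp.smul_apply, smul_eq_mul, Fin.sum_univ_three]; ring

/-- The bound of the energy form for media with coefficients bounded by `M`. -/
lemma IsLameMedium.abs_integral_form_le (h : IsLameMedium M K α₀ β₀ lam mu) {D E : Fin 3 → E3 → E3}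
    (hD : ∀ k, MemLp (D k) 2 halfVol) (hE : ∀ k, MemLp (E k) 2 halfVol) :
    |∫ x, form lam mu D E x ∂halfVol| ≤ 9 * |M| * ((∑ k, nrm (D k)) * ∑ k, nrm (E k)) := by
  refine (HalfSpaceElasticity.abs_integral_form_le (q := fun _ => |M|) h.ae_abs_le hD
    fun k => (hE k).const_smul |M|).trans (le_of_eq ?_)
  simp only [nrm_smul, abs_abs, ← Finset.mul_sum]
  ring

/-- The energy form as a bounded bilinear form on the energy space. -/
def energyForm (h : IsLameMedium M K α₀ β₀ lam mu) : energySpace →L[ℝ] energySpace →L[ℝ] ℝ :=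
  have hi : ∀ i j : energySpace, Integrable (form lam mu (jetGrad i) (jetGrad j)) halfVol :=
    fun i j => integrable_form h.coeffs.1 h.coeffs.2.1 i.2.mem1 j.2.mem1
  LinearMap.mkContinuous₂
    (LinearMap.mk₂ ℝ (fun i j : energySpace => ∫ x, form lam mu (jetGrad i) (jetGrad j) x ∂halfVol)
      (fun i i' j => by
        rw [← integral_add (hi i j) (hi i' j)]
        refine integral_congr_ae ?_
        filter_upwards [ae_all_iff.2 fun k => jetGrad_add i i' k] with x hx
        rw [← form_add_left]
        exact form_congr hx fun _ => rfl)
      (fun c i j => by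
        rw [smul_eq_mul, ← integral_const_mul]
        refine integral_congr_ae ?_
        filter_upwards [ae_all_iff.2 fun k => jetGrad_smul c i k] with x hx
        rw [← form_smul_left fun _ => c]
        exact form_congr hx fun _ => rfl)
      (fun i j j' => by
        rw [← integral_add (hi i j) (hi i j')]
        refine integral_congr_ae ?_
        filter_upwards [ae_all_iff.2 fun k => jetGrad_add j j' k] with x hx
        rw [← form_add_right]
        exact form_congr (fun _ => rfl) hx)
      (fun c i j => by
        rw [smul_eq_mul, ← integral_const_mul]
        refine integral_congr_ae ?_
        filter_upwards [ae_all_iff.2 fun k => jetGrad_smul c j k] with x hx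
        rw [← form_smul_right fun _ => c]
        exact form_congr (fun _ => rfl) hx))
    -- The density bound gives `9 |M|`, and each sum of three gradient norms is at most three times
    -- the jet norm.
    (81 * |M|) (fun i j => by
      have hb : ∀ i : energySpace, ∑ k, nrm (jetGrad i k) ≤ 3 * ‖i‖ := fun i => by
        refine (Finset.sum_le_sum fun k _ => nrm_jet_le (i : Lp JetPt 2 halfVol) k.succ).trans ?_
        simp
      refine (h.abs_integral_form_le i.2.mem1 j.2.mem1).trans ?_
      have h1 := mul_le_mul (hb i) (hb j) (Finset.sum_nonneg fun k _ => nrm_nonneg _) (by positivity)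
      have h2 := mul_le_mul_of_nonneg_left h1 (show (0:ℝ) ≤ 9 * |M| by positivity)
      refine h2.trans (le_of_eq ?_)
      ring)

lemma energyForm_apply (h : IsLameMedium M K α₀ β₀ lam mu) (i j : energySpace) :
    energyForm h i j = ∫ x, form lam mu (jetGrad i) (jetGrad j) x ∂halfVol := rfl

/-- Korn and convexity control only the gradient; Hardy recovers the weighted zeroth order
component, so the jet norm is at most `3 ∑ ‖D k‖`, whence the factor `9`. -/
lemma isCoercive_energyForm (h : IsLameMedium M K α₀ β₀ lam mu) (hα₀ : 0 < α₀) (hβ₀ : 0 < β₀) :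
    IsCoercive (energyForm h) := by
  set c := 26244 / min (2 * α₀) β₀ with hc
  have hc0 : 0 < c := by have := lt_min (show 0 < 2 * α₀ by linarith) hβ₀; positivity
  refine ⟨1 / (9 * c), by positivity, fun i => ?_⟩
  rw [energyForm_apply]
  have h1 := i.2.coercive h hα₀ hβ₀
  have h2 : ‖i‖ ≤ 3 * ∑ k, nrm (jetGrad i k) := by
    refine (norm_jet_le (i : Lp JetPt 2 halfVol)).trans ?_
    rw [Fin.sum_univ_succ, ← rho_inv_smul_jetField]
    have := i.2.hardy
    change _ + ∑ k, nrm (jetGrad i k) ≤ _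
    linarith
  have h3 : ‖i‖ * ‖i‖ ≤ 9 * (∑ k, nrm (jetGrad i k)) ^ 2 := by nlinarith [norm_nonneg i]
  rw [mul_assoc, one_div, inv_mul_le_iff₀ (by positivity)]
  linarith

/-- `v` with gradient `D` is a weak solution of `div (ℂ ∇̂v) = g` with zero traction. -/
def IsWeakSol (lam mu : E3 → ℝ) (D : Fin 3 → E3 → E3) (g : E3 → E3) : Prop :=
  ∀ (w : E3 → E3) (E : Fin 3 → E3 → E3), IsEnergy w E →
    ∫ x, form lam mu D E x ∂halfVol = -∫ x, inner ℝ (g x) (w x) ∂halfVol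

lemma inner_eq_inner_rho (g w : E3 → E3) (x : E3) :
    inner ℝ (g x) (w x) = inner ℝ (rho x • g x) ((rho x)⁻¹ • w x) := by
  rw [inner_smul_left, inner_smul_right]
  simp only [conj_trivial]
  rw [← mul_assoc, mul_inv_cancel₀ (rho_pos x).ne', one_mul]

lemma abs_integral_inner_le {g w : E3 → E3} (hg : MemLp (fun x => rho x • g x) 2 halfVol)
    (hw : MemLp (fun x => (rho x)⁻¹ • w x) 2 halfVol) :
    |∫ x, inner ℝ (g x) (w x) ∂halfVol|
      ≤ nrm (fun x => rho x • g x) * nrm fun x => (rho x)⁻¹ • w x := by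
  rw [← one_mul (_ * _)]
  refine abs_integral_le_of_le_mul hg hw zero_le_one (Eventually.of_forall fun x => ?_)
  rw [inner_eq_inner_rho, one_mul]
  exact abs_real_inner_le_norm _ _

/-- Lax–Milgram, the right-hand side being bounded since `ϱ g` and `ϱ⁻¹ w` are both in `L²`. No
boundary condition is imposed on the fields `w`: zero traction is the natural condition. -/
theorem exists_isWeakSol (h : IsLameMedium M K α₀ β₀ lam mu) (hα₀ : 0 < α₀) (hβ₀ : 0 < β₀)
    {g : E3 → E3} (hg : MemLp (fun x => rho x • g x) 2 halfVol) :
    ∃ v D, IsEnergy v D ∧ IsWeakSol lam mu D g := by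
  -- Only the zeroth component is nonzero, so the `L²` pairing of `G` with the jet of `w` is `∫ (ϱ
  -- g) · (ϱ⁻¹ w)`.
  let G : E3 → JetPt := fun x => WithLp.toLp 2 (Fin.cons (rho x • g x) fun _ => 0)
  have hG : MemLp G 2 halfVol := by
    refine MemLp.of_eval_piLp fun c => ?_
    refine Fin.cases ?_ (fun k => ?_) c
    · exact hg
    · exact MemLp.zero
  let ℓ : StrongDual ℝ energySpace := -((innerSL ℝ (hG.toLp G)).comp energySpace.subtypeL)
  let e := (isCoercive_energyForm h hα₀ hβ₀).continuousLinearEquivOfBilin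
  let j : energySpace := e.symm ((InnerProductSpace.toDual ℝ energySpace).symm ℓ)
  refine ⟨jetField j, jetGrad j, j.2, fun w E hw => ?_⟩
  obtain ⟨i, hi0, hi1⟩ := exists_energySpace hw
  have h1 : energyForm h j i = ℓ i := by
    rw [← (isCoercive_energyForm h hα₀ hβ₀).continuousLinearEquivOfBilin_apply]
    change inner ℝ (e j) i = _
    rw [ContinuousLinearEquiv.apply_symm_apply, InnerProductSpace.toDual_symm_apply]
  rw [energyForm_apply] at h1
  have h2 : ∫ x, form lam mu (jetGrad j) E x ∂halfVol
      = ∫ x, form lam mu (jetGrad j) (jetGrad i) x ∂halfVol := by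
    refine integral_congr_ae ?_
    filter_upwards [ae_all_iff.2 hi1] with x hx
    exact form_congr (fun _ => rfl) fun k => (hx k).symm
  rw [h2, h1]
  change -(inner ℝ (hG.toLp G) (i : Lp JetPt 2 halfVol)) = _
  rw [L2.inner_def]
  congr 1
  refine integral_congr_ae ?_
  filter_upwards [hG.coeFn_toLp, hi0] with x hx hx0
  rw [hx, inner_eq_inner_rho, ← hx0, PiLp.inner_apply, Fin.sum_univ_succ]
  simp [G, jetField, smul_smul, inv_mul_cancel₀ (rho_pos x).ne']

/-- The energy estimate. -/
lemma IsWeakSol.energy_le (h : IsLameMedium M K α₀ β₀ lam mu) (hα₀ : 0 < α₀) (hβ₀ : 0 < β₀)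
    {v g : E3 → E3} {D : Fin 3 → E3 → E3} (hv : IsEnergy v D) (hs : IsWeakSol lam mu D g)
    (hg : MemLp (fun x => rho x • g x) 2 halfVol) :
    ∑ k, nrm (D k) ≤ 52488 / min (2 * α₀) β₀ * nrm fun x => rho x • g x := by
  have hm := lt_min (show 0 < 2 * α₀ by linarith) hβ₀
  have h1 := hv.coercive h hα₀ hβ₀
  set c := 26244 / min (2 * α₀) β₀ with hc
  have hc0 : 0 < c := by positivity
  have h2 := abs_integral_inner_le hg hv.mem0
  have h3 := hv.hardy
  set S := ∑ k, nrm (D k) with hS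
  set N := nrm fun x => rho x • g x with hN
  have hS0 : 0 ≤ S := Finset.sum_nonneg fun k _ => nrm_nonneg _
  have hN0 : 0 ≤ N := nrm_nonneg _
  rw [hs v D hv] at h1
  have h4 : -∫ x, inner ℝ (g x) (v x) ∂halfVol ≤ N * (2 * S) :=
    (neg_le_abs _).trans (h2.trans (mul_le_mul_of_nonneg_left h3 hN0))
  have h5 : S ^ 2 ≤ c * (N * (2 * S)) := h1.trans (mul_le_mul_of_nonneg_left h4 hc0.le)
  have h6 : 52488 / min (2 * α₀) β₀ = 2 * c := by rw [hc]; ring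
  rw [h6]
  rcases hS0.eq_or_lt with h0 | h0
  · rw [← h0]; positivity
  · nlinarith

end LaxMilgram

/-! ### Weighted bounds for tangential differences. -/

section DifferenceQuotients

lemma rho_add_le (x y : E3) : rho (x + y) ≤ rho x + ‖y‖ := by
  refine Real.sqrt_le_iff.2 ⟨add_nonneg (rho_pos x).le (norm_nonneg y), ?_⟩
  have h1 := rho_sq x
  have h2 := norm_le_rho x
  have h3 : ‖x + y‖ ^ 2 ≤ (‖x‖ + ‖y‖) ^ 2 := by gcongr; exact norm_add_le x y
  nlinarith [norm_nonneg y, norm_nonneg x]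

lemma norm_smul_stdBasis (k : Fin 3) (t : ℝ) : ‖t • stdBasis k‖ = |t| := by
  rw [norm_smul, norm_stdBasis, mul_one, Real.norm_eq_abs]

lemma rho_shift_le (k : Fin 3) {t : ℝ} (ht : |t| ≤ 1) (x : E3) :
    rho (x + t • stdBasis k) ≤ 2 * rho x := by
  have := rho_add_le x (t • stdBasis k)
  rw [norm_smul_stdBasis] at this
  linarith [one_le_rho x]

lemma rho_inv_le_shift (k : Fin 3) {t : ℝ} (ht : |t| ≤ 1) (x : E3) :
    (rho x)⁻¹ ≤ 2 * (rho (x + t • stdBasis k))⁻¹ := by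
  rw [← div_eq_mul_inv, le_div_iff₀ (rho_pos _), inv_mul_le_iff₀ (rho_pos x), mul_comm]
  exact rho_shift_le k ht x

lemma dd_comp_add {F : Type*} [NormedAddCommGroup F] [NormedSpace ℝ F] (φ : E3 → F) (k : Fin 3)
    (y x : E3) : dd k (fun x => φ (x + y)) x = dd k φ (x + y) := by
  simp only [dd, fderiv_comp_add_right]

lemma IsTest.comp_add {F : Type*} [NormedAddCommGroup F] [NormedSpace ℝ F] {φ : E3 → F}
    (h : IsTest φ) (y : E3) : IsTest fun x => φ (x + y) :=
  ⟨h.smooth.comp (contDiff_id.add contDiff_const),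
    h.compact.comp_homeomorph (Homeomorph.addRight y)⟩

variable {F : Type*} [NormedAddCommGroup F]

lemma memLp_shift {k : Fin 3} (hk : k ≠ 2) (t : ℝ) {f : E3 → F} (hf : MemLp f 2 halfVol) :
    MemLp (fun x => f (x + t • stdBasis k)) 2 halfVol :=
  hf.comp_measurePreserving (measurePreserving_add_tangential hk t)

lemma nrm_shift {k : Fin 3} (hk : k ≠ 2) (t : ℝ) {f : E3 → F} (hf : AEStronglyMeasurable f halfVol) :
    nrm (fun x => f (x + t • stdBasis k)) = nrm f := by
  rw [nrm, nrm]
  exact congrArg _ (eLpNorm_comp_measurePreserving hf (measurePreserving_add_tangential hk t))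

variable [NormedSpace ℝ F]

lemma IsEnergy.shift {u : E3 → F} {D : Fin 3 → E3 → F} (h : IsEnergy u D) {k : Fin 3} (hk : k ≠ 2)
    {t : ℝ} (ht : |t| ≤ 1) :
    IsEnergy (fun x => u (x + t • stdBasis k)) (fun j x => D j (x + t • stdBasis k)) where
  mem0 := by
    have h1 := memLp_shift hk t h.mem0
    have hc : Continuous fun x : E3 => (rho x)⁻¹ * rho (x + t • stdBasis k) :=
      continuous_rho_inv.mul (continuous_rho.comp (by fun_prop))
    refine (h1.bdd_smul hc.aestronglyMeasurable (B := 2) (Eventually.of_forall fun x => ?_)).ae_eq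
      (Eventually.of_forall fun x => ?_)
    · rw [abs_of_nonneg (mul_nonneg (inv_nonneg.2 (rho_pos x).le) (rho_pos _).le),
        inv_mul_le_iff₀ (rho_pos x), mul_comm]
      exact rho_shift_le k ht x
    · simp only [smul_smul]
      rw [mul_assoc, mul_inv_cancel₀ (rho_pos _).ne', mul_one]
  mem1 j := memLp_shift hk t (h.mem1 j)
  weak j := by
    intro φ hφ hs
    have h1 := h.weak j (fun x => φ (x + (-t) • stdBasis k)) (hφ.comp_add _) ?_
    · rw [← integral_comp_add_tangential hk t (fun x => _ • u x),
        ← integral_comp_add_tangential hk t (fun x => _ • D j x)] at h1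
      simpa only [dd_comp_add, add_assoc, ← add_smul, add_neg_cancel, zero_smul, add_zero] using h1
    · intro x hx
      have h2 : x + (-t) • stdBasis k ∈ tsupport φ := by
        have := tsupport_comp_eq_preimage φ (Homeomorph.addRight ((-t) • stdBasis k))
        have h3 : x ∈ tsupport (φ ∘ Homeomorph.addRight ((-t) • stdBasis k)) := hx
        rw [this] at h3
        exact h3
      exact (add_smul_stdBasis_mem hk x (-t)).1 (hs h2)

lemma integral_dd_segment [CompleteSpace F] {φ : E3 → F} (h : IsTest φ) (k : Fin 3) (t : ℝ) (x : E3) :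
    φ (x + t • stdBasis k) - φ x
      = ∫ s in Ioc (0 : ℝ) 1, t • dd k φ (x + (s * t) • stdBasis k) := by
  have hd : ∀ s : ℝ, HasDerivAt (fun s : ℝ => φ (x + (s * t) • stdBasis k))
      (t • dd k φ (x + (s * t) • stdBasis k)) s := by
    intro s
    have h1 : HasDerivAt (fun s : ℝ => x + (s * t) • stdBasis k) (t • stdBasis k) s := by
      simpa using (((hasDerivAt_id s).mul_const t).smul_const (stdBasis k)).const_add x
    have h2 := (h.differentiable (x + (s * t) • stdBasis k)).hasFDerivAt.comp_hasDerivAt s h1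
    rw [map_smul] at h2
    exact h2
  have hc : Continuous fun s : ℝ => t • dd k φ (x + (s * t) • stdBasis k) :=
    ((h.deriv k).continuous.comp (by fun_prop)).const_smul t
  have := intervalIntegral.integral_eq_sub_of_hasDerivAt (fun s _ => hd s)
    (hc.intervalIntegrable 0 1)
  rw [intervalIntegral.integral_of_le zero_le_one] at this
  rw [this]
  simp

/-- The difference is `t` times an average of `∂_k φ` along a segment. Moving the weight along the
segment costs the factor `2`, and the translations preserve the `L²` norm of the half space. -/
lemma IsTest.eLpNorm_diff_le [CompleteSpace F] {φ : E3 → F} (h : IsTest φ) {k : Fin 3} (hk : k ≠ 2)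
    {q : E3 → ℝ} (hq : Continuous q) (hq0 : ∀ x, 0 ≤ q x)
    (hq2 : ∀ (t : ℝ) (x : E3), |t| ≤ 1 → q x ≤ 2 * q (x + t • stdBasis k)) {t : ℝ} (ht : |t| ≤ 1) :
    eLpNorm (fun x => q x • (φ (x + t • stdBasis k) - φ x)) 2 halfVol
      ≤ ENNReal.ofReal (|t| * (2 * nrm fun x => q x • dd k φ x)) := by
  have : IsProbabilityMeasure (volume.restrict (Ioc (0 : ℝ) 1)) := ⟨by simp⟩
  have hd := (h.deriv k).continuous
  have hm : MemLp (fun x => q x • dd k φ x) 2 halfVol :=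
    ((hq.smul hd).memLp_of_hasCompactSupport (μ := volume) (h.deriv k).compact.smul_left).restrict _
  let g : ℝ → E3 → ℝ≥0∞ := fun s x => ‖q x • t • dd k φ (x + (s * t) • stdBasis k)‖ₑ
  have hg : Continuous (Function.uncurry g) := by
    have h1 : Continuous fun p : ℝ × E3 => dd k φ (p.2 + (p.1 * t) • stdBasis k) :=
      hd.comp (by fun_prop)
    exact ((hq.comp continuous_snd).smul (h1.const_smul t)).enorm
  refine eLpNorm_le_of_average (volume.restrict (Ioc (0 : ℝ) 1)) (g := g) hg.measurable.aemeasurable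
    (Eventually.of_forall fun x => ?_) ?_
  · rw [integral_dd_segment h, ← integral_smul]
    exact enorm_integral_le_lintegral_enorm _
  · filter_upwards [ae_restrict_mem measurableSet_Ioc] with s hs
    have hst : |s * t| ≤ 1 := by
      rw [abs_mul, abs_of_pos hs.1]
      exact mul_le_one₀ hs.2 (abs_nonneg t) ht
    have hc : Continuous fun x => ‖q x • dd k φ x‖ₑ ^ 2 := (ENNReal.continuous_pow 2).comp (hq.smul hd).enorm
    calc ∫⁻ x, g s x ^ 2 ∂halfVol
        ≤ ∫⁻ x, ENNReal.ofReal (|t| * 2) ^ 2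
            * ‖q (x + (s * t) • stdBasis k) • dd k φ (x + (s * t) • stdBasis k)‖ₑ ^ 2 ∂halfVol := by
          refine lintegral_mono fun x => ?_
          rw [← mul_pow]
          refine pow_le_pow_left' ?_ 2
          have e : ‖q x • t • dd k φ (x + (s * t) • stdBasis k)‖ ≤
              |t| * 2 * ‖q (x + (s * t) • stdBasis k) • dd k φ (x + (s * t) • stdBasis k)‖ := by
            simp only [norm_smul, Real.norm_eq_abs, abs_of_nonneg (hq0 _)]
            nlinarith [mul_le_mul_of_nonneg_right (hq2 _ x hst) (mul_nonneg (abs_nonneg t)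
              (norm_nonneg (dd k φ (x + (s * t) • stdBasis k))))]
          simp only [g]
          rw [← ofReal_norm, ← ofReal_norm, ← ENNReal.ofReal_mul (by positivity)]
          exact ENNReal.ofReal_le_ofReal e
      _ = (ENNReal.ofReal (|t| * (2 * nrm fun x => q x • dd k φ x))) ^ 2 := by
          rw [lintegral_const_mul' _ _ (ENNReal.pow_ne_top ENNReal.ofReal_ne_top),
            (measurePreserving_add_tangential hk (s * t)).lintegral_comp hc.measurable,
            ← eLpNorm_two_sq, ← ofReal_nrm hm, ← mul_pow, ← ENNReal.ofReal_mul (by positivity),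
            mul_assoc]

/-- Almost everywhere convergence of the values is what Fatou's lemma needs to transfer bounds on
differences; the gradients only have to stay within `ε` of the limit. -/
lemma IsEnergy.exists_seq [CompleteSpace F] {u : E3 → F} {D : Fin 3 → E3 → F} (h : IsEnergy u D)
    {ε : ℝ} (hε : 0 < ε) : ∃ φ : ℕ → E3 → F, (∀ n, IsTest (φ n)) ∧
      (∀ n k, nrm (fun x => dd k (φ n) x - D k x) ≤ ε) ∧
      ∀ᵐ x ∂halfVol, Tendsto (fun n => φ n x) atTop (𝓝 (u x)) := by
  have hex : ∀ n : ℕ, ∃ ψ : E3 → F, IsTest ψ ∧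
      nrm (fun x => (rho x)⁻¹ • (ψ x - u x)) ≤ min ε (1 / ((n : ℝ) + 1)) ∧
      ∀ k, nrm (fun x => dd k ψ x - D k x) ≤ min ε (1 / ((n : ℝ) + 1)) := fun n =>
    h.exists_near (lt_min hε (by positivity))
  choose ψ hψ h1 h2 using hex
  have hm : ∀ n, MemLp (fun x => (rho x)⁻¹ • ψ n x) 2 halfVol := fun n => (hψ n).memLp_rho_inv_smul
  have ht : Tendsto (fun n => eLpNorm ((fun x => (rho x)⁻¹ • ψ n x) - fun x => (rho x)⁻¹ • u x) 2
      halfVol) atTop (𝓝 0) := by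
    have h3 : Tendsto (fun n : ℕ => ENNReal.ofReal (1 / ((n : ℝ) + 1))) atTop (𝓝 0) := by
      simpa using ENNReal.tendsto_ofReal (tendsto_one_div_add_atTop_nhds_zero_nat (𝕜 := ℝ))
    refine tendsto_of_tendsto_of_tendsto_of_le_of_le tendsto_const_nhds h3 (fun n => zero_le) fun n => ?_
    rw [← ofReal_nrm ((hm n).sub h.mem0)]
    refine ENNReal.ofReal_le_ofReal (le_trans (le_of_eq ?_) ((h1 n).trans (min_le_right _ _)))
    refine nrm_congr (Eventually.of_forall fun x => ?_)
    simp [smul_sub]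
  have htm := tendstoInMeasure_of_tendsto_eLpNorm two_ne_zero (fun n => (hm n).1) h.mem0.1 ht
  obtain ⟨ns, hns, hae⟩ := htm.exists_seq_tendsto_ae
  refine ⟨fun i => ψ (ns i), fun i => hψ _, fun i k => (h2 _ k).trans (min_le_left _ _), ?_⟩
  filter_upwards [hae] with x hx
  have := hx.const_smul (rho x)
  simpa only [smul_smul, mul_inv_cancel₀ (rho_pos x).ne', one_smul] using this

/-- Bound of tangential difference quotients. -/
theorem IsEnergy.diff_le [CompleteSpace F] {u : E3 → F} {D : Fin 3 → E3 → F} (h : IsEnergy u D)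
    {k : Fin 3} (hk : k ≠ 2) {q : E3 → ℝ} (hq : Continuous q) (hq0 : ∀ x, 0 ≤ q x)
    (hq1 : ∀ x, q x ≤ 1) (hq2 : ∀ (t : ℝ) (x : E3), |t| ≤ 1 → q x ≤ 2 * q (x + t • stdBasis k)) {t : ℝ}
    (ht : |t| ≤ 1) :
    MemLp (fun x => q x • (u (x + t • stdBasis k) - u x)) 2 halfVol ∧
      nrm (fun x => q x • (u (x + t • stdBasis k) - u x)) ≤ |t| * (2 * nrm fun x => q x • D k x) := by
  have hqa : ∀ᵐ x ∂halfVol, |q x| ≤ 1 := Eventually.of_forall fun x => by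
    rw [abs_of_nonneg (hq0 x)]; exact hq1 x
  have hqD : MemLp (fun x => q x • D k x) 2 halfVol :=
    (h.mem1 k).bdd_smul hq.aestronglyMeasurable hqa
  have key : ∀ ε : ℝ, 0 < ε → eLpNorm (fun x => q x • (u (x + t • stdBasis k) - u x)) 2 halfVol
      ≤ ENNReal.ofReal (|t| * (2 * nrm fun x => q x • D k x) + ε) := by
    intro ε hε
    obtain ⟨φ, hφ, h1, h2⟩ := h.exists_seq (ε := ε / 2) (by positivity)
    have hq' : ∀ n, MemLp (fun x => q x • (φ n (x + t • stdBasis k) - φ n x)) 2 halfVol := fun n =>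
      ((memLp_shift hk t (hφ n).memLp).sub (hφ n).memLp).bdd_smul hq.aestronglyMeasurable hqa
    refine (Lp.eLpNorm_lim_le_liminf_eLpNorm (fun n => (hq' n).1) _ ?_).trans
      (liminf_le_of_frequently_le' (Frequently.of_forall fun n => ?_))
    · filter_upwards [h2, (measurePreserving_add_tangential hk t).quasiMeasurePreserving.ae h2]
        with x hx hx'
      exact (hx'.sub hx).const_smul (q x)
    · refine ((hφ n).eLpNorm_diff_le hk hq hq0 hq2 ht).trans (ENNReal.ofReal_le_ofReal ?_)
      have e1 : nrm (fun x => q x • dd k (φ n) x) ≤ (nrm fun x => q x • D k x) + ε / 2 := by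
        have e2 := nrm_le_add_sub (((hφ n).deriv k).memLp.bdd_smul hq.aestronglyMeasurable hqa) hqD
        rw [nrm_sub_rev] at e2
        have e3 : nrm (fun x => q x • dd k (φ n) x - q x • D k x) ≤ ε / 2 := by
          refine (nrm_mono (((hφ n).deriv k).memLp.sub (h.mem1 k))
            (Eventually.of_forall fun x => ?_)).trans (h1 n k)
          rw [← smul_sub, norm_smul, Real.norm_of_nonneg (hq0 x)]
          exact mul_le_of_le_one_left (norm_nonneg _) (hq1 x)
        linarith
      nlinarith [abs_nonneg t, nrm_nonneg fun x => q x • dd k (φ n) x]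
  have hA : 0 ≤ |t| * (2 * nrm fun x => q x • D k x) :=
    mul_nonneg (abs_nonneg t) (mul_nonneg zero_le_two (nrm_nonneg _))
  have hm : AEStronglyMeasurable (fun x => q x • (u (x + t • stdBasis k) - u x)) halfVol := by
    have hu := h.locallyIntegrable.aestronglyMeasurable
    exact hq.aestronglyMeasurable.smul
      ((hu.comp_measurePreserving (measurePreserving_add_tangential hk t)).sub hu)
  exact ⟨⟨hm, (key 1 one_pos).trans_lt ENNReal.ofReal_lt_top⟩, le_of_forall_pos_le_add fun ε hε =>
    nrm_le_of_eLpNorm_le (by linarith) (key ε hε)⟩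

end DifferenceQuotients

/-! ### From difference bounds to weak derivatives, by duality. -/

section WeakDerivativeExistence

/-- The fundamental theorem of calculus along the segment from `x` to `x + t e_k`. The gradient
bound holds only almost everywhere, so Fubini is needed to have it at almost all points of the
segment for almost every `x`; the factor `2` compares `ϱ` along the segment. -/
lemma abs_sub_shift_le {g : E3 → ℝ} {K : ℝ} (hg : ∃ L, LipschitzOnWith L g lowerHalf)
    (hd : ∀ᵐ x ∂halfVol, ‖fderiv ℝ g x‖ ≤ K / rho x) {k : Fin 3} (hk : k ≠ 2) {t : ℝ}
    (ht : |t| ≤ 1) :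
    ∀ᵐ x ∂halfVol, |g (x + t • stdBasis k) - g x| ≤ 2 * |K| * |t| * (rho x)⁻¹ := by
  obtain ⟨L, hL⟩ := hg
  obtain ⟨G, hG, hEq⟩ := hL.extend_real
  have h1 : ∀ᵐ x ∂halfVol, DifferentiableAt ℝ G x ∧ ‖fderiv ℝ G x‖ ≤ |K| / rho x := by
    filter_upwards [hd, ae_restrict_of_ae (hG.ae_differentiableAt (μ := volume)),
      ae_restrict_mem measurableSet_lowerHalf] with x hx hx2 hx3
    refine ⟨hx2, ?_⟩
    have e : G =ᶠ[𝓝 x] g := by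
      filter_upwards [isOpen_lowerHalf.mem_nhds hx3] with y hy
      exact (hEq hy).symm
    rw [e.fderiv_eq]
    exact hx.trans (div_le_div_of_nonneg_right (le_abs_self K) (rho_pos x).le)
  -- A measurable null superset of the exceptional set, so that the order of the two null-set
  -- quantifiers can be exchanged.
  set N := toMeasurable halfVol {x | ¬ (DifferentiableAt ℝ G x ∧ ‖fderiv ℝ G x‖ ≤ |K| / rho x)}
    with hN
  have hN0 : halfVol N = 0 := by rw [hN, measure_toMeasurable]; exact h1
  have hNm : MeasurableSet N := measurableSet_toMeasurable _ _
  have hNs : ∀ x, x ∉ N → DifferentiableAt ℝ G x ∧ ‖fderiv ℝ G x‖ ≤ |K| / rho x := fun x hx => by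
    by_contra hc
    exact hx (subset_toMeasurable _ _ hc)
  have hNae : ∀ᵐ x ∂halfVol, x ∉ N := by
    rw [ae_iff]; simpa using hN0
  have h2 : ∀ᵐ x ∂halfVol, ∀ᵐ s : ℝ, x + s • stdBasis k ∉ N := by
    have hm : MeasurableSet {p : E3 × ℝ | p.1 + p.2 • stdBasis k ∉ N} := by
      have hc : Continuous fun p : E3 × ℝ => p.1 + p.2 • stdBasis k := by fun_prop
      exact hc.measurable hNm.compl
    refine (Measure.ae_ae_comm hm).2 (Eventually.of_forall fun s => ?_)
    exact (measurePreserving_add_tangential hk s).quasiMeasurePreserving.ae hNae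
  filter_upwards [h2, ae_restrict_mem measurableSet_lowerHalf] with x hx hxm
  have hf : LipschitzWith L fun s : ℝ => G (x + s • stdBasis k) := by
    refine LipschitzWith.of_dist_le_mul fun s s' => (hG.dist_le_mul _ _).trans (le_of_eq ?_)
    rw [dist_add_left, dist_eq_norm, ← sub_smul, norm_smul_stdBasis, Real.dist_eq]
  have hFTC := (hf.lipschitzOnWith (s := uIcc 0 t)).absolutelyContinuousOnInterval.integral_deriv_eq_sub
  simp only [zero_smul, add_zero] at hFTC
  rw [hEq hxm, hEq ((add_smul_stdBasis_mem hk x t).2 hxm), ← hFTC, ← Real.norm_eq_abs]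
  have h3 := intervalIntegral.norm_integral_le_of_norm_le_const_ae (a := 0) (b := t)
    (f := deriv fun s : ℝ => G (x + s • stdBasis k)) (C := 2 * |K| * (rho x)⁻¹) ?_
  · refine h3.trans (le_of_eq ?_)
    rw [sub_zero]
    ring
  filter_upwards [hx] with s hs hst
  obtain ⟨hs1, hs2⟩ := hNs _ hs
  have hs3 : |s| ≤ 1 := by
    rcases le_total 0 t with h0 | h0
    · rw [uIoc_of_le h0] at hst
      rw [abs_of_nonneg h0] at ht
      rw [abs_of_pos hst.1]
      exact hst.2.trans ht
    · rw [uIoc_of_ge h0] at hst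
      rw [abs_of_nonpos h0] at ht
      rw [abs_of_nonpos hst.2]
      linarith [hst.1]
  have h4 : HasDerivAt (fun s : ℝ => G (x + s • stdBasis k))
      (fderiv ℝ G (x + s • stdBasis k) (stdBasis k)) s := by
    have h5 : HasDerivAt (fun s : ℝ => x + s • stdBasis k) (stdBasis k) s := by
      simpa using ((hasDerivAt_id s).smul_const (stdBasis k)).const_add x
    exact hs1.hasFDerivAt.comp_hasDerivAt s h5
  rw [h4.deriv]
  calc ‖fderiv ℝ G (x + s • stdBasis k) (stdBasis k)‖
      ≤ ‖fderiv ℝ G (x + s • stdBasis k)‖ * ‖stdBasis k‖ := ContinuousLinearMap.le_opNorm _ _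
    _ ≤ |K| / rho (x + s • stdBasis k) := by rw [norm_stdBasis, mul_one]; exact hs2
    _ ≤ 2 * |K| * (rho x)⁻¹ := by
        have h6 := rho_inv_le_shift k (t := -s) (by rwa [abs_neg]) (x + s • stdBasis k)
        rw [add_assoc, ← add_smul, add_neg_cancel, zero_smul, add_zero] at h6
        rw [div_eq_mul_inv]
        nlinarith [abs_nonneg K]

/-- A linear functional dominated by the norm of the image under `ι` is an inner product with a
vector. -/
lemma exists_riesz {α H : Type*} [AddCommGroup α] [Module ℝ α] [NormedAddCommGroup H]
    [InnerProductSpace ℝ H] [CompleteSpace H] (ι : α →ₗ[ℝ] H) (ℓ : α →ₗ[ℝ] ℝ) {C : ℝ} (hC : 0 ≤ C)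
    (h : ∀ a, |ℓ a| ≤ C * ‖ι a‖) : ∃ y : H, ‖y‖ ≤ C ∧ ∀ a, ℓ a = inner ℝ y (ι a) := by
  have hk : LinearMap.ker ι ≤ LinearMap.ker ℓ := fun a ha => by
    have h1 := h a
    rw [LinearMap.mem_ker.1 ha, norm_zero, mul_zero] at h1
    exact LinearMap.mem_ker.2 (abs_nonpos_iff.1 h1)
  -- The bound makes `ℓ` vanish on the kernel of `ι`, so it descends to the range; Hahn–Banach
  -- extends it to `H` with the same norm. Neither a topology on `α` nor a closed range is needed.
  let ℓ₀ : LinearMap.range ι →ₗ[ℝ] ℝ :=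
    ((LinearMap.ker ι).liftQ ℓ hk).comp ι.quotKerEquivRange.symm.toLinearMap
  have h0 : ∀ a, ℓ₀ ⟨ι a, a, rfl⟩ = ℓ a := fun a => by
    have : ι.quotKerEquivRange.symm ⟨ι a, a, rfl⟩ = (LinearMap.ker ι).mkQ a :=
      ι.quotKerEquivRange_symm_apply_image a _
    simp only [ℓ₀, LinearMap.comp_apply, LinearEquiv.coe_coe, this, Submodule.mkQ_apply,
      Submodule.liftQ_apply]
  let ℓ₁ : StrongDual ℝ (LinearMap.range ι) := ℓ₀.mkContinuous C (by
    rintro ⟨-, a, rfl⟩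
    rw [h0]
    exact h a)
  obtain ⟨f, hf, hn⟩ := exists_extension_norm_eq (LinearMap.range ι) ℓ₁
  refine ⟨(InnerProductSpace.toDual ℝ H).symm f, ?_, fun a => ?_⟩
  · rw [LinearIsometryEquiv.norm_map, hn]
    exact LinearMap.mkContinuous_norm_le _ hC _
  · rw [InnerProductSpace.toDual_symm_apply, hf ⟨ι a, a, rfl⟩, ← h0]
    rfl

variable {F : Type*} [NormedAddCommGroup F] [NormedSpace ℝ F]

lemma dd_add {φ ψ : E3 → F} {x : E3} (h : DifferentiableAt ℝ φ x) (h' : DifferentiableAt ℝ ψ x)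
    (k : Fin 3) : dd k (fun x => φ x + ψ x) x = dd k φ x + dd k ψ x := by
  simp only [dd]
  rw [fderiv_fun_add h h']
  rfl

lemma dd_const_smul {φ : E3 → F} {x : E3} (h : DifferentiableAt ℝ φ x) (c : ℝ) (k : Fin 3) :
    dd k (fun x => c • φ x) x = c • dd k φ x := by
  simp only [dd]
  rw [fderiv_fun_const_smul h]
  rfl

lemma IsTest.add {φ ψ : E3 → F} (h : IsTest φ) (h' : IsTest ψ) : IsTest fun x => φ x + ψ x :=
  ⟨h.smooth.add h'.smooth, h.compact.add h'.compact⟩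

lemma IsTest.const_smul {φ : E3 → F} (h : IsTest φ) (c : ℝ) : IsTest fun x => c • φ x :=
  IsTest.smul contDiff_const h

/-- The space of test fields on the whole space. -/
def testSpace : Submodule ℝ (E3 → E3) where
  carrier := {φ | IsTest φ}
  add_mem' := fun h h' => h.add h'
  zero_mem' := ⟨contDiff_const, HasCompactSupport.zero⟩
  smul_mem' := fun c _ h => h.const_smul c

lemma integrable_inner {f g : E3 → E3} (hf : MemLp f 2 halfVol) (hg : MemLp g 2 halfVol) :
    Integrable (fun x => inner ℝ (f x) (g x)) halfVol :=
  integrable_of_le_mul hf hg (hf.1.inner hg.1) (c := 1) (Eventually.of_forall fun x => by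
    rw [one_mul]; exact abs_real_inner_le_norm _ _)

/-- Writing `∫ ∂_k φ · f` as a derivative in the translation parameter lets the difference quotient
be moved from `φ` to `f`. -/
lemma hasDerivAt_integral_shift {φ f : E3 → E3} (h : IsTest φ) (hf : MemLp f 2 halfVol)
    (k : Fin 3) : HasDerivAt (fun s : ℝ => ∫ x, inner ℝ (φ (x + s • stdBasis k)) (f x) ∂halfVol)
      (∫ x, inner ℝ (dd k φ x) (f x) ∂halfVol) 0 := by
  obtain ⟨B, hB⟩ := (h.deriv k).continuous.bounded_above_of_compact_support (h.deriv k).compact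
  obtain ⟨R, hR⟩ := (h.deriv k).compact.isCompact.isBounded.subset_closedBall (0 : E3)
  have hB0 : 0 ≤ B := (norm_nonneg _).trans (hB 0)
  have hs : Metric.ball (0 : ℝ) 1 ∈ 𝓝 (0 : ℝ) := Metric.ball_mem_nhds _ one_pos
  have hind : MemLp ((Metric.closedBall (0 : E3) (R + 1)).indicator fun _ => B) 2 halfVol := by
    refine memLp_indicator_const 2 measurableSet_closedBall B (Or.inr ?_)
    exact (isCompact_closedBall (0 : E3) (R + 1)).measure_lt_top.ne
  have key := hasDerivAt_integral_of_dominated_loc_of_deriv_le (μ := halfVol) hs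
    (F := fun (s : ℝ) x => inner ℝ (φ (x + s • stdBasis k)) (f x))
    (F' := fun (s : ℝ) x => inner ℝ (dd k φ (x + s • stdBasis k)) (f x))
    (bound := fun x => (Metric.closedBall (0 : E3) (R + 1)).indicator (fun _ => B) x * ‖f x‖)
    (Eventually.of_forall fun s => ((h.comp_add _).continuous.aestronglyMeasurable).inner hf.1)
    (integrable_inner (h.comp_add _).memLp hf)
    ((((h.deriv k).comp_add _).continuous.aestronglyMeasurable).inner hf.1) ?_
    (hind.integrable_mul hf.norm) ?_
  · simpa using key.2
  · refine Eventually.of_forall fun x s hs1 => ?_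
    refine (norm_inner_le_norm _ _).trans (mul_le_mul_of_nonneg_right ?_ (norm_nonneg _))
    by_cases hx : x ∈ Metric.closedBall (0 : E3) (R + 1)
    · rw [indicator_of_mem hx]
      exact hB _
    · have hx' : x + s • stdBasis k ∉ tsupport (dd k φ) := by
        intro hc
        refine hx ?_
        have h1 := hR hc
        rw [mem_closedBall_zero_iff] at h1 ⊢
        rw [mem_ball_zero_iff, Real.norm_eq_abs] at hs1
        have h2 := norm_sub_le (x + s • stdBasis k) (s • stdBasis k)
        rw [add_sub_cancel_right, norm_smul_stdBasis] at h2
        linarith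
      rw [indicator_of_notMem hx, image_eq_zero_of_notMem_tsupport hx', norm_zero]
  · refine Eventually.of_forall fun x s _ => ?_
    have h5 : HasDerivAt (fun s : ℝ => x + s • stdBasis k) (stdBasis k) s := by
      simpa using ((hasDerivAt_id s).smul_const (stdBasis k)).const_add x
    have h6 : HasDerivAt (fun s : ℝ => φ (x + s • stdBasis k)) (dd k φ (x + s • stdBasis k)) s :=
      (h.differentiable _).hasFDerivAt.comp_hasDerivAt s h5
    simpa using h6.inner ℝ (hasDerivAt_const s (f x))

lemma coord_integral {f : E3 → E3} (hf : Integrable f halfVol) (i : Fin 3) :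
    (∫ x, f x ∂halfVol) i = ∫ x, f x i ∂halfVol :=
  ((EuclideanSpace.proj (𝕜 := ℝ) i).integral_comp_comm hf).symm

/-- A bound on weighted tangential difference quotients yields a weak derivative. -/
theorem exists_weakD_of_diff_le {f : E3 → E3} (hf : MemLp f 2 halfVol) {k : Fin 3} (hk : k ≠ 2)
    {A : ℝ} (hA : 0 ≤ A)
    (h : ∀ t : ℝ, |t| ≤ 1 → MemLp (fun x => rho x • (f (x + t • stdBasis k) - f x)) 2 halfVol ∧
      nrm (fun x => rho x • (f (x + t • stdBasis k) - f x)) ≤ A * |t|) :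
    ∃ w : E3 → E3, MemLp (fun x => rho x • w x) 2 halfVol ∧ nrm (fun x => rho x • w x) ≤ A ∧
      WeakD k f w := by
  -- The norm of `ϱ⁻¹ φ` is dual to the weight `ϱ` wanted on the derivative: the Riesz vector will
  -- be `y = ϱ w`.
  let ι : testSpace →ₗ[ℝ] Lp E3 2 halfVol :=
    { toFun := fun φ => (IsTest.memLp_rho_inv_smul φ.2).toLp
      map_add' := fun φ ψ => by
        rw [← MemLp.toLp_add]
        exact MemLp.toLp_congr _ _ (Eventually.of_forall fun x => by simp)
      map_smul' := fun c φ => by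
        rw [← MemLp.toLp_const_smul]
        exact MemLp.toLp_congr _ _ (Eventually.of_forall fun x => by simp [smul_comm c]) }
  have hT : ∀ φ : testSpace, IsTest (φ : E3 → E3) := fun φ => φ.2
  let ℓ : testSpace →ₗ[ℝ] ℝ :=
    { toFun := fun φ => -∫ x, inner ℝ (dd k φ x) (f x) ∂halfVol
      map_add' := fun φ ψ => by
        rw [← neg_add, ← integral_add (integrable_inner ((hT φ).deriv k).memLp hf)
          (integrable_inner ((hT ψ).deriv k).memLp hf)]
        congr 1
        refine integral_congr_ae (Eventually.of_forall fun x => ?_)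
        simp only [← inner_add_left]
        rw [← dd_add ((hT φ).differentiable x) ((hT ψ).differentiable x)]
        rfl
      map_smul' := fun c φ => by
        rw [RingHom.id_apply, smul_neg, smul_eq_mul, ← integral_const_mul]
        congr 1
        refine integral_congr_ae (Eventually.of_forall fun x => ?_)
        simp only [← real_inner_smul_left]
        rw [← dd_const_smul ((hT φ).differentiable x)]
        rfl }
  have hb : ∀ φ, |ℓ φ| ≤ A * ‖ι φ‖ := by
    intro φ
    have hn : ‖ι φ‖ = nrm fun x => (rho x)⁻¹ • (φ : E3 → E3) x := by
      rw [← nrm_eq_norm]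
      exact nrm_congr (IsTest.memLp_rho_inv_smul (hT φ)).coeFn_toLp
    -- A Lipschitz bound at `0` bounds the derivative there. After moving the translation to `f`,
    -- the hypothesis on weighted differences supplies that bound.
    have h1 := (hasDerivAt_integral_shift (hT φ) hf k).hasFDerivAt.le_of_lip'
      (C := A * ‖ι φ‖) (mul_nonneg hA (norm_nonneg _)) ?_
    · rw [ContinuousLinearMap.norm_toSpanSingleton] at h1
      change |-_| ≤ _
      rw [abs_neg]
      exact h1
    · filter_upwards [Metric.ball_mem_nhds (0 : ℝ) one_pos] with s hs
      rw [mem_ball_zero_iff, Real.norm_eq_abs] at hs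
      have e : ∫ x, inner ℝ ((φ : E3 → E3) (x + s • stdBasis k)) (f x) ∂halfVol
          = ∫ x, inner ℝ ((φ : E3 → E3) x) (f (x + (-s) • stdBasis k)) ∂halfVol := by
        rw [← integral_comp_add_tangential hk (-s)]
        simp only [add_assoc, ← add_smul, neg_add_cancel, zero_smul, add_zero]
      obtain ⟨h2, h3⟩ := h (-s) (by rw [abs_neg]; exact hs.le)
      simp only [zero_smul, add_zero]
      rw [e, ← integral_sub (integrable_inner (hT φ).memLp (memLp_shift hk _ hf))
        (integrable_inner (hT φ).memLp hf)]
      simp only [← inner_sub_right, sub_zero]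
      have e2 : ∫ x, inner ℝ ((φ : E3 → E3) x) (f (x + (-s) • stdBasis k) - f x) ∂halfVol
          = ∫ x, inner ℝ (f (x + (-s) • stdBasis k) - f x) ((φ : E3 → E3) x) ∂halfVol :=
        integral_congr_ae (Eventually.of_forall fun x => real_inner_comm _ _)
      rw [e2]
      refine (abs_integral_inner_le h2 (IsTest.memLp_rho_inv_smul (hT φ))).trans ?_
      rw [hn, Real.norm_eq_abs]
      rw [abs_neg] at h3
      have := mul_le_mul_of_nonneg_right h3 (nrm_nonneg fun x => (rho x)⁻¹ • (φ : E3 → E3) x)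
      linarith
  obtain ⟨y, hy, hℓ⟩ := exists_riesz ι ℓ hA hb
  have e : (fun x => rho x • (rho x)⁻¹ • (y : E3 → E3) x) = y := by
    ext1 x
    rw [smul_smul, mul_inv_cancel₀ (rho_pos x).ne', one_smul]
  refine ⟨fun x => (rho x)⁻¹ • (y : E3 → E3) x, by rw [e]; exact Lp.memLp y,
    by rw [e, nrm_eq_norm]; exact hy, fun φ hφ _ => ?_⟩
  have hy2 : MemLp (fun x => (rho x)⁻¹ • (y : E3 → E3) x) 2 halfVol :=
    (Lp.memLp y).bdd_smul continuous_rho_inv.aestronglyMeasurable (B := 1)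
    (Eventually.of_forall fun x => by
      rw [abs_of_nonneg (inv_nonneg.2 (rho_pos x).le)]; exact rho_inv_le_one x)
  ext i
  -- Testing with `φ e_i` extracts the `i`-th component of the vector identity.
  have hΦ : IsTest fun x => φ x • stdBasis i := IsTest.smul' hφ contDiff_const
  have h1 := hℓ ⟨_, hΦ⟩
  change -∫ x, inner ℝ (dd k (fun x => φ x • stdBasis i) x) (f x) ∂halfVol = _ at h1
  rw [L2.inner_def] at h1
  rw [PiLp.neg_apply, coord_integral (integrable_smul_of_memLp (hφ.deriv k).memLp hf),
    coord_integral (integrable_smul_of_memLp hφ.memLp hy2)]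
  have e1 : ∀ x, inner ℝ (dd k (fun x => φ x • stdBasis i) x) (f x) = (dd k φ x • f x) i := by
    intro x
    rw [dd_smul (hφ.differentiable x) (differentiableAt_const _)]
    simp [dd, stdBasis, inner_smul_left, EuclideanSpace.inner_single_left]
  simp only [e1] at h1
  rw [← neg_inj, h1, neg_neg]
  refine integral_congr_ae ?_
  filter_upwards [(IsTest.memLp_rho_inv_smul hΦ).coeFn_toLp] with x hx
  have : (ι ⟨_, hΦ⟩ : E3 → E3) x = (rho x)⁻¹ • φ x • stdBasis i := hx
  rw [this]
  simp [stdBasis, inner_smul_right, EuclideanSpace.inner_single_right]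
  ring

end WeakDerivativeExistence

/-! ### Weighted tangential second derivatives. -/

section TangentialRegularity

variable {M K α₀ β₀ : ℝ} {lam mu : E3 → ℝ}

lemma IsEnergy.smul_bdd {F : Type*} [NormedAddCommGroup F] [NormedSpace ℝ F] {u : E3 → F}
    {D : Fin 3 → E3 → F} (h : IsEnergy u D) (hu : MemLp u 2 halfVol) {θ : E3 → ℝ}
    (hθ : ContDiff ℝ ∞ θ) {B : ℝ} (hB : ∀ x, |θ x| ≤ B) (hB' : ∀ j x, |dd j θ x| ≤ B) :
    IsEnergy (fun x => θ x • u x) (fun j x => θ x • D j x + dd j θ x • u x) where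
  mem0 := (h.mem0.bdd_smul hθ.continuous.aestronglyMeasurable
    (Eventually.of_forall hB)).ae_eq (Eventually.of_forall fun x => smul_comm _ _ _)
  mem1 j := ((h.mem1 j).bdd_smul hθ.continuous.aestronglyMeasurable (Eventually.of_forall hB)).add
    (hu.bdd_smul (contDiff_dd hθ j).continuous.aestronglyMeasurable (Eventually.of_forall (hB' j)))
  weak j := (h.weak j).smul h.locallyIntegrable ((h.mem1 j).locallyIntegrable (by norm_num)) hθ

lemma IsEnergy.sub {F : Type*} [NormedAddCommGroup F] [NormedSpace ℝ F] {u u' : E3 → F}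
    {D D' : Fin 3 → E3 → F} (h : IsEnergy u D) (h' : IsEnergy u' D') :
    IsEnergy (fun x => u x - u' x) (fun k x => D k x - D' k x) := by
  simpa only [neg_one_smul, ← sub_eq_add_neg] using h.add (h'.const_smul (-1))

/-- A bounded smooth approximation of the weight `ϱ`. -/
def cutRho (δ : ℝ) (x : E3) : ℝ := rho x / (1 + δ * rho x)

lemma one_add_pos {δ : ℝ} (hδ : 0 < δ) (x : E3) : 0 < 1 + δ * rho x := by
  have := rho_pos x; positivity

lemma contDiff_cutRho {δ : ℝ} (hδ : 0 < δ) : ContDiff ℝ ∞ (cutRho δ) :=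
  contDiff_rho.div (contDiff_const.add (contDiff_const.mul contDiff_rho))
    fun x => (one_add_pos hδ x).ne'

lemma cutRho_nonneg {δ : ℝ} (hδ : 0 < δ) (x : E3) : 0 ≤ cutRho δ x :=
  div_nonneg (rho_pos x).le (one_add_pos hδ x).le

lemma cutRho_le_rho {δ : ℝ} (hδ : 0 < δ) (x : E3) : cutRho δ x ≤ rho x :=
  div_le_self (rho_pos x).le (by have := rho_pos x; nlinarith)

lemma cutRho_le_inv {δ : ℝ} (hδ : 0 < δ) (x : E3) : cutRho δ x ≤ δ⁻¹ := by
  rw [cutRho, div_le_iff₀ (one_add_pos hδ x), mul_add, inv_mul_cancel_left₀ hδ.ne']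
  linarith [inv_pos.2 hδ]

lemma abs_dd_cutRho_le {δ : ℝ} (hδ : 0 < δ) (k : Fin 3) (x : E3) : |dd k (cutRho δ) x| ≤ 1 := by
  have h1 : HasFDerivAt rho (fderiv ℝ rho x) x :=
    (contDiff_rho.differentiable (by simp) x).hasFDerivAt
  have h2 : HasDerivAt (fun r : ℝ => r / (1 + δ * r)) (1 / (1 + δ * rho x) ^ 2) (rho x) := by
    have h3 : HasDerivAt (fun r : ℝ => 1 + δ * r) δ (rho x) := by
      simpa using ((hasDerivAt_id (rho x)).const_mul δ).const_add 1
    have h4 := (hasDerivAt_id (rho x)).div h3 (one_add_pos hδ x).ne'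
    refine h4.congr_deriv ?_
    simp only [id]
    congr 1
    ring
  have h5 := h2.comp_hasFDerivAt x h1
  have h6 : dd k (cutRho δ) x = 1 / (1 + δ * rho x) ^ 2 * (x k / rho x) := by
    rw [← dd_rho]
    exact congrArg (fun L : E3 →L[ℝ] ℝ => L (stdBasis k)) h5.fderiv
  rw [h6, abs_mul]
  have h7 : |x k / rho x| ≤ 1 := by
    rw [abs_div, abs_of_pos (rho_pos x), div_le_one (rho_pos x)]
    exact (PiLp.norm_apply_le x k).trans (norm_le_rho x)
  have h8 : |1 / (1 + δ * rho x) ^ 2| ≤ 1 := by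
    rw [abs_of_nonneg (by positivity)]
    refine div_le_one_of_le₀ (one_le_pow₀ ?_) (by positivity)
    have := rho_pos x
    nlinarith
  exact mul_le_one₀ h8 (abs_nonneg _) h7

lemma tendsto_cutRho (x : E3) : Tendsto (fun n : ℕ => cutRho (1 / ((n : ℝ) + 1)) x) atTop (𝓝 (rho x)) := by
  have h1 := tendsto_one_div_add_atTop_nhds_zero_nat (𝕜 := ℝ)
  have h2 : Tendsto (fun n : ℕ => 1 + 1 / ((n : ℝ) + 1) * rho x) atTop (𝓝 1) := by
    simpa using (h1.mul_const (rho x)).const_add 1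
  have h3 := (tendsto_const_nhds (x := rho x)).div h2 one_ne_zero
  rw [div_one] at h3
  exact h3

/-- With `P = η W + s` the left side pairs `P - s` with `P + s`, and the cross terms cancel by
symmetry. For `W = ∇w` and `s = ∇η ⊗ w`, `P` is the gradient of `η w` and `η (P + s)` that of `η²
w`, so testing with `η² w` produces the coercive term and only a quadratic error in `s`. -/
lemma form_weight_identity (W s : Fin 3 → E3 → E3) (η : E3 → ℝ) (x : E3) :
    form lam mu W (fun j x => η x • ((η x • W j x + s j x) + s j x)) x
      = form lam mu (fun j x => η x • W j x + s j x) (fun j x => η x • W j x + s j x) x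
        - form lam mu s s x := by
  simp only [form_eq, strain, PiLp.add_apply, PiLp.smul_apply, smul_eq_mul, Fin.sum_univ_three]
  ring

/-- A discrete product rule: the difference of two stresses splits into a difference of gradients
with the old coefficients and a difference of coefficients with the new gradient. -/
lemma form_coeff_sub (lam' mu' : E3 → ℝ) (D D' E : Fin 3 → E3 → E3) (x : E3) :
    form lam mu (fun j x => D' j x - D j x) E x
      = form lam' mu' D' E x - form lam mu D E x
        - form (fun x => lam' x - lam x) (fun x => mu' x - mu x) D' E x := by
  simp only [form_eq, strain, PiLp.sub_apply, Fin.sum_univ_three]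
  ring

lemma IsBddCoeff.shift {c : E3 → ℝ} (h : IsBddCoeff c) {k : Fin 3} (hk : k ≠ 2) (t : ℝ) :
    IsBddCoeff fun x => c (x + t • stdBasis k) := by
  obtain ⟨B, hB⟩ := h.2
  exact ⟨h.1.comp_measurePreserving (measurePreserving_add_tangential hk t), B,
    (measurePreserving_add_tangential hk t).quasiMeasurePreserving.ae hB⟩

lemma IsBddCoeff.sub {c c' : E3 → ℝ} (h : IsBddCoeff c) (h' : IsBddCoeff c') :
    IsBddCoeff fun x => c x - c' x := by
  obtain ⟨B, hB⟩ := h.2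
  obtain ⟨B', hB'⟩ := h'.2
  refine ⟨h.1.sub h'.1, B + B', ?_⟩
  filter_upwards [hB, hB'] with x h1 h2
  exact (norm_sub_le _ _).trans (add_le_add h1 h2)

/-- The equation satisfied by the tangential differences of a weak solution. -/
lemma IsWeakSol.diff_eq (h : IsLameMedium M K α₀ β₀ lam mu) {v g : E3 → E3}
    {D : Fin 3 → E3 → E3} (hv : IsEnergy v D) (hs : IsWeakSol lam mu D g) {k : Fin 3} (hk : k ≠ 2)
    {t : ℝ} (ht : |t| ≤ 1) {ψ : E3 → E3} {E : Fin 3 → E3 → E3} (hψ : IsEnergy ψ E) :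
    ∫ x, form lam mu (fun j x => D j (x + t • stdBasis k) - D j x) E x ∂halfVol
      = -(∫ x, form (fun x => lam (x + t • stdBasis k) - lam x)
          (fun x => mu (x + t • stdBasis k) - mu x) (fun j x => D j (x + t • stdBasis k)) E x ∂halfVol)
        - ∫ x, inner ℝ (g x) (ψ (x + (-t) • stdBasis k) - ψ x) ∂halfVol := by
  obtain ⟨hl, hm, -⟩ := h.coeffs
  have ht' : |(-t)| ≤ 1 := by rwa [abs_neg]
  have hτ := hψ.shift hk ht'
  -- Testing with the backward difference of `ψ` is a discrete integration by parts: a change of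
  -- variables moves the translation to the solution and the coefficients.
  have e1 := hs _ _ (hτ.sub hψ)
  have hD' := (hv.shift hk ht).mem1
  have e2 : ∫ x, form lam mu D (fun j x => E j (x + (-t) • stdBasis k) - E j x) x ∂halfVol
      = ∫ x, form (fun x => lam (x + t • stdBasis k)) (fun x => mu (x + t • stdBasis k))
          (fun j x => D j (x + t • stdBasis k)) E x ∂halfVol - ∫ x, form lam mu D E x ∂halfVol := by
    have e3 : ∫ x, form lam mu D (fun j x => E j (x + (-t) • stdBasis k)) x ∂halfVol
      = ∫ x, form (fun x => lam (x + t • stdBasis k)) (fun x => mu (x + t • stdBasis k))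
          (fun j x => D j (x + t • stdBasis k)) E x ∂halfVol := by
      rw [← integral_comp_add_tangential hk t]
      simp only [form, stress, strain, add_assoc, ← add_smul, add_neg_cancel, zero_smul, add_zero]
    rw [← e3, ← integral_sub (integrable_form hl hm hv.mem1 hτ.mem1)
      (integrable_form hl hm hv.mem1 hψ.mem1)]
    refine integral_congr_ae (Eventually.of_forall fun x => ?_)
    simp only [form, PiLp.sub_apply, mul_sub, Finset.sum_sub_distrib]
  rw [e2] at e1
  have i1 := integrable_form (hl.shift hk t) (hm.shift hk t) hD' hψ.mem1
  have i2 := integrable_form hl hm hv.mem1 hψ.mem1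
  have i3 := integrable_form ((hl.shift hk t).sub hl) ((hm.shift hk t).sub hm) hD' hψ.mem1
  have e4 : ∫ x, form lam mu (fun j x => D j (x + t • stdBasis k) - D j x) E x ∂halfVol
      = (∫ x, form (fun x => lam (x + t • stdBasis k)) (fun x => mu (x + t • stdBasis k))
          (fun j x => D j (x + t • stdBasis k)) E x ∂halfVol - ∫ x, form lam mu D E x ∂halfVol)
        - ∫ x, form (fun x => lam (x + t • stdBasis k) - lam x)
          (fun x => mu (x + t • stdBasis k) - mu x) (fun j x => D j (x + t • stdBasis k)) E x
          ∂halfVol := by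
    have e5 := integral_sub (i1.sub i2) i3
    simp only [Pi.sub_apply] at e5
    rw [← integral_sub i1 i2, ← e5]
    exact integral_congr_ae (Eventually.of_forall fun x => form_coeff_sub _ _ D _ E x)
  rw [e4, e1]
  ring

/-- If the conclusion failed, then `A ≤ S`, and the right side of the hypothesis would be at most
`(a + b) A S < S²`. -/
lemma le_of_sq_le_quadratic {S A a b : ℝ} (hA : 0 ≤ A) (ha : 0 ≤ a) (hb : 0 ≤ b)
    (h : S ^ 2 ≤ a * A * S + b * A ^ 2) : S ≤ (a + b + 1) * A := by
  by_contra! hc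
  have h1 : A ≤ S := le_trans (by nlinarith [mul_nonneg ha hA, mul_nonneg hb hA]) hc.le
  have hS : 0 < S := lt_of_le_of_lt (by positivity) hc
  nlinarith [mul_lt_mul_of_pos_right hc hS, mul_nonneg hb (mul_nonneg hA (sub_nonneg.2 h1)),
    mul_nonneg hA hS.le]

/-- The weighted estimate of tangential differences, with a truncated weight. -/
lemma IsWeakSol.cutRho_diff_le (h : IsLameMedium M K α₀ β₀ lam mu) (hα₀ : 0 < α₀) (hβ₀ : 0 < β₀)
    {v g : E3 → E3} {D : Fin 3 → E3 → E3} (hv : IsEnergy v D) (hs : IsWeakSol lam mu D g)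
    (hg : MemLp (fun x => rho x • g x) 2 halfVol) {k : Fin 3} (hk : k ≠ 2) {t : ℝ} (ht : |t| ≤ 1)
    {δ : ℝ} (hδ : 0 < δ) (j : Fin 3) {c : ℝ} (hc : c = 26244 / min (2 * α₀) β₀) :
    nrm (fun x => cutRho δ x • (D j (x + t • stdBasis k) - D j x))
      ≤ ((36 * |K| * c ^ 2 + 2 * c) + c * (1296 * |M| * c ^ 2 + 432 * |K| * c ^ 2 + 8 * c) + 1
        + 4 * c) * (|t| * nrm fun x => rho x • g x) := by
  have hmin := lt_min (show 0 < 2 * α₀ by linarith) hβ₀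
  have hc0 : 0 < c := by rw [hc]; positivity
  set N := nrm fun x => rho x • g x with hN
  have hN0 : 0 ≤ N := nrm_nonneg _
  set A := |t| * N with hA
  have hA0 : 0 ≤ A := mul_nonneg (abs_nonneg t) hN0
  have hS0 : ∑ k, nrm (D k) ≤ 2 * c * N := by
    refine (hs.energy_le h hα₀ hβ₀ hv hg).trans (le_of_eq ?_)
    rw [hc]
    ring
  have hτ := hv.shift hk ht
  obtain ⟨hwm, hwn⟩ := hv.diff_le hk (q := fun _ => 1) continuous_const (fun _ => zero_le_one)
    (fun _ => le_rfl) (fun _ _ _ => by norm_num) ht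
  simp only [one_smul] at hwm hwn
  have hW := hτ.sub hv
  set w : E3 → E3 := fun x => v (x + t • stdBasis k) - v x with hwdef
  set W : Fin 3 → E3 → E3 := fun j x => D j (x + t • stdBasis k) - D j x with hWdef
  set η := cutRho δ with hη
  have hη1 : ∀ x, |η x| ≤ max δ⁻¹ 1 := fun x => by
    rw [abs_of_nonneg (cutRho_nonneg hδ x)]
    exact (cutRho_le_inv hδ x).trans (le_max_left _ _)
  have hη2 : ∀ j x, |dd j η x| ≤ max δ⁻¹ 1 := fun j x =>
    (abs_dd_cutRho_le hδ j x).trans (le_max_right _ _)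
  have hP := hW.smul_bdd hwm (contDiff_cutRho hδ) hη1 hη2
  have hηw : MemLp (fun x => η x • w x) 2 halfVol :=
    hwm.bdd_smul (contDiff_cutRho hδ).continuous.aestronglyMeasurable (Eventually.of_forall hη1)
  set s : Fin 3 → E3 → E3 := fun j x => dd j η x • w x with hsdef
  have hsm : ∀ j, MemLp (s j) 2 halfVol := fun j =>
    hwm.bdd_smul (contDiff_dd (contDiff_cutRho hδ) j).continuous.aestronglyMeasurable
      (Eventually.of_forall (hη2 j))
  set P : Fin 3 → E3 → E3 := fun j x => η x • W j x + s j x with hPdef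
  -- Since `η` and its derivatives are bounded for fixed `δ`, the field `η² w` has finite energy and
  -- may be used as a test field.
  have hψ : IsEnergy (fun x => η x • η x • w x) fun j x => η x • (P j x + s j x) := by
    refine (hP.smul_bdd hηw (contDiff_cutRho hδ) hη1 hη2).congr (ae_eq_refl _) fun j =>
      Eventually.of_forall fun x => ?_
    simp only [P, s, smul_add, hη]
    rw [smul_comm (dd j (cutRho δ) x)]
  set S := ∑ j, nrm (P j) with hS
  have hSj : ∀ j, nrm (P j) ≤ S := fun j =>
    Finset.single_le_sum (f := fun j => nrm (P j)) (fun j _ => nrm_nonneg _) (Finset.mem_univ j)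
  -- The derivatives of `η` are at most `1` whatever `δ` is, and `w` is bounded in unweighted `L²`
  -- by `2 |t|` times the norm of `D k`, which the energy estimate bounds by `2 c N`.
  have hsn : ∀ j, nrm (s j) ≤ 4 * c * A := by
    intro j
    have h1 : nrm (s j) ≤ nrm w := nrm_mono hwm (Eventually.of_forall fun x => by
      rw [hsdef, norm_smul]
      exact mul_le_of_le_one_left (norm_nonneg _) (abs_dd_cutRho_le hδ j x))
    have h2 : nrm (D k) ≤ 2 * c * N := le_trans
      (Finset.single_le_sum (f := fun k => nrm (D k)) (fun k _ => nrm_nonneg _) (Finset.mem_univ k))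
      hS0
    have h3 := mul_le_mul_of_nonneg_left h2 (abs_nonneg t)
    have h4 : nrm w ≤ |t| * (2 * nrm (D k)) := hwn
    rw [hA]
    linarith
  have hss : ∑ j, nrm (s j) ≤ 12 * c * A := by
    refine (Finset.sum_le_sum fun j _ => hsn j).trans (le_of_eq ?_)
    simp
    ring
  -- the three terms on the right-hand side
  have I1 : |∫ x, form lam mu s s x ∂halfVol| ≤ 1296 * |M| * c ^ 2 * A ^ 2 := by
    refine (h.abs_integral_form_le hsm hsm).trans ?_
    have h0 : 0 ≤ ∑ j, nrm (s j) := Finset.sum_nonneg fun j _ => nrm_nonneg _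
    have h1 := mul_le_mul hss hss h0 (by positivity)
    have h2 := mul_le_mul_of_nonneg_left h1 (show 0 ≤ 9 * |M| by positivity)
    refine h2.trans (le_of_eq ?_)
    ring
  -- The decay hypothesis enters here: the differences of the coefficients are at most `2 |K| |t|
  -- ϱ⁻¹`, and `ϱ⁻¹` absorbs the factor `η ≤ ϱ` in the gradient of the test field.
  have I2 : |∫ x, form (fun x => lam (x + t • stdBasis k) - lam x)
      (fun x => mu (x + t • stdBasis k) - mu x) (fun j x => D j (x + t • stdBasis k))
      (fun j x => η x • (P j x + s j x)) x ∂halfVol| ≤ 36 * |K| * c * A * S + 432 * |K| * c ^ 2 * A ^ 2 := by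
    have hq : Continuous fun x => 2 * |K| * |t| * (rho x)⁻¹ := continuous_const.mul continuous_rho_inv
    have hqb : ∀ᵐ x ∂halfVol, |2 * |K| * |t| * (rho x)⁻¹| ≤ 2 * |K| * |t| := Eventually.of_forall fun x => by
      rw [abs_of_nonneg (mul_nonneg (by positivity) (inv_nonneg.2 (rho_pos x).le))]
      exact mul_le_of_le_one_right (by positivity) (rho_inv_le_one x)
    have h1 := abs_integral_form_le (q := fun x => 2 * |K| * |t| * (rho x)⁻¹)
      ((abs_sub_shift_le h.lipschitz_lam h.decay_lam hk ht).and
        (abs_sub_shift_le h.lipschitz_mu h.decay_mu hk ht)) hτ.mem1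
      (D' := fun j x => η x • (P j x + s j x))
      (fun j => (hψ.mem1 j).bdd_smul hq.aestronglyMeasurable hqb)
    have h2 : ∀ j, nrm (fun x => (2 * |K| * |t| * (rho x)⁻¹) • η x • (P j x + s j x))
        ≤ 2 * |K| * |t| * (nrm (P j) + nrm (s j)) := fun j => by
      refine (nrm_le_mul ((hP.mem1 j).add (hsm j)) (c := 2 * |K| * |t|) (by positivity)
        (Eventually.of_forall fun x => ?_)).trans
        (mul_le_mul_of_nonneg_left (nrm_add_le (hP.mem1 j) (hsm j)) (by positivity))
      have h3 : (rho x)⁻¹ * η x ≤ 1 := by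
        rw [inv_mul_le_iff₀ (rho_pos x), mul_one]
        exact cutRho_le_rho hδ x
      have h4 : 0 ≤ (rho x)⁻¹ * η x := mul_nonneg (inv_nonneg.2 (rho_pos x).le) (cutRho_nonneg hδ x)
      rw [smul_smul, norm_smul, Real.norm_eq_abs, mul_assoc, abs_mul, abs_of_nonneg h4,
        abs_of_nonneg (by positivity)]
      exact mul_le_mul_of_nonneg_right (mul_le_of_le_one_right (by positivity) h3) (norm_nonneg _)
    have h5 : ∑ j, nrm (fun x => D j (x + t • stdBasis k)) ≤ 2 * c * N := by
      simpa only [nrm_shift hk t (hv.mem1 _).1] using hS0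
    have h6 : ∑ j, nrm (fun x => (2 * |K| * |t| * (rho x)⁻¹) • η x • (P j x + s j x))
        ≤ 2 * |K| * |t| * (S + 12 * c * A) := by
      refine (Finset.sum_le_sum fun j _ => h2 j).trans ?_
      rw [← Finset.mul_sum, Finset.sum_add_distrib]
      exact mul_le_mul_of_nonneg_left (by linarith) (by positivity)
    have h7 := mul_le_mul h5 h6 (Finset.sum_nonneg fun j _ => nrm_nonneg _) (by positivity)
    refine h1.trans ((mul_le_mul_of_nonneg_left h7 (by norm_num : (0:ℝ) ≤ 9)).trans (le_of_eq ?_))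
    rw [hA]
    ring
  -- The weight `ϱ` goes to `g`; the difference of `η² w` with weight `ϱ⁻¹` is at most `2 |t|` times
  -- the norm of `ϱ⁻¹ η (P k + s k)`, and `ϱ⁻¹ η ≤ 1`.
  have I3 : |∫ x, inner ℝ (g x) (η (x + (-t) • stdBasis k) • η (x + (-t) • stdBasis k) •
      w (x + (-t) • stdBasis k) - η x • η x • w x) ∂halfVol| ≤ 2 * A * S + 8 * c * A ^ 2 := by
    obtain ⟨hm3, hn3⟩ := hψ.diff_le hk (q := fun x => (rho x)⁻¹) continuous_rho_inv
      (fun x => inv_nonneg.2 (rho_pos x).le) rho_inv_le_one (fun t x ht => rho_inv_le_shift k ht x)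
      (t := -t) (by rwa [abs_neg])
    refine (abs_integral_inner_le hg hm3).trans ?_
    have h2 : nrm (fun x => (rho x)⁻¹ • η x • (P k x + s k x)) ≤ S + 4 * c * A := by
      refine le_trans (nrm_mono ((hP.mem1 k).add (hsm k)) (Eventually.of_forall fun x => ?_))
        ((nrm_add_le (hP.mem1 k) (hsm k)).trans (add_le_add (hSj k) (hsn k)))
      have h3 : (rho x)⁻¹ * η x ≤ 1 := by
        rw [inv_mul_le_iff₀ (rho_pos x), mul_one]
        exact cutRho_le_rho hδ x
      have h4 : 0 ≤ (rho x)⁻¹ * η x := mul_nonneg (inv_nonneg.2 (rho_pos x).le) (cutRho_nonneg hδ x)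
      rw [smul_smul, norm_smul, Real.norm_eq_abs, abs_of_nonneg h4]
      exact mul_le_of_le_one_left (norm_nonneg _) h3
    rw [abs_neg] at hn3
    have h5 := hn3.trans (mul_le_mul_of_nonneg_left (mul_le_mul_of_nonneg_left h2 zero_le_two)
      (abs_nonneg t))
    refine (mul_le_mul_of_nonneg_left h5 hN0).trans (le_of_eq ?_)
    rw [hA]
    ring
  have E1 := hs.diff_eq h hv hk ht hψ
  obtain ⟨hl, hm, -⟩ := h.coeffs
  have E2 : ∫ x, form lam mu W (fun j x => η x • (P j x + s j x)) x ∂halfVol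
      = ∫ x, form lam mu P P x ∂halfVol - ∫ x, form lam mu s s x ∂halfVol := by
    rw [← integral_sub (integrable_form hl hm hP.mem1 hP.mem1) (integrable_form hl hm hsm hsm)]
    exact integral_congr_ae (Eventually.of_forall fun x => form_weight_identity W s η x)
  have E3 := hP.coercive h hα₀ hβ₀
  rw [← hc] at E3
  have E4 : ∫ x, form lam mu P P x ∂halfVol ≤ 1296 * |M| * c ^ 2 * A ^ 2
      + (36 * |K| * c * A * S + 432 * |K| * c ^ 2 * A ^ 2) + (2 * A * S + 8 * c * A ^ 2) := by
    have := E2.symm.trans E1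
    linarith [le_abs_self (∫ x, form lam mu s s x ∂halfVol), (abs_le.1 I2).1, (abs_le.1 I3).1]
  have E5 : S ^ 2 ≤ (36 * |K| * c ^ 2 + 2 * c) * A * S
      + c * (1296 * |M| * c ^ 2 + 432 * |K| * c ^ 2 + 8 * c) * A ^ 2 := by
    refine (E3.trans (mul_le_mul_of_nonneg_left E4 hc0.le)).trans (le_of_eq ?_)
    ring
  have E6 := le_of_sq_le_quadratic hA0 (by positivity) (by positivity) E5
  have E7 : nrm (fun x => η x • W j x) ≤ nrm (P j) + nrm (s j) := by
    have h1 := nrm_add_le (hP.mem1 j) (hsm j).neg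
    simp only [Pi.neg_apply, add_neg_cancel_right, P] at h1
    refine h1.trans (le_of_eq ?_)
    rw [show (-s j) = fun x => -s j x from rfl, nrm_neg]
  linarith [hSj j, hsn j]

/-- The weighted estimate of tangential differences of the gradient of a weak solution. -/
theorem IsWeakSol.diff_le (h : IsLameMedium M K α₀ β₀ lam mu) (hα₀ : 0 < α₀) (hβ₀ : 0 < β₀)
    {v g : E3 → E3} {D : Fin 3 → E3 → E3} (hv : IsEnergy v D) (hs : IsWeakSol lam mu D g)
    (hg : MemLp (fun x => rho x • g x) 2 halfVol) {k : Fin 3} (hk : k ≠ 2) {t : ℝ} (ht : |t| ≤ 1)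
    (j : Fin 3) {c : ℝ} (hc : c = 26244 / min (2 * α₀) β₀) :
    MemLp (fun x => rho x • (D j (x + t • stdBasis k) - D j x)) 2 halfVol ∧
      nrm (fun x => rho x • (D j (x + t • stdBasis k) - D j x))
      ≤ ((36 * |K| * c ^ 2 + 2 * c) + c * (1296 * |M| * c ^ 2 + 432 * |K| * c ^ 2 + 8 * c) + 1
        + 4 * c) * (|t| * nrm fun x => rho x • g x) := by
  set A := ((36 * |K| * c ^ 2 + 2 * c) + c * (1296 * |M| * c ^ 2 + 432 * |K| * c ^ 2 + 8 * c) + 1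
        + 4 * c) * (|t| * nrm fun x => rho x • g x) with hA
  have hmin := lt_min (show 0 < 2 * α₀ by linarith) hβ₀
  have hc0 : 0 < c := by rw [hc]; positivity
  have hA0 : 0 ≤ A := mul_nonneg (by positivity) (mul_nonneg (abs_nonneg t) (nrm_nonneg _))
  have hW := ((hv.shift hk ht).sub hv).mem1 j
  have hδ : ∀ n : ℕ, 0 < 1 / ((n : ℝ) + 1) := fun n => by positivity
  have hm : ∀ n : ℕ, MemLp (fun x => cutRho (1 / ((n : ℝ) + 1)) x •
      (D j (x + t • stdBasis k) - D j x)) 2 halfVol := fun n =>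
    hW.bdd_smul (contDiff_cutRho (hδ n)).continuous.aestronglyMeasurable
      (Eventually.of_forall fun x => by
        rw [abs_of_nonneg (cutRho_nonneg (hδ n) x)]; exact cutRho_le_inv (hδ n) x)
  -- The truncated estimate does not depend on `δ`, so `δ = 1 / (n + 1) → 0` and Fatou's lemma give
  -- the full weight.
  have key : eLpNorm (fun x => rho x • (D j (x + t • stdBasis k) - D j x)) 2 halfVol
      ≤ ENNReal.ofReal A := by
    refine (Lp.eLpNorm_lim_le_liminf_eLpNorm (fun n => (hm n).1) _
      (Eventually.of_forall fun x => (tendsto_cutRho x).smul_const _)).trans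
      (liminf_le_of_frequently_le' (Frequently.of_forall fun n => ?_))
    rw [← ofReal_nrm (hm n)]
    exact ENNReal.ofReal_le_ofReal (hs.cutRho_diff_le h hα₀ hβ₀ hv hg hk ht (hδ n) j hc)
  exact ⟨⟨continuous_rho.aestronglyMeasurable.smul hW.1, key.trans_lt ENNReal.ofReal_lt_top⟩,
    nrm_le_of_eLpNorm_le hA0 key⟩

/-- Tangential regularity of weak solutions. -/
theorem IsWeakSol.exists_weakD_tangential (h : IsLameMedium M K α₀ β₀ lam mu) (hα₀ : 0 < α₀)
    (hβ₀ : 0 < β₀) {v g : E3 → E3} {D : Fin 3 → E3 → E3} (hv : IsEnergy v D)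
    (hs : IsWeakSol lam mu D g) (hg : MemLp (fun x => rho x • g x) 2 halfVol) {k : Fin 3}
    (hk : k ≠ 2) (j : Fin 3) {c : ℝ} (hc : c = 26244 / min (2 * α₀) β₀) :
    ∃ w : E3 → E3, MemLp (fun x => rho x • w x) 2 halfVol ∧ nrm (fun x => rho x • w x)
      ≤ ((36 * |K| * c ^ 2 + 2 * c) + c * (1296 * |M| * c ^ 2 + 432 * |K| * c ^ 2 + 8 * c) + 1
        + 4 * c) * (nrm fun x => rho x • g x) ∧ WeakD k (D j) w := by
  have hmin := lt_min (show 0 < 2 * α₀ by linarith) hβ₀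
  have hc0 : 0 < c := by rw [hc]; positivity
  refine exists_weakD_of_diff_le (hv.mem1 j) hk (mul_nonneg (by positivity) (nrm_nonneg _))
    fun t ht => ?_
  obtain ⟨h1, h2⟩ := hs.diff_le h hα₀ hβ₀ hv hg hk ht j hc
  exact ⟨h1, h2.trans (le_of_eq (by ring))⟩

end TangentialRegularity

/-! ### Weak derivatives tested up to the boundary. -/

section WeakCalculus

lemma _root_.MeasureTheory.MemLp.integrable_mul_half {f g : E3 → ℝ} (hf : MemLp f 2 halfVol)
    (hg : MemLp g 2 halfVol) : Integrable (fun x => f x * g x) halfVol := hf.integrable_mul hg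

lemma abs_integral_mul_le {f g : E3 → ℝ} (hf : MemLp f 2 halfVol) (hg : MemLp g 2 halfVol) :
    |∫ x, f x * g x ∂halfVol| ≤ nrm f * nrm g := norm_integral_smul_le hf hg

/-- Square integrable `u` and `w` such that `∂_k u = w` weakly, tested with smooth functions that
are compactly supported in the open set `S` (and need not vanish on the boundary of the half
space). -/
structure HasWeak (S : Set E3) (k : Fin 3) (u w : E3 → ℝ) : Prop where
  memLp : MemLp u 2 halfVol
  memLp' : MemLp w 2 halfVol
  gauss : ∀ φ : E3 → ℝ, IsTest φ → tsupport φ ⊆ S →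
    ∫ x, dd k φ x * u x ∂halfVol = -∫ x, φ x * w x ∂halfVol

variable {S : Set E3} {k : Fin 3} {u w u' w' : E3 → ℝ}

lemma HasWeak.add (h : HasWeak S k u w) (h' : HasWeak S k u' w') :
    HasWeak S k (fun x => u x + u' x) (fun x => w x + w' x) where
  memLp := h.memLp.add h'.memLp
  memLp' := h.memLp'.add h'.memLp'
  gauss φ hφ hs := by
    simp only [mul_add]
    rw [integral_add ((hφ.deriv k).memLp.integrable_mul_half h.memLp)
      ((hφ.deriv k).memLp.integrable_mul_half h'.memLp), integral_add (hφ.memLp.integrable_mul_half h.memLp')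
      (hφ.memLp.integrable_mul_half h'.memLp'), h.gauss φ hφ hs, h'.gauss φ hφ hs, neg_add]

lemma HasWeak.const_mul (h : HasWeak S k u w) (c : ℝ) :
    HasWeak S k (fun x => c * u x) (fun x => c * w x) where
  memLp := h.memLp.const_mul c
  memLp' := h.memLp'.const_mul c
  gauss φ hφ hs := by
    simp only [mul_left_comm _ c]
    rw [integral_const_mul, integral_const_mul, h.gauss φ hφ hs, mul_neg]

lemma HasWeak.sub (h : HasWeak S k u w) (h' : HasWeak S k u' w') :
    HasWeak S k (fun x => u x - u' x) (fun x => w x - w' x) := by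
  simpa only [neg_one_mul, ← sub_eq_add_neg] using h.add (h'.const_mul (-1))

lemma HasWeak.zero : HasWeak S k (fun _ => 0) (fun _ => 0) where
  memLp := MemLp.zero
  memLp' := MemLp.zero
  gauss φ _ _ := by simp

lemma HasWeak.congr (h : HasWeak S k u w) (hu : u =ᵐ[halfVol] u') (hw : w =ᵐ[halfVol] w') :
    HasWeak S k u' w' where
  memLp := h.memLp.ae_eq hu
  memLp' := h.memLp'.ae_eq hw
  gauss φ hφ hs := by
    rw [← integral_congr_ae (hu.mono fun x hx => congrArg (dd k φ x * ·) hx),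
      ← integral_congr_ae (hw.mono fun x hx => congrArg (φ x * ·) hx)]
    exact h.gauss φ hφ hs

lemma HasWeak.sum {ι : Type*} (s : Finset ι) {u w : ι → E3 → ℝ}
    (h : ∀ i ∈ s, HasWeak S k (u i) (w i)) :
    HasWeak S k (fun x => ∑ i ∈ s, u i x) (fun x => ∑ i ∈ s, w i x) := by
  classical
  induction s using Finset.induction_on with
  | empty => simpa using HasWeak.zero
  | insert a s ha ih =>
    simp only [Finset.sum_insert ha]
    exact (h a (Finset.mem_insert_self a s)).add (ih fun i hi => h i (Finset.mem_insert_of_mem hi))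

/-- The Gauss formula extends to limits of test functions. -/
lemma HasWeak.gauss_of_approx (h : HasWeak S k u w) {θ θ' : E3 → ℝ} (hθ : MemLp θ 2 halfVol)
    (hθ' : MemLp θ' 2 halfVol) (ha : ∀ ε > 0, ∃ φ, IsTest φ ∧ tsupport φ ⊆ S ∧
      nrm (fun x => φ x - θ x) ≤ ε ∧ nrm (fun x => dd k φ x - θ' x) ≤ ε) :
    ∫ x, θ' x * u x ∂halfVol = -∫ x, θ x * w x ∂halfVol := by
  rw [← sub_eq_zero, sub_neg_eq_add, ← abs_nonpos_iff]
  refine le_of_forall_pos_le_add fun ε hε => ?_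
  set A := nrm u + nrm w with hA
  have hA0 : 0 ≤ A := add_nonneg (nrm_nonneg _) (nrm_nonneg _)
  obtain ⟨φ, hφ, hs, h1, h2⟩ := ha (ε / (A + 1)) (by positivity)
  have e := h.gauss φ hφ hs
  have i1 := (hφ.deriv k).memLp.integrable_mul_half h.memLp
  have i2 := hφ.memLp.integrable_mul_half h.memLp'
  have i3 := ((hφ.deriv k).memLp.sub hθ').integrable_mul_half h.memLp
  have i4 := (hφ.memLp.sub hθ).integrable_mul_half h.memLp'
  have e1 : ∫ x, θ' x * u x ∂halfVol
      = ∫ x, dd k φ x * u x ∂halfVol - ∫ x, (dd k φ x - θ' x) * u x ∂halfVol := by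
    have := integral_sub i1 i3
    simp only [Pi.sub_apply] at this
    rw [← this]
    exact integral_congr_ae (Eventually.of_forall fun x => by simp only []; ring)
  have e2 : ∫ x, θ x * w x ∂halfVol
      = ∫ x, φ x * w x ∂halfVol - ∫ x, (φ x - θ x) * w x ∂halfVol := by
    have := integral_sub i2 i4
    simp only [Pi.sub_apply] at this
    rw [← this]
    exact integral_congr_ae (Eventually.of_forall fun x => by simp only []; ring)
  have b1 := (abs_integral_mul_le ((hφ.deriv k).memLp.sub hθ') h.memLp).trans
    (mul_le_mul_of_nonneg_right h2 (nrm_nonneg u))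
  have b2 := (abs_integral_mul_le (hφ.memLp.sub hθ) h.memLp').trans
    (mul_le_mul_of_nonneg_right h1 (nrm_nonneg w))
  simp only [Pi.sub_apply] at b1 b2
  have b5 : (ε / (A + 1)) * A ≤ ε := by
    rw [div_mul_eq_mul_div, div_le_iff₀ (by positivity)]
    nlinarith
  rw [e1, e2, e, zero_add]
  have e3 : ∀ a b c : ℝ, -a - b + (a - c) = -(b + c) := fun a b c => by ring
  rw [e3, abs_neg]
  refine (abs_add_le _ _).trans ((add_le_add b1 b2).trans ?_)
  rw [← mul_add]
  exact b5

lemma exists_isTest_one_on {C : Set E3} (hC : IsCompact C) (hS : IsOpen S) (hCS : C ⊆ S) :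
    ∃ χ : E3 → ℝ, IsTest χ ∧ tsupport χ ⊆ S ∧ ∀ x ∈ C, χ x = 1 := by
  obtain ⟨L, hL, hCL, hLS⟩ := exists_compact_between hC hS hCS
  obtain ⟨χ, h0, h1, -⟩ := exists_contMDiffMap_zero_one_of_isClosed (n := (⊤ : ℕ∞))
    (modelWithCornersSelf ℝ E3) (isOpen_interior (s := L)).isClosed_compl hC.isClosed
    (disjoint_compl_left_iff_subset.2 hCL)
  have hsupp : tsupport χ ⊆ L := by
    refine closure_minimal (fun x hx => ?_) hL.isClosed
    by_contra hc
    exact hx (h0 fun hi => hc (interior_subset hi))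
  exact ⟨χ, ⟨χ.contMDiff.contDiff, HasCompactSupport.of_support_subset_isCompact hL
    (subset_closure.trans hsupp)⟩, hsupp.trans hLS, h1⟩

lemma isBddCoeff_pd_of_lipschitz {c : E3 → ℝ} (hc : ∃ L, LipschitzOnWith L c lowerHalf) (l : Fin 3) :
    IsBddCoeff (pd l c) := by
  obtain ⟨L, hL⟩ := hc
  refine ⟨(measurable_fderiv_apply_const ℝ c (stdBasis l)).aestronglyMeasurable, L, ?_⟩
  filter_upwards [ae_restrict_mem measurableSet_lowerHalf] with x hx
  have h1 := norm_fderiv_le_of_lipschitzOn ℝ (isOpen_lowerHalf.mem_nhds hx) hL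
  have h2 := (fderiv ℝ c x).le_opNorm (stdBasis l)
  rw [norm_stdBasis, mul_one] at h2
  exact h2.trans h1

/-- Lipschitz functions are weakly differentiable. -/
lemma weakD_of_lipschitz {c : E3 → ℝ} (hc : ∃ L, LipschitzOnWith L c lowerHalf) (l : Fin 3) :
    WeakD l c (pd l c) := by
  intro φ hφ hs
  obtain ⟨L, hL⟩ := hc
  obtain ⟨G, hG, hEq⟩ := hL.extend_real
  obtain ⟨L', hφL⟩ := hφ.exists_lipschitzWith
  have h0 : ∀ x, x ∉ (lowerHalf : Set E3) → φ x = 0 := fun x hx =>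
    image_eq_zero_of_notMem_tsupport fun h => hx (hs h)
  have h0' : ∀ x, x ∉ (lowerHalf : Set E3) → dd l φ x = 0 := fun x hx =>
    image_eq_zero_of_notMem_tsupport fun h => hx (hs (tsupport_dd_subset φ l h))
  have e1 : ∫ x, dd l φ x • c x ∂halfVol = ∫ x, dd l φ x * G x := by
    have := setIntegral_eq_integral_of_forall_compl_eq_zero (μ := volume)
      (s := (lowerHalf : Set E3)) (f := fun x => dd l φ x * G x)
      fun x hx => by rw [h0' x hx, zero_mul]
    rw [← this]
    exact setIntegral_congr_fun measurableSet_lowerHalf fun x hx => by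
      simp only [smul_eq_mul, hEq hx]
  have e2 : ∫ x, φ x • pd l c x ∂halfVol = ∫ x, φ x * dd l G x := by
    have := setIntegral_eq_integral_of_forall_compl_eq_zero (μ := volume)
      (s := (lowerHalf : Set E3)) (f := fun x => φ x * dd l G x)
      fun x hx => by rw [h0 x hx, zero_mul]
    rw [← this]
    refine setIntegral_congr_fun measurableSet_lowerHalf fun x hx => ?_
    have e : G =ᶠ[𝓝 x] c := by
      filter_upwards [isOpen_lowerHalf.mem_nhds hx] with y hy
      exact (hEq hy).symm
    simp only [smul_eq_mul, pd, dd, e.fderiv_eq]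
  have e3 := hG.integral_lineDeriv_mul_eq (μ := volume) hφL hφ.compact (stdBasis l)
  have e4 : ∫ x, φ x * dd l G x = ∫ x, lineDeriv ℝ G x (stdBasis l) * φ x :=
    integral_congr_ae ((ae_dd_eq_lineDeriv hG l).mono fun x hx => by
      simp only [hx]; ring)
  have e5 : ∫ x, lineDeriv ℝ φ x (-stdBasis l) * G x = -∫ x, dd l φ x * G x := by
    rw [← integral_neg]
    refine integral_congr_ae (Eventually.of_forall fun x => ?_)
    simp only [(hφ.differentiable x).lineDeriv_eq_fderiv, dd, map_neg, neg_mul]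
  rw [e1, e2, e4, e3, e5, neg_neg]

lemma _root_.MeasureTheory.MemLp.isBddCoeff_mul {f c : E3 → ℝ} (hf : MemLp f 2 halfVol)
    (hc : IsBddCoeff c) : MemLp (fun x => c x * f x) 2 halfVol := by
  obtain ⟨B, hB⟩ := hc.2
  exact hf.bdd_smul hc.1 hB

/-- The product rule with a Lipschitz factor. -/
theorem HasWeak.mul_lipschitz (h : HasWeak S k u w) (hS : IsOpen S) {c : E3 → ℝ}
    (hc : ∃ L, LipschitzOnWith L c lowerHalf) (hb : IsBddCoeff c) :
    HasWeak S k (fun x => c x * u x) (fun x => pd k c x * u x + c x * w x) := by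
  have hbd := fun l => isBddCoeff_pd_of_lipschitz hc l
  refine ⟨h.memLp.isBddCoeff_mul hb,
    (h.memLp.isBddCoeff_mul (hbd k)).add (h.memLp'.isBddCoeff_mul hb), fun φ hφ hs => ?_⟩
  have hφc : MemLp (fun x => φ x • c x) 2 halfVol :=
    (hφ.memLp.isBddCoeff_mul hb).ae_eq (Eventually.of_forall fun x => mul_comm _ _)
  have hd : ∀ l, MemLp (fun x => φ x • pd l c x + dd l φ x • c x) 2 halfVol := fun l =>
    ((hφ.memLp.isBddCoeff_mul (hbd l)).add ((hφ.deriv l).memLp.isBddCoeff_mul hb)).ae_eq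
      (Eventually.of_forall fun x => by simp only [Pi.add_apply, smul_eq_mul]; ring)
  have hloc : ∀ {b : E3 → ℝ}, IsBddCoeff b → LocallyIntegrable b halfVol := by
    rintro b ⟨hm, B, hB⟩
    exact (locallyIntegrable_const B).mono hm (hB.mono fun x hx => hx.trans (le_abs_self B))
  have hE : IsEnergy (fun x => φ x • c x) (fun l x => φ x • pd l c x + dd l φ x • c x) :=
    ⟨hφc.bdd_smul continuous_rho_inv.aestronglyMeasurable (B := 1) (Eventually.of_forall fun x => by
      rw [abs_of_nonneg (inv_nonneg.2 (rho_pos x).le)]; exact rho_inv_le_one x), hd,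
      fun l => (weakD_of_lipschitz hc l).smul (hloc hb) (hloc (hbd l)) hφ.smooth⟩
  obtain ⟨χ, hχ, hχS, hχ1⟩ := exists_isTest_one_on hφ.compact.isCompact hS hs
  -- The product rule amounts to the Gauss formula with `φ c` as test function. As `φ c` is only
  -- Lipschitz, it is approximated by `χ ψ` with `ψ` a test function near `φ c` and `χ = 1` on the
  -- support of `φ`; the cutoff keeps the support inside `S`.
  have key := h.gauss_of_approx hφc (hd k) fun ε hε => ?_
  · have i1 : Integrable (fun x => dd k φ x * (c x * u x)) halfVol :=
      (hφ.deriv k).memLp.integrable_mul_half (h.memLp.isBddCoeff_mul hb)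
    have i2 : Integrable (fun x => φ x * (pd k c x * u x)) halfVol :=
      hφ.memLp.integrable_mul_half (h.memLp.isBddCoeff_mul (hbd k))
    have i3 : Integrable (fun x => φ x * (c x * w x)) halfVol :=
      hφ.memLp.integrable_mul_half (h.memLp'.isBddCoeff_mul hb)
    have e1 : ∫ x, (φ x • pd k c x + dd k φ x • c x) * u x ∂halfVol
        = ∫ x, φ x * (pd k c x * u x) ∂halfVol + ∫ x, dd k φ x * (c x * u x) ∂halfVol := by
      rw [← integral_add i2 i1]
      exact integral_congr_ae (Eventually.of_forall fun x => by
        simp only [smul_eq_mul]; ring)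
    have e2 : ∫ x, φ x • c x * w x ∂halfVol = ∫ x, φ x * (c x * w x) ∂halfVol :=
      integral_congr_ae (Eventually.of_forall fun x => by simp only [smul_eq_mul]; ring)
    simp only [mul_add]
    rw [integral_add i2 i3]
    linarith
  obtain ⟨B1, hB1⟩ := hχ.continuous.bounded_above_of_compact_support hχ.compact
  -- `ψ` approximates `φ c` only in the norm weighted by `ϱ⁻¹`; multiplying by `χ` or its derivative
  -- makes the missing factor `ϱ` harmless.
  have hρχ : IsTest fun x => χ x * rho x := IsTest.smul' hχ contDiff_rho
  obtain ⟨B2, hB2⟩ := hρχ.continuous.bounded_above_of_compact_support hρχ.compact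
  have hρχ' : IsTest fun x => dd k χ x * rho x := IsTest.smul' (hχ.deriv k) contDiff_rho
  obtain ⟨B3, hB3⟩ := hρχ'.continuous.bounded_above_of_compact_support hρχ'.compact
  have hB10 : 0 ≤ B1 := (norm_nonneg _).trans (hB1 0)
  have hB20 : 0 ≤ B2 := (norm_nonneg _).trans (hB2 0)
  have hB30 : 0 ≤ B3 := (norm_nonneg _).trans (hB3 0)
  obtain ⟨ψ, hψ, h1, h2⟩ := hE.exists_near (ε := ε / (B1 + B2 + B3 + 1)) (by positivity)
  have hd1 : MemLp (fun x => (rho x)⁻¹ • (ψ x - φ x • c x)) 2 halfVol :=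
    (hψ.memLp_rho_inv_smul.sub hE.mem0).ae_eq (Eventually.of_forall fun x => by
      simp only [Pi.sub_apply, smul_sub])
  have hd2 : MemLp (fun x => dd k ψ x - (φ x • pd k c x + dd k φ x • c x)) 2 halfVol :=
    (hψ.deriv k).memLp.sub (hd k)
  have hφ0 : ∀ x, φ x ≠ 0 → χ x = 1 ∧ dd k χ x = 0 := by
    intro x hx
    refine ⟨hχ1 x (subset_tsupport _ hx), ?_⟩
    have : χ =ᶠ[𝓝 x] fun _ => 1 := by
      filter_upwards [hφ.continuous.isOpen_support.mem_nhds hx] with y hy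
      exact hχ1 y (subset_tsupport _ hy)
    rw [dd, this.fderiv_eq]
    simp
  have hε' : ∀ B, 0 ≤ B → B ≤ B1 + B2 + B3 → B * (ε / (B1 + B2 + B3 + 1)) ≤ ε := fun B h0 hB => by
    rw [mul_div_assoc', div_le_iff₀ (by positivity)]
    nlinarith
  refine ⟨fun x => χ x • ψ x, IsTest.smul' hχ hψ.smooth, (tsupport_smul_subset_left χ ψ).trans hχS,
    ?_, ?_⟩
  · refine (nrm_le_mul hd1 hB20 (Eventually.of_forall fun x => ?_)).trans
      ((mul_le_mul_of_nonneg_left h1 hB20).trans (hε' B2 hB20 (by linarith)))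
    have e : χ x • ψ x - φ x • c x = (χ x * rho x) * ((rho x)⁻¹ • (ψ x - φ x • c x)) := by
      have h3 : χ x * φ x = φ x := by
        by_cases hx : φ x = 0
        · rw [hx, mul_zero]
        · rw [(hφ0 x hx).1, one_mul]
      have h4 := (rho_pos x).ne'
      simp only [smul_eq_mul]
      field_simp
      rw [mul_sub, ← mul_assoc, h3]
    rw [e, norm_mul]
    exact mul_le_mul_of_nonneg_right (hB2 x) (norm_nonneg _)
  · have e : (fun x => dd k (fun x => χ x • ψ x) x - (φ x • pd k c x + dd k φ x • c x))
        = fun x => χ x * (dd k ψ x - (φ x • pd k c x + dd k φ x • c x))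
          + (dd k χ x * rho x) * ((rho x)⁻¹ • (ψ x - φ x • c x)) := by
      ext1 x
      rw [dd_smul (hχ.differentiable x) (hψ.differentiable x)]
      have h3 : χ x * φ x = φ x := by
        by_cases hx : φ x = 0
        · rw [hx, mul_zero]
        · rw [(hφ0 x hx).1, one_mul]
      have h5 : dd k χ x * φ x = 0 := by
        by_cases hx : φ x = 0
        · rw [hx, mul_zero]
        · rw [(hφ0 x hx).2, zero_mul]
      have h6 : χ x * dd k φ x = dd k φ x := by
        by_cases hx : dd k φ x = 0
        · rw [hx, mul_zero]
        · rw [hχ1 x (tsupport_dd_subset φ k (subset_tsupport _ hx)), one_mul]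
      have h4 := (rho_pos x).ne'
      simp only [smul_eq_mul]
      field_simp
      linear_combination pd k c x * h3 + c x * h5 + c x * h6
    have n1 : nrm (fun x => χ x * (dd k ψ x - (φ x • pd k c x + dd k φ x • c x)))
        ≤ B1 * (ε / (B1 + B2 + B3 + 1)) :=
      (nrm_le_mul hd2 hB10 (Eventually.of_forall fun x => by
        rw [norm_mul]; exact mul_le_mul_of_nonneg_right (hB1 x) (norm_nonneg _))).trans
        (mul_le_mul_of_nonneg_left (h2 k) hB10)
    have n2 : nrm (fun x => (dd k χ x * rho x) * ((rho x)⁻¹ • (ψ x - φ x • c x)))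
        ≤ B3 * (ε / (B1 + B2 + B3 + 1)) :=
      (nrm_le_mul hd1 hB30 (Eventually.of_forall fun x => by
        rw [norm_mul]; exact mul_le_mul_of_nonneg_right (hB3 x) (norm_nonneg _))).trans
        (mul_le_mul_of_nonneg_left h1 hB30)
    rw [e]
    refine (nrm_add_le (hd2.bdd_smul hχ.continuous.aestronglyMeasurable (Eventually.of_forall hB1))
      (hd1.bdd_smul hρχ'.continuous.aestronglyMeasurable (Eventually.of_forall hB3))).trans
      ((add_le_add n1 n2).trans ?_)
    rw [← add_mul]
    exact hε' _ (by positivity) (by linarith)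

/-- Tangential weak derivatives can be tested up to the boundary. -/
lemma HasWeak.univ_of_tangential (hk : k ≠ 2) {D : Fin 3 → E3 → ℝ}
    (h : ∀ l, HasWeak lowerHalf l u (D l)) : HasWeak univ k u (D k) := by
  have hE : IsEnergy u D := ⟨(h 0).memLp.bdd_smul continuous_rho_inv.aestronglyMeasurable (B := 1)
    (Eventually.of_forall fun x => by
      rw [abs_of_nonneg (inv_nonneg.2 (rho_pos x).le)]; exact rho_inv_le_one x),
    fun l => (h l).memLp', fun l => (h l).gauss⟩
  refine ⟨(h k).memLp, (h k).memLp', fun φ hφ _ => ?_⟩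
  rw [← sub_eq_zero, sub_neg_eq_add, ← abs_nonpos_iff]
  refine le_of_forall_pos_le_add fun ε hε => ?_
  have hφρ : MemLp (fun x => dd k φ x * rho x) 2 halfVol :=
    (IsTest.smul' (hφ.deriv k) contDiff_rho).memLp
  set A := nrm (fun x => dd k φ x * rho x) + nrm φ with hA
  have hA0 : 0 ≤ A := add_nonneg (nrm_nonneg _) (nrm_nonneg _)
  obtain ⟨ψ, hψ, h1, h2⟩ := hE.exists_near (ε := ε / (A + 1)) (by positivity)
  -- The function `u` is approximated here rather than the test function: for smooth `ψ` the
  -- tangential derivative of `φ ψ` integrates to zero, whatever `φ` does at the boundary.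
  have e0 : ∫ x, dd k φ x * ψ x ∂halfVol + ∫ x, φ x * dd k ψ x ∂halfVol = 0 := by
    rw [← integral_add ((hφ.deriv k).memLp.integrable_mul_half hψ.memLp)
      (hφ.memLp.integrable_mul_half (hψ.deriv k).memLp)]
    obtain ⟨L, hL⟩ := (hφ.mul hψ).exists_lipschitzWith
    rw [← integral_dd_tangential_eq_zero hL (hφ.mul hψ).compact hk]
    refine integral_congr_ae (Eventually.of_forall fun x => ?_)
    rw [dd_mul (hφ.differentiable x) (hψ.differentiable x)]
    ring
  have hd1 : MemLp (fun x => (rho x)⁻¹ • (ψ x - u x)) 2 halfVol :=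
    (hψ.memLp_rho_inv_smul.sub hE.mem0).ae_eq (Eventually.of_forall fun x => by
      simp only [Pi.sub_apply, smul_sub])
  have hd2 := (hψ.deriv k).memLp.sub (h k).memLp'
  have e1 : ∫ x, dd k φ x * u x ∂halfVol = ∫ x, dd k φ x * ψ x ∂halfVol
      - ∫ x, (dd k φ x * rho x) * ((rho x)⁻¹ • (ψ x - u x)) ∂halfVol := by
    rw [← integral_sub ((hφ.deriv k).memLp.integrable_mul_half hψ.memLp) (hφρ.integrable_mul_half hd1)]
    refine integral_congr_ae (Eventually.of_forall fun x => ?_)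
    have h4 := (rho_pos x).ne'
    simp only [smul_eq_mul]
    field_simp
    ring
  have e2 : ∫ x, φ x * D k x ∂halfVol = ∫ x, φ x * dd k ψ x ∂halfVol
      - ∫ x, φ x * (dd k ψ x - D k x) ∂halfVol := by
    have := integral_sub (hφ.memLp.integrable_mul_half (hψ.deriv k).memLp) (hφ.memLp.integrable_mul_half hd2)
    simp only [Pi.sub_apply] at this
    rw [← this]
    exact integral_congr_ae (Eventually.of_forall fun x => by simp only []; ring)
  have b1 := (abs_integral_mul_le hφρ hd1).trans (mul_le_mul_of_nonneg_left h1 (nrm_nonneg _))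
  have b2 := (abs_integral_mul_le hφ.memLp hd2).trans
    (mul_le_mul_of_nonneg_left (h2 k) (nrm_nonneg _))
  simp only [Pi.sub_apply] at b2
  have b5 : A * (ε / (A + 1)) ≤ ε := by
    rw [mul_div_assoc', div_le_iff₀ (by positivity)]
    nlinarith
  have e3 : ∀ a b c d : ℝ, a + b = 0 → a - c + (b - d) = -(c + d) := fun a b c d h => by linarith
  rw [e1, e2, e3 _ _ _ _ e0, abs_neg, zero_add]
  refine (abs_add_le _ _).trans ((add_le_add b1 b2).trans ?_)
  rw [← add_mul]
  exact b5

/-- Uniqueness of weak derivatives. -/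
lemma HasWeak.unique (h : HasWeak lowerHalf k u w) (h' : HasWeak lowerHalf k u w') :
    w =ᵐ[halfVol] w' := by
  have hl : LocallyIntegrableOn (fun x => w x - w' x) (lowerHalf : Set E3) halfVol :=
    ((h.memLp'.sub h'.memLp').locallyIntegrable (by norm_num)).locallyIntegrableOn _
  have := isOpen_lowerHalf.ae_eq_zero_of_integral_contDiff_smul_eq_zero hl fun φ hφ hc hs => by
    have hT : IsTest φ := ⟨hφ, hc⟩
    simp only [smul_eq_mul, mul_sub]
    rw [integral_sub (hT.memLp.integrable_mul_half h.memLp') (hT.memLp.integrable_mul_half h'.memLp'),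
      ← neg_neg (∫ x, φ x * w x ∂halfVol), ← h.gauss φ hT hs, h'.gauss φ hT hs]
    ring
  filter_upwards [this, ae_restrict_mem measurableSet_lowerHalf] with x hx hx2
  exact sub_eq_zero.1 (hx hx2)

lemma WeakD.coord {f g : E3 → E3} (h : WeakD k f g) (hf : MemLp f 2 halfVol)
    (hg : MemLp g 2 halfVol) (i : Fin 3) :
    HasWeak lowerHalf k (fun x => f x i) (fun x => g x i) where
  memLp := (EuclideanSpace.proj (𝕜 := ℝ) i).comp_memLp' hf
  memLp' := (EuclideanSpace.proj (𝕜 := ℝ) i).comp_memLp' hg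
  gauss φ hφ hs := by
    have h1 := congrArg (fun v : E3 => v i) (h φ hφ hs)
    simp only [PiLp.neg_apply] at h1
    rw [coord_integral (integrable_smul_of_memLp (hφ.deriv k).memLp hf),
      coord_integral (integrable_smul_of_memLp hφ.memLp hg)] at h1
    simpa using h1

lemma weakD_of_coord {f g : E3 → E3} (h : ∀ i, HasWeak lowerHalf k (fun x => f x i) fun x => g x i) :
    WeakD k f g := by
  intro φ hφ hs
  have hf : MemLp f 2 halfVol := MemLp.of_eval_piLp fun i => (h i).memLp
  have hg : MemLp g 2 halfVol := MemLp.of_eval_piLp fun i => (h i).memLp'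
  ext i
  rw [PiLp.neg_apply, coord_integral (integrable_smul_of_memLp (hφ.deriv k).memLp hf),
    coord_integral (integrable_smul_of_memLp hφ.memLp hg)]
  simpa using (h i).gauss φ hφ hs

/-- Weak derivatives commute. -/
lemma WeakD.comm {F : Type*} [NormedAddCommGroup F] [NormedSpace ℝ F] {v : E3 → F}
    {D : Fin 3 → E3 → F} (hv : ∀ k, WeakD k v (D k)) {k l : Fin 3} {w : E3 → F}
    (h : WeakD k (D l) w) : WeakD l (D k) w := by
  intro φ hφ hs
  rw [← h φ hφ hs, ← neg_inj, ← hv k (dd l φ) (hφ.deriv l) ((tsupport_dd_subset φ l).trans hs),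
    ← hv l (dd k φ) (hφ.deriv k) ((tsupport_dd_subset φ k).trans hs)]
  simp only [dd_comm hφ.smooth k l]

end WeakCalculus

/-! ### The second normal derivative from the equation. -/

section NormalRegularity

variable {M K α₀ β₀ : ℝ} {lam mu : E3 → ℝ}

lemma HasWeak.strain {S : Set E3} {k : Fin 3} {D D' : Fin 3 → E3 → E3}
    (h : ∀ l i, HasWeak S k (fun x => D l x i) fun x => D' l x i) (i j : Fin 3) :
    HasWeak S k (strain D i j) (strain D' i j) :=
  (((h j i).add (h i j)).const_mul 2⁻¹).congr
    (Eventually.of_forall fun x => by simp only [HalfSpaceElasticity.strain]; ring)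
    (Eventually.of_forall fun x => by simp only [HalfSpaceElasticity.strain]; ring)

/-- The product rule for the stress. -/
lemma HasWeak.stress (h : IsLameMedium M K α₀ β₀ lam mu) {S : Set E3} (hS : IsOpen S) {k : Fin 3}
    {D D' : Fin 3 → E3 → E3} (hD : ∀ l i, HasWeak S k (fun x => D l x i) fun x => D' l x i)
    (i j : Fin 3) : HasWeak S k (stress lam mu D i j) fun x =>
      stress (pd k lam) (pd k mu) D i j x + HalfSpaceElasticity.stress lam mu D' i j x := by
  obtain ⟨hl, hm, -⟩ := h.coeffs
  have h1 : HasWeak S k (fun x => if i = j then ∑ l, HalfSpaceElasticity.strain D l l x else 0)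
      fun x => if i = j then ∑ l, HalfSpaceElasticity.strain D' l l x else 0 := by
    split_ifs
    · exact HasWeak.sum _ fun l _ => HasWeak.strain hD l l
    · exact HasWeak.zero
  have h2 := h1.mul_lipschitz hS h.lipschitz_lam hl
  have h3 := ((HasWeak.strain hD i j).mul_lipschitz hS h.lipschitz_mu hm).const_mul 2
  refine (h2.add h3).congr (Eventually.of_forall fun x => ?_) (Eventually.of_forall fun x => ?_)
  · simp only [HalfSpaceElasticity.stress]; ring
  · simp only [HalfSpaceElasticity.stress]; ring

lemma lipschitz_inv {c : E3 → ℝ} (hc : ∃ L, LipschitzOnWith L c lowerHalf) {a : ℝ} (ha : 0 < a)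
    (h : ∀ x ∈ lowerHalf, a ≤ c x) : ∃ L, LipschitzOnWith L (fun x => (c x)⁻¹) lowerHalf := by
  obtain ⟨L, hL⟩ := hc
  refine ⟨L * (a⁻¹ ^ 2).toNNReal, LipschitzOnWith.of_dist_le_mul fun x hx y hy => ?_⟩
  have h1 := h x hx
  have h2 := h y hy
  have hx0 : 0 < c x := ha.trans_le h1
  have hy0 : 0 < c y := ha.trans_le h2
  have h3 := hL.dist_le_mul x hx y hy
  rw [Real.dist_eq] at h3 ⊢
  have e : (c x)⁻¹ - (c y)⁻¹ = -(c x - c y) * ((c x)⁻¹ * (c y)⁻¹) := by field_simp; ring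
  have h4 : (c x)⁻¹ ≤ a⁻¹ := inv_anti₀ ha h1
  have h5 : (c y)⁻¹ ≤ a⁻¹ := inv_anti₀ ha h2
  have h6 : (c x)⁻¹ * (c y)⁻¹ ≤ a⁻¹ ^ 2 := by
    rw [sq]; exact mul_le_mul h4 h5 (inv_nonneg.2 hy0.le) (inv_nonneg.2 ha.le)
  rw [e, abs_mul, abs_neg, abs_of_pos (mul_pos (inv_pos.2 hx0) (inv_pos.2 hy0)), NNReal.coe_mul,
    Real.coe_toNNReal _ (by positivity)]
  calc |c x - c y| * ((c x)⁻¹ * (c y)⁻¹) ≤ (L * dist x y) * a⁻¹ ^ 2 :=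
        mul_le_mul h3 h6 (by positivity) (by positivity)
    _ = _ := by ring

lemma isBddCoeff_inv {c : E3 → ℝ} (hc : ∃ L, LipschitzOnWith L c lowerHalf) {a : ℝ} (ha : 0 < a)
    (h : ∀ x ∈ lowerHalf, a ≤ c x) : IsBddCoeff fun x => (c x)⁻¹ := by
  obtain ⟨L, hL⟩ := lipschitz_inv hc ha h
  refine ⟨hL.continuousOn.aestronglyMeasurable measurableSet_lowerHalf, a⁻¹, ?_⟩
  filter_upwards [ae_restrict_mem measurableSet_lowerHalf] with x hx
  rw [Real.norm_of_nonneg (inv_nonneg.2 (ha.le.trans (h x hx)))]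
  exact inv_anti₀ ha (h x hx)

lemma ae_mem_lowerHalf : ∀ᵐ x ∂halfVol, x ∈ lowerHalf := ae_restrict_mem measurableSet_lowerHalf

lemma IsTest.isEnergy {F : Type*} [NormedAddCommGroup F] [NormedSpace ℝ F] {φ : E3 → F}
    (h : IsTest φ) (hw : ∀ k, WeakD k φ (dd k φ)) : IsEnergy φ fun k => dd k φ :=
  ⟨h.memLp_rho_inv_smul, fun k => (h.deriv k).memLp, hw⟩

lemma IsTest.weakD {φ : E3 → ℝ} (h : IsTest φ) (k : Fin 3) : WeakD k φ (dd k φ) := by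
  obtain ⟨L, hL⟩ := h.exists_lipschitzWith
  exact weakD_of_lipschitz ⟨L, hL.lipschitzOnWith⟩ k

/-- The test field `φ e_i`. -/
lemma IsTest.isEnergy_smul_stdBasis {φ : E3 → ℝ} (h : IsTest φ) (i : Fin 3) :
    IsEnergy (fun x => φ x • stdBasis i) fun k x => dd k φ x • stdBasis i := by
  refine ⟨IsTest.memLp_rho_inv_smul (IsTest.smul' h contDiff_const), fun k =>
    (IsTest.smul' (h.deriv k) contDiff_const).memLp, fun k θ hθ hs => ?_⟩
  have h1 := h.weakD k θ hθ hs
  simp only [smul_smul]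
  rw [integral_smul_const, integral_smul_const, ← neg_smul]
  exact congrArg (· • stdBasis i) h1

lemma memLp_stress {c d : E3 → ℝ} (hc : IsBddCoeff c) (hd : IsBddCoeff d) {D : Fin 3 → E3 → E3}
    (hD : ∀ k, MemLp (D k) 2 halfVol) (i j : Fin 3) : MemLp (stress c d D i j) 2 halfVol := by
  have hs1 : MemLp (fun x => if i = j then ∑ k, strain D k k x else 0) 2 halfVol := by
    split_ifs
    · exact memLp_finsetSum _ fun k _ => memLp_strain hD k k
    · exact MemLp.zero
  exact (((hs1.isBddCoeff_mul hc).add (((memLp_strain hD i j).isBddCoeff_mul hd).const_mul 2)).ae_eq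
    (Eventually.of_forall fun x => by simp only [stress, Pi.add_apply]; ring))

/-- The weak formulation, tested with `φ e_i`. -/
lemma IsWeakSol.test {D : Fin 3 → E3 → E3} {g : E3 → E3} (hs : IsWeakSol lam mu D g)
    (h : IsLameMedium M K α₀ β₀ lam mu) (hD : ∀ k, MemLp (D k) 2 halfVol) {φ : E3 → ℝ}
    (hφ : IsTest φ) (i : Fin 3) :
    ∑ j, ∫ x, dd j φ x * stress lam mu D i j x ∂halfVol = -∫ x, φ x * g x i ∂halfVol := by
  have h1 := hs _ _ (hφ.isEnergy_smul_stdBasis i)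
  obtain ⟨hl, hm, -⟩ := h.coeffs
  have e1 : ∀ x, form lam mu D (fun k x => dd k φ x • stdBasis i) x
      = ∑ j, dd j φ x * stress lam mu D i j x := by
    intro x
    simp only [form, PiLp.smul_apply, smul_eq_mul, stdBasis, PiLp.single_apply]
    rw [Finset.sum_eq_single i (fun b _ hb => by simp [hb]) (by simp)]
    exact Finset.sum_congr rfl fun j _ => by simp; ring
  have e2 : ∀ x, inner ℝ (g x) (φ x • stdBasis i) = φ x * g x i := by
    intro x
    simp [stdBasis, inner_smul_right, EuclideanSpace.inner_single_right]
  simp only [e1, e2] at h1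
  rw [← h1, integral_finsetSum]
  intro j _
  exact (hφ.deriv j).memLp.integrable_mul_half (memLp_stress hl hm hD i j)

lemma memLp_of_memLp_rho_smul {F : Type*} [NormedAddCommGroup F] [NormedSpace ℝ F] {g : E3 → F}
    (hg : MemLp (fun x => rho x • g x) 2 halfVol) : MemLp g 2 halfVol := by
  refine (hg.bdd_smul continuous_rho_inv.aestronglyMeasurable (B := 1)
    (Eventually.of_forall fun x => ?_)).ae_eq (Eventually.of_forall fun x => ?_)
  · rw [abs_of_nonneg (inv_nonneg.2 (rho_pos x).le)]; exact rho_inv_le_one x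
  · simp only [smul_smul, inv_mul_cancel₀ (rho_pos x).ne', one_smul]

/-- The weak normal derivative of the normal stress of a weak solution. -/
lemma IsWeakSol.hasWeak_stress (h : IsLameMedium M K α₀ β₀ lam mu) {D : Fin 3 → E3 → E3}
    {g : E3 → E3} (hs : IsWeakSol lam mu D g) (hg : MemLp g 2 halfVol)
    (hD : ∀ k, MemLp (D k) 2 halfVol) {S : Set E3} (hS : IsOpen S) {T : Fin 3 → Fin 3 → E3 → E3}
    (hT : ∀ k, k ≠ 2 → ∀ l i, HasWeak S k (fun x => D l x i) fun x => T k l x i) (i : Fin 3) :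
    HasWeak S 2 (stress lam mu D i 2) fun x =>
      g x i - (dStress lam mu D T 0 i 0 x + dStress lam mu D T 1 i 1 x) := by
  have h0 := HasWeak.stress h hS (hT 0 (by decide)) i 0
  have h1 := HasWeak.stress h hS (hT 1 (by decide)) i 1
  have hgi : MemLp (fun x => g x i) 2 halfVol := (EuclideanSpace.proj (𝕜 := ℝ) i).comp_memLp' hg
  have hd : MemLp (fun x => dStress lam mu D T 0 i 0 x + dStress lam mu D T 1 i 1 x) 2 halfVol :=
    h0.memLp'.add h1.memLp'
  obtain ⟨hl, hm, -⟩ := h.coeffs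
  refine ⟨memLp_stress hl hm hD i 2, hgi.sub hd, fun φ hφ hφs => ?_⟩
  -- The weak equation tested with `φ e_i` is solved for the term in the normal direction. Its test
  -- functions need not vanish at the boundary, so the choice `S = univ` also yields zero traction.
  have e := hs.test h hD hφ i
  rw [Fin.sum_univ_three, h0.gauss φ hφ hφs, h1.gauss φ hφ hφs] at e
  have i0 := hφ.memLp.integrable_mul_half h0.memLp'
  have i1 := hφ.memLp.integrable_mul_half h1.memLp'
  have ig := hφ.memLp.integrable_mul_half hgi
  have e2 : ∫ x, φ x * (g x i - (dStress lam mu D T 0 i 0 x + dStress lam mu D T 1 i 1 x)) ∂halfVol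
      = ∫ x, φ x * g x i ∂halfVol - (∫ x, φ x * dStress lam mu D T 0 i 0 x ∂halfVol
        + ∫ x, φ x * dStress lam mu D T 1 i 1 x ∂halfVol) := by
    have e3 := integral_add i0 i1
    have e4 := integral_sub ig (i0.add i1)
    simp only [Pi.add_apply] at e4
    simp only [dStress]
    rw [← e3, ← e4]
    exact integral_congr_ae (Eventually.of_forall fun x => by simp only []; ring)
  rw [e2]
  simp only [dStress]
  linarith

/-- Existence of the second normal derivative of a weak solution. -/
lemma IsWeakSol.exists_normal (h : IsLameMedium M K α₀ β₀ lam mu) (hα₀ : 0 < α₀) (hβ₀ : 0 < β₀)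
    {D : Fin 3 → E3 → E3} {g : E3 → E3} (hs : IsWeakSol lam mu D g) (hg : MemLp g 2 halfVol)
    (hD : ∀ k, MemLp (D k) 2 halfVol) {T : Fin 3 → Fin 3 → E3 → E3}
    (hT : ∀ k, k ≠ 2 → ∀ l i, HasWeak lowerHalf k (fun x => D l x i) fun x => T k l x i)
    (hT2 : ∀ l, l ≠ 2 → ∀ i, HasWeak lowerHalf 2 (fun x => D l x i) fun x => T l 2 x i) :
    ∃ N : E3 → E3, ∀ i, HasWeak lowerHalf 2 (fun x => D 2 x i) fun x => N x i := by
  obtain ⟨hl, hm, -⟩ := h.coeffs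
  have hO := isOpen_lowerHalf
  have hσ := fun i => hs.hasWeak_stress h hg hD hO hT i
  suffices H : ∀ i, ∃ n : E3 → ℝ, HasWeak lowerHalf 2 (fun x => D 2 x i) n by
    choose n hn using H
    exact ⟨fun x => WithLp.toLp 2 fun i => n i x, hn⟩
  have hmi := lipschitz_inv h.lipschitz_mu hα₀ h.convex_mu
  have hmb := isBddCoeff_inv h.lipschitz_mu hα₀ h.convex_mu
  -- For tangential `i` the stress entry is `mu (∂₃ v_i + ∂_i v₃)`: divide by `mu`, which is
  -- Lipschitz and bounded below, and subtract a derivative already known.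
  have key : ∀ i, i ≠ 2 → ∃ n : E3 → ℝ, HasWeak lowerHalf 2 (fun x => D 2 x i) n := by
    intro i hi
    refine ⟨_, (((hσ i).mul_lipschitz hO hmi hmb).sub (hT2 i hi 2)).congr ?_ (ae_eq_refl _)⟩
    filter_upwards [ae_mem_lowerHalf] with x hx
    have hm0 : mu x ≠ 0 := (hα₀.trans_le (h.convex_mu x hx)).ne'
    simp only [stress, hi, if_false, strain]
    field_simp
    ring
  intro i
  by_cases hi : i = 2
  · subst hi
    have hc : ∃ L, LipschitzOnWith L (fun x => lam x + 2 * mu x) lowerHalf := by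
      obtain ⟨L, hL⟩ := h.lipschitz_lam
      obtain ⟨L', hL'⟩ := h.lipschitz_mu
      refine ⟨L + 2 * L', LipschitzOnWith.of_dist_le_mul fun x hx y hy => ?_⟩
      have h1 := hL.dist_le_mul x hx y hy
      have h2 := hL'.dist_le_mul x hx y hy
      rw [Real.dist_eq] at h1 h2 ⊢
      have h3 := abs_add_le (lam x - lam y) (2 * (mu x - mu y))
      rw [abs_mul, abs_two] at h3
      have e : lam x + 2 * mu x - (lam y + 2 * mu y) = lam x - lam y + 2 * (mu x - mu y) := by ring
      rw [e, NNReal.coe_add, NNReal.coe_mul, NNReal.coe_ofNat]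
      linarith
    -- `3 (lam + 2 mu) = (3 lam + 2 mu) + 4 mu`.
    have ha : ∀ x ∈ lowerHalf, (β₀ + 4 * α₀) / 3 ≤ lam x + 2 * mu x := fun x hx => by
      linarith [h.convex_mu x hx, h.convex_lam x hx]
    have ha0 : 0 < (β₀ + 4 * α₀) / 3 := by positivity
    -- The normal stress entry is `(lam + 2 mu) ∂₃ v₃` plus `lam` times the tangential divergence;
    -- the latter is subtracted before dividing.
    have h1 := ((hT2 0 (by decide) 0).add (hT2 1 (by decide) 1)).mul_lipschitz hO h.lipschitz_lam hl
    refine ⟨_, (((hσ 2).sub h1).mul_lipschitz hO (lipschitz_inv hc ha0 ha)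
      (isBddCoeff_inv hc ha0 ha)).congr ?_ (ae_eq_refl _)⟩
    filter_upwards [ae_mem_lowerHalf] with x hx
    have hm0 : lam x + 2 * mu x ≠ 0 := (ha0.trans_le (ha x hx)).ne'
    simp only [stress, if_true, strain, Fin.sum_univ_three]
    rw [inv_mul_eq_iff_eq_mul₀ hm0]
    ring
  · exact key i hi

end NormalRegularity

/-! ### The weighted second order estimate and the equation almost everywhere. -/

section FullRegularity

variable {M K α₀ β₀ : ℝ} {lam mu : E3 → ℝ}

lemma norm_le_sum_abs (v : E3) : ‖v‖ ≤ ∑ i, |v i| := by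
  have h0 : 0 ≤ ∑ i, |v i| := Finset.sum_nonneg fun i _ => abs_nonneg _
  refine (abs_le_of_sq_le_sq' (a := ‖v‖) ?_ h0).2
  rw [PiLp.norm_sq_eq_of_L2]
  exact Finset.sum_sq_le_sq_sum_of_nonneg fun i _ => abs_nonneg _

lemma IsLameMedium.ae_abs_pd_le (h : IsLameMedium M K α₀ β₀ lam mu) :
    ∀ᵐ x ∂halfVol, ∀ l, |pd l lam x| ≤ |K| * (rho x)⁻¹ ∧ |pd l mu x| ≤ |K| * (rho x)⁻¹ := by
  have key : ∀ {f : E3 → ℝ} {x : E3}, ‖fderiv ℝ f x‖ ≤ K / rho x → ∀ l, |pd l f x| ≤ |K| * (rho x)⁻¹ := by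
    intro f x hx l
    have h1 := (fderiv ℝ f x).le_opNorm (stdBasis l)
    rw [norm_stdBasis, mul_one] at h1
    rw [← div_eq_mul_inv]
    exact (h1.trans hx).trans (div_le_div_of_nonneg_right (le_abs_self K) (rho_pos x).le)
  filter_upwards [h.decay_lam, h.decay_mu] with x h1 h2 l
  exact ⟨key h1 l, key h2 l⟩

/-- Pointwise control of the second normal derivative by the other derivatives. -/
lemma norm_normal_le (hα₀ : 0 < α₀) (hβ₀ : 0 < β₀) {D : Fin 3 → E3 → E3}
    {D₂ : Fin 3 → Fin 3 → E3 → E3} (hsym : ∀ l k, D₂ l k = D₂ k l) {g : E3 → E3} {x : E3}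
    (hg : ∀ i, g x i = ∑ j, dStress lam mu D D₂ j i j x)
    (hb : |lam x| ≤ |M| ∧ |mu x| ≤ |M|)
    (hp : ∀ l, |pd l lam x| ≤ |K| * (rho x)⁻¹ ∧ |pd l mu x| ≤ |K| * (rho x)⁻¹)
    (h1 : α₀ ≤ mu x) (h2 : β₀ ≤ 3 * lam x + 2 * mu x) :
    ‖rho x • D₂ 2 2 x‖ ≤ (min α₀ ((β₀ + 4 * α₀) / 3))⁻¹ *
      (3 * ‖rho x • g x‖ + 27 * |K| * ∑ k, ‖D k x‖
        + 12 * |M| * (∑ k, ‖rho x • D₂ 0 k x‖ + ∑ k, ‖rho x • D₂ 1 k x‖)) := by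
  set a := min α₀ ((β₀ + 4 * α₀) / 3) with ha
  have ha0 : 0 < a := lt_min hα₀ (by positivity)
  set s := ∑ k, ‖D k x‖ with hs
  set θ : Fin 3 → ℝ := fun j => ∑ k, ‖D₂ j k x‖ with hθ
  have hs0 : 0 ≤ s := Finset.sum_nonneg fun k _ => norm_nonneg _
  have hθ0 : ∀ j, 0 ≤ θ j := fun j => Finset.sum_nonneg fun k _ => norm_nonneg _
  have hρ := rho_pos x
  have hco : ∀ j k i, |D₂ j k x i| ≤ θ j := fun j k i =>
    (PiLp.norm_apply_le (D₂ j k x) i).trans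
      (Finset.single_le_sum (f := fun k => ‖D₂ j k x‖) (fun k _ => norm_nonneg _) (Finset.mem_univ k))
  have hds : ∀ l i j, |stress (pd l lam) (pd l mu) D i j x| ≤ 3 * (|K| * (rho x)⁻¹) * s :=
    fun l i j => abs_stress_le _ _ D i j x (hp l).1 (hp l).2
  have hst : ∀ l i j, |stress lam mu (D₂ l) i j x| ≤ 3 * |M| * θ l :=
    fun l i j => abs_stress_le _ _ (D₂ l) i j x hb.1 hb.2
  -- The equation is solved for the part of the normal stress derivative that contains `D₂ 2 2`:
  -- three terms with differentiated coefficients give `9`, two tangential columns give `θ 0 + θ 1`.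
  have hr : ∀ i, |stress lam mu (D₂ 2) i 2 x|
      ≤ ‖g x‖ + 9 * (|K| * (rho x)⁻¹) * s + 3 * |M| * (θ 0 + θ 1) := by
    intro i
    have e := hg i
    rw [Fin.sum_univ_three] at e
    simp only [dStress] at e
    have hgi : |g x i| ≤ ‖g x‖ := PiLp.norm_apply_le (g x) i
    have a0 := abs_le.1 (hds 0 i 0)
    have a1 := abs_le.1 (hds 1 i 1)
    have a2 := abs_le.1 (hds 2 i 2)
    have b0 := abs_le.1 (hst 0 i 0)
    have b1 := abs_le.1 (hst 1 i 1)
    have c0 := abs_le.1 hgi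
    exact abs_le.2 ⟨by linarith [a0.2, a1.2, a2.2, b0.2, b1.2, c0.1],
      by linarith [a0.1, a1.1, a2.1, b0.1, b1.1, c0.2]⟩
  have hM : ∀ {c t b : ℝ}, |c| ≤ |M| → |t| ≤ b → |c * t| ≤ |M| * b := fun hc ht => by
    rw [abs_mul]; exact mul_le_mul hc ht (abs_nonneg _) (abs_nonneg _)
  have hN : ∀ i, a * |D₂ 2 2 x i|
      ≤ ‖g x‖ + 9 * (|K| * (rho x)⁻¹) * s + 4 * |M| * (θ 0 + θ 1) := by
    have hM0 := abs_nonneg M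
    have hmu : ∀ i, i ≠ 2 → |D₂ 2 i x 2| ≤ θ 0 + θ 1 → a * |D₂ 2 2 x i|
      ≤ ‖g x‖ + 9 * (|K| * (rho x)⁻¹) * s + 4 * |M| * (θ 0 + θ 1) := by
      intro i hi hc
      have e : mu x * D₂ 2 2 x i = stress lam mu (D₂ 2) i 2 x - mu x * D₂ 2 i x 2 := by
        simp only [stress, hi, if_false, strain]; ring
      have h3 : a * |D₂ 2 2 x i| ≤ |mu x * D₂ 2 2 x i| := by
        rw [abs_mul, abs_of_pos (hα₀.trans_le h1)]
        exact mul_le_mul_of_nonneg_right ((min_le_left _ _).trans h1) (abs_nonneg _)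
      rw [e] at h3
      have h4 := abs_sub (stress lam mu (D₂ 2) i 2 x) (mu x * D₂ 2 i x 2)
      linarith [hr i, hM hb.2 hc]
    intro i
    by_cases hi : i = 2
    · subst hi
      have e : (lam x + 2 * mu x) * D₂ 2 2 x 2
          = stress lam mu (D₂ 2) 2 2 x - lam x * (D₂ 2 0 x 0 + D₂ 2 1 x 1) := by
        simp only [stress, if_true, strain, Fin.sum_univ_three]; ring
      have h3 : a * |D₂ 2 2 x 2| ≤ |(lam x + 2 * mu x) * D₂ 2 2 x 2| := by
        have h5 : (β₀ + 4 * α₀) / 3 ≤ lam x + 2 * mu x := by linarith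
        rw [abs_mul, abs_of_pos (lt_of_lt_of_le (by positivity) h5)]
        exact mul_le_mul_of_nonneg_right ((min_le_right _ _).trans h5) (abs_nonneg _)
      rw [e] at h3
      have h4 := abs_sub (stress lam mu (D₂ 2) 2 2 x) (lam x * (D₂ 2 0 x 0 + D₂ 2 1 x 1))
      have h6 : |D₂ 2 0 x 0 + D₂ 2 1 x 1| ≤ θ 0 + θ 1 := by
        rw [hsym 2 0, hsym 2 1]
        exact (abs_add_le _ _).trans (add_le_add (hco 0 2 0) (hco 1 2 1))
      linarith [hr 2, hM hb.1 h6]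
    · refine hmu i hi ?_
      rw [hsym 2 i]
      have h5 : θ i ≤ θ 0 + θ 1 := by
        fin_cases i
        · exact le_add_of_nonneg_right (hθ0 1)
        · exact le_add_of_nonneg_left (hθ0 0)
        · exact absurd rfl hi
      exact (hco i 2 2).trans h5
  have hsum : a * ‖D₂ 2 2 x‖
      ≤ 3 * (‖g x‖ + 9 * (|K| * (rho x)⁻¹) * s + 4 * |M| * (θ 0 + θ 1)) := by
    have h3 := mul_le_mul_of_nonneg_left (norm_le_sum_abs (D₂ 2 2 x)) ha0.le
    rw [Fin.sum_univ_three] at h3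
    linarith [hN 0, hN 1, hN 2]
  rw [← div_eq_inv_mul, le_div_iff₀ ha0]
  simp only [norm_smul, Real.norm_of_nonneg hρ.le, ← Finset.mul_sum]
  have h4 := mul_le_mul_of_nonneg_left hsum hρ.le
  have h5 : rho x * (rho x)⁻¹ = 1 := mul_inv_cancel₀ hρ.ne'
  have e : rho x * (3 * (‖g x‖ + 9 * (|K| * (rho x)⁻¹) * s + 4 * |M| * (θ 0 + θ 1)))
      = 3 * (rho x * ‖g x‖) + 27 * |K| * s * (rho x * (rho x)⁻¹)
        + 12 * |M| * (rho x * θ 0 + rho x * θ 1) := by ring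
  rw [e, h5, mul_one] at h4
  have e2 : rho x * ‖D₂ 2 2 x‖ * a = rho x * (a * ‖D₂ 2 2 x‖) := by ring
  rw [e2]
  exact h4

/-- Regularity of weak solutions: the second derivatives are square integrable with weight `ϱ`, and
the equation holds almost everywhere. -/
theorem exists_second_derivatives (M K : ℝ) {α₀ β₀ : ℝ} (hα₀ : 0 < α₀) (hβ₀ : 0 < β₀) :
    ∃ C : ℝ, 0 ≤ C ∧ ∀ {lam mu : E3 → ℝ}, IsLameMedium M K α₀ β₀ lam mu → ∀ {v g : E3 → E3}
      {D : Fin 3 → E3 → E3}, IsEnergy v D → IsWeakSol lam mu D g →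
      MemLp (fun x => rho x • g x) 2 halfVol → ∃ D₂ : Fin 3 → Fin 3 → E3 → E3,
        (∀ l k, D₂ l k = D₂ k l) ∧ (∀ l k, WeakD l (D k) (D₂ l k)) ∧
        (∀ l k, MemLp (fun x => rho x • D₂ l k x) 2 halfVol ∧
          nrm (fun x => rho x • D₂ l k x) ≤ C * nrm fun x => rho x • g x) ∧
        ∀ᵐ x ∂halfVol, divStress lam mu D D₂ x = g x := by
  set c := 26244 / min (2 * α₀) β₀ with hc
  have hmin := lt_min (show 0 < 2 * α₀ by linarith) hβ₀
  have hc0 : 0 < c := by rw [hc]; positivity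
  set C₁ := (36 * |K| * c ^ 2 + 2 * c) + c * (1296 * |M| * c ^ 2 + 432 * |K| * c ^ 2 + 8 * c) + 1
    + 4 * c with hC₁
  have hC₁0 : 0 ≤ C₁ := by positivity
  set a := min α₀ ((β₀ + 4 * α₀) / 3) with ha
  have ha0 : 0 < a := lt_min hα₀ (by positivity)
  -- `54 = 27 · 2`, from the energy estimate with constant `2c`; `72 = 12 · 6`, from six second
  -- derivatives bounded by `C₁`.
  refine ⟨C₁ + a⁻¹ * (3 + 54 * |K| * c + 72 * |M| * C₁), by positivity, ?_⟩
  intro lam mu h v g D hv hs hg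
  set n := nrm fun x => rho x • g x with hn
  have hn0 : 0 ≤ n := nrm_nonneg _
  have hT0 : ∀ k j, ∃ w : E3 → E3, k ≠ 2 → MemLp (fun x => rho x • w x) 2 halfVol ∧
      nrm (fun x => rho x • w x) ≤ C₁ * n ∧ WeakD k (D j) w := by
    intro k j
    by_cases hk : k = 2
    · exact ⟨0, fun h => absurd hk h⟩
    · obtain ⟨w, hw⟩ := hs.exists_weakD_tangential h hα₀ hβ₀ hv hg hk j hc
      exact ⟨w, fun _ => hw⟩
  choose T hT using hT0
  have hTm : ∀ k j, k ≠ 2 → MemLp (T k j) 2 halfVol := fun k j hk =>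
    memLp_of_memLp_rho_smul (hT k j hk).1
  have hgm := memLp_of_memLp_rho_smul hg
  obtain ⟨N, hN⟩ := hs.exists_normal h hα₀ hβ₀ hgm hv.mem1 (T := T)
    (fun k hk l i => (hT k l hk).2.2.coord (hv.mem1 l) (hTm k l hk) i)
    (fun l hl i => (WeakD.comm hv.weak (hT l 2 hl).2.2).coord (hv.mem1 l) (hTm l 2 hl) i)
  have hNm : MemLp N 2 halfVol := MemLp.of_eval_piLp fun i => (hN i).memLp'
  -- `T k j` is meaningful only for tangential `k`. Ordering the indices puts a tangential one first
  -- unless both are normal, and makes the family symmetric by construction.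
  let D₂ : Fin 3 → Fin 3 → E3 → E3 := fun l k =>
    if l = 2 ∧ k = 2 then N else T (min l k) (max l k)
  have hsym : ∀ l k, D₂ l k = D₂ k l := fun l k => by
    simp only [D₂, and_comm, min_comm, max_comm]
  have hD2T : ∀ l k, l ≠ 2 ∨ k ≠ 2 → D₂ l k = T (min l k) (max l k) ∧ min l k ≠ 2 := by
    intro l k hlk
    refine ⟨if_neg fun hc => ?_, ?_⟩
    · rcases hlk with hlk | hlk
      · exact hlk hc.1
      · exact hlk hc.2
    · revert hlk
      revert l k
      decide
  have hW : ∀ l k, WeakD l (D k) (D₂ l k) := by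
    intro l k
    by_cases hlk : l = 2 ∧ k = 2
    · obtain ⟨rfl, rfl⟩ := hlk
      exact weakD_of_coord hN
    · obtain ⟨e, hmn⟩ := hD2T l k (not_and_or.1 hlk)
      rw [e]
      have hw := (hT (min l k) (max l k) hmn).2.2
      rcases le_total l k with hle | hle
      · rw [min_eq_left hle, max_eq_right hle] at hw ⊢
        exact hw
      · rw [min_eq_right hle, max_eq_left hle] at hw ⊢
        exact WeakD.comm hv.weak hw
  have hm2 : ∀ l k, MemLp (D₂ l k) 2 halfVol := by
    intro l k
    by_cases hlk : l = 2 ∧ k = 2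
    · obtain ⟨rfl, rfl⟩ := hlk
      exact hNm
    · obtain ⟨e, hmn⟩ := hD2T l k (not_and_or.1 hlk)
      rw [e]
      exact hTm _ _ hmn
  have hHW : ∀ l k i, HasWeak lowerHalf l (fun x => D k x i) fun x => D₂ l k x i := fun l k i =>
    (hW l k).coord (hv.mem1 k) (hm2 l k) i
  have hdiv : ∀ᵐ x ∂halfVol, ∀ i, g x i = ∑ j, dStress lam mu D D₂ j i j x := by
    refine ae_all_iff.2 fun i => ?_
    -- The normal derivative of the normal stress is known both from the equation and from the
    -- product rule; uniqueness of weak derivatives gives the equation almost everywhere.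
    have h1 := hs.hasWeak_stress h hgm hv.mem1 isOpen_lowerHalf (T := D₂) (fun k _ l i => hHW k l i) i
    have h2 := HasWeak.stress h isOpen_lowerHalf (hHW 2) i 2
    filter_upwards [h1.unique h2] with x hx
    rw [Fin.sum_univ_three]
    simp only [dStress] at hx ⊢
    linarith
  -- `exists_normal` gives membership in `L²` without weight; the weighted bound is read off from
  -- the equation pointwise.
  have hpt : ∀ᵐ x ∂halfVol, ‖rho x • D₂ 2 2 x‖ ≤ a⁻¹ *
      (3 * ‖rho x • g x‖ + 27 * |K| * ∑ k, ‖D k x‖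
        + 12 * |M| * (∑ k, ‖rho x • D₂ 0 k x‖ + ∑ k, ‖rho x • D₂ 1 k x‖)) := by
    filter_upwards [hdiv, h.ae_abs_le, h.ae_abs_pd_le, ae_mem_lowerHalf] with x h1 h2 h3 h4
    exact norm_normal_le hα₀ hβ₀ hsym h1 h2 h3 (h.convex_mu x h4) (h.convex_lam x h4)
  have htan : ∀ l k, l ≠ 2 ∨ k ≠ 2 → MemLp (fun x => rho x • D₂ l k x) 2 halfVol ∧
      nrm (fun x => rho x • D₂ l k x) ≤ C₁ * n := by
    intro l k hlk
    obtain ⟨e, hmn⟩ := hD2T l k hlk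
    rw [e]
    exact ⟨(hT _ _ hmn).1, (hT _ _ hmn).2.1⟩
  have hrest : 0 ≤ a⁻¹ * (3 + 54 * |K| * c + 72 * |M| * C₁) := by positivity
  refine ⟨D₂, hsym, hW, fun l k => ?_, ?_⟩
  · by_cases hlk : l = 2 ∧ k = 2
    · obtain ⟨rfl, rfl⟩ := hlk
      have m1 : MemLp (fun x => 3 * ‖rho x • g x‖) 2 halfVol := hg.norm.const_mul 3
      have m2 : MemLp (fun x => 27 * |K| * ∑ k, ‖D k x‖) 2 halfVol :=
        (memLp_sum_norm hv.mem1).const_mul _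
      have m4 : ∀ l, l ≠ 2 → MemLp (fun x => ∑ k, ‖rho x • D₂ l k x‖) 2 halfVol := fun l hl =>
        memLp_finsetSum _ fun k _ => (htan l k (Or.inl hl)).1.norm
      have m3 : MemLp (fun x => 12 * |M| * (∑ k, ‖rho x • D₂ 0 k x‖ + ∑ k, ‖rho x • D₂ 1 k x‖)) 2
          halfVol := ((m4 0 (by decide)).add (m4 1 (by decide))).const_mul _
      have hmF := (m1.add m2).add m3
      have n2 : ∑ k, nrm (D k) ≤ 2 * c * n := by
        refine (hs.energy_le h hα₀ hβ₀ hv hg).trans (le_of_eq ?_)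
        rw [hc]
        ring
      have n4 : ∀ l, l ≠ 2 → nrm (fun x => ∑ k, ‖rho x • D₂ l k x‖) ≤ 3 * (C₁ * n) := fun l hl => by
        refine (nrm_finset_sum_le _ fun k _ => (htan l k (Or.inl hl)).1.norm).trans ?_
        simp only [nrm_norm]
        refine (Finset.sum_le_sum fun k _ => (htan l k (Or.inl hl)).2).trans ?_
        simp
      have hcm : ∀ (b : ℝ), 0 ≤ b → ∀ f : E3 → ℝ, nrm (fun x => b * f x) = b * nrm f := fun b hb f => by
        have := nrm_smul b f
        rwa [abs_of_nonneg hb] at this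
      have hF : nrm (fun x => (3 * ‖rho x • g x‖ + 27 * |K| * ∑ k, ‖D k x‖)
          + 12 * |M| * (∑ k, ‖rho x • D₂ 0 k x‖ + ∑ k, ‖rho x • D₂ 1 k x‖))
          ≤ (3 + 54 * |K| * c + 72 * |M| * C₁) * n := by
        have q1 := nrm_add_le (m1.add m2) m3
        have q2 := nrm_add_le m1 m2
        have q3 := nrm_add_le (m4 0 (by decide)) (m4 1 (by decide))
        simp only [Pi.add_apply] at q1
        change _ ≤ nrm (fun x => 3 * ‖rho x • g x‖ + 27 * |K| * ∑ k, ‖D k x‖) + _ at q1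
        rw [hcm 3 (by norm_num), hcm _ (by positivity), nrm_norm] at q2
        rw [hcm _ (by positivity)] at q1
        have q4 := (nrm_sum_norm_le hv.mem1).trans n2
        have q5 := mul_le_mul_of_nonneg_left q4 (show 0 ≤ 27 * |K| by positivity)
        have q6 := mul_le_mul_of_nonneg_left (q3.trans (add_le_add (n4 0 (by decide))
          (n4 1 (by decide)))) (show 0 ≤ 12 * |M| by positivity)
        refine (q1.trans (add_le_add (q2.trans (add_le_add_right q5 _)) q6)).trans (le_of_eq ?_)
        rw [← hn]
        ring
      have hfin : nrm (fun x => rho x • D₂ 2 2 x) ≤ a⁻¹ * ((3 + 54 * |K| * c + 72 * |M| * C₁) * n) := by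
        refine (nrm_le_mul hmF (inv_nonneg.2 ha0.le) ?_).trans
          (mul_le_mul_of_nonneg_left hF (inv_nonneg.2 ha0.le))
        filter_upwards [hpt] with x hx
        exact hx.trans (mul_le_mul_of_nonneg_left (le_abs_self _) (inv_nonneg.2 ha0.le))
      refine ⟨?_, ?_⟩
      · refine (hmF.const_mul a⁻¹).mono (continuous_rho.aestronglyMeasurable.smul (hm2 2 2).1) ?_
        filter_upwards [hpt] with x hx
        exact hx.trans (le_abs_self _)
      · nlinarith [mul_nonneg hC₁0 hn0]
    · obtain ⟨h1, h2⟩ := htan l k (not_and_or.1 hlk)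
      exact ⟨h1, by nlinarith [mul_nonneg hrest hn0]⟩
  · filter_upwards [hdiv] with x hx
    ext i
    exact (hx i).symm

end FullRegularity

/-! ### Elements of `H²_1` as energy fields with second derivatives. -/

section Jets

lemma isTest_coe {F : Type*} [NormedAddCommGroup F] [NormedSpace ℝ F] {Ω : Opens E3}
    (φ : 𝓓(Ω, F)) : IsTest (φ : E3 → F) := ⟨φ.contDiff, φ.hasCompactSupport⟩

lemma coe_lineDeriv {F : Type*} [NormedAddCommGroup F] [NormedSpace ℝ F] {Ω : Opens E3}
    (φ : 𝓓(Ω, F)) (k : Fin 3) : ⇑(∂_{stdBasis k} φ : 𝓓(Ω, F)) = dd k φ := by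
  ext1 x
  rw [TestFunction.lineDerivOp_eq_lineDerivCLM (𝕜 := ℝ),
    TestFunction.lineDerivCLM_apply_of_le (by simp),
    ((isTest_coe φ).differentiable x).lineDeriv_eq_fderiv]
  rfl

/-- A test function with support in `Ω`, as an element of `𝓓(Ω, F)`. -/
def IsTest.toTestFunction {F : Type*} [NormedAddCommGroup F] [NormedSpace ℝ F] {φ : E3 → F}
    (h : IsTest φ) {Ω : Opens E3} (hs : tsupport φ ⊆ Ω) : 𝓓(Ω, F) := ⟨φ, h.smooth, h.compact, hs⟩

lemma IsTest.coe_toTestFunction {F : Type*} [NormedAddCommGroup F] [NormedSpace ℝ F] {φ : E3 → F}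
    (h : IsTest φ) {Ω : Opens E3} (hs : tsupport φ ⊆ Ω) : ⇑(h.toTestFunction hs) = φ := rfl

lemma coe_testDeriv {Ω : Opens E3} {m : ℕ} (κ : MultiIdx m) (φ : 𝓓(Ω, ℝ)) :
    ⇑(testDeriv κ φ) = (dd 0)^[κ.1 0] ((dd 1)^[κ.1 1] ((dd 2)^[κ.1 2] φ)) := by
  have h : ∀ (k : Fin 3) (n : ℕ) (ψ : 𝓓(Ω, ℝ)),
      ⇑((fun ψ : 𝓓(Ω, ℝ) => (∂_{stdBasis k} ψ : 𝓓(Ω, ℝ)))^[n] ψ) = (dd k)^[n] ψ := by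
    intro k n ψ
    induction n with
    | zero => rfl
    | succ n ih => rw [Function.iterate_succ_apply', Function.iterate_succ_apply', coe_lineDeriv, ih]
  rw [testDeriv, h, h, h]

lemma coe_testDeriv_idx1 {Ω : Opens E3} (k : Fin 3) (φ : 𝓓(Ω, ℝ)) :
    ⇑(testDeriv (idx1 k) φ) = dd k φ := by
  rw [coe_testDeriv]
  fin_cases k <;> rfl

lemma coe_testDeriv_idx2 {Ω : Opens E3} (l k : Fin 3) (φ : 𝓓(Ω, ℝ)) :
    ⇑(testDeriv (idx2 l k) φ) = dd l (dd k φ) := by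
  have hc : ∀ l k, dd l (dd k φ) = dd k (dd l φ) := fun l k =>
    funext fun x => dd_comm (isTest_coe φ).smooth l k x
  rw [coe_testDeriv]
  fin_cases l <;> fin_cases k <;> first | rfl | (rw [hc]; rfl)

lemma len_idx0 (m : ℕ) : (idx0 m).len = 0 := by simp [MultiIdx.len, idx0]

lemma len_idx1 (k : Fin 3) : (idx1 k).len = 1 := by revert k; decide

lemma len_idx2 (l k : Fin 3) : (idx2 l k).len = 2 := by revert l k; decide

lemma multiIdx_two_cases (κ : MultiIdx 2) :
    κ = idx0 2 ∨ (∃ k, κ = idx1 k) ∨ ∃ l k, κ = idx2 l k := by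
  revert κ; decide

lemma wDeriv_idx0 (h : JetL2 2) (x : E3) :
    wDeriv 1 h (idx0 2) x = rho x • (h (idx0 2) : E3 → E3) x := by
  rw [wDeriv, len_idx0, show (-((1 : ℝ) - (2 : ℕ) + (0 : ℕ))) = 1 by norm_num, Real.rpow_one]

lemma wDeriv_idx1 (h : JetL2 2) (k : Fin 3) (x : E3) :
    wDeriv 1 h (idx1 k) x = (h (idx1 k) : E3 → E3) x := by
  rw [wDeriv, len_idx1, show (-((1 : ℝ) - (2 : ℕ) + (1 : ℕ))) = 0 by norm_num, Real.rpow_zero,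
    one_smul]

lemma wDeriv_idx2 (h : JetL2 2) (l k : Fin 3) (x : E3) :
    wDeriv 1 h (idx2 l k) x = (rho x)⁻¹ • (h (idx2 l k) : E3 → E3) x := by
  rw [wDeriv, len_idx2, show (-((1 : ℝ) - (2 : ℕ) + (2 : ℕ))) = -1 by norm_num, Real.rpow_neg_one]

lemma rho_inv_smul_wDeriv (h : JetL2 2) :
    (fun x => (rho x)⁻¹ • wDeriv 1 h (idx0 2) x) = (h (idx0 2) : E3 → E3) := by
  ext1 x
  rw [wDeriv_idx0, smul_smul, inv_mul_cancel₀ (rho_pos x).ne', one_smul]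

lemma grad1_eq (v : weightedSobolev 2 1) (k : Fin 3) :
    grad1 v k = ((v : JetL2 2) (idx1 k) : E3 → E3) := funext fun x => wDeriv_idx1 _ k x

lemma rho_smul_grad2 (v : weightedSobolev 2 1) (l k : Fin 3) :
    (fun x => rho x • grad2 v l k x) = ((v : JetL2 2) (idx2 l k) : E3 → E3) := by
  ext1 x
  rw [grad2, wDeriv_idx2, smul_smul, mul_inv_cancel₀ (rho_pos x).ne', one_smul]

lemma weakD_grad1 (v : weightedSobolev 2 1) (k : Fin 3) :
    WeakD k (wDeriv 1 (v : JetL2 2) (idx0 2)) (grad1 v k) := by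
  intro φ hφ hs
  have h := v.2 (idx1 k) (hφ.toTestFunction hs)
  rw [len_idx1, coe_testDeriv_idx1, pow_one, neg_one_smul] at h
  exact h

/-- The space is defined by comparing each derivative with the field itself; testing the first order
relation with `∂_l φ` converts this into the iterated form. -/
lemma weakD_grad2 (v : weightedSobolev 2 1) (l k : Fin 3) : WeakD l (grad1 v k) (grad2 v l k) := by
  intro φ hφ hs
  have h := v.2 (idx2 l k) (hφ.toTestFunction hs)
  rw [len_idx2, coe_testDeriv_idx2, neg_one_sq, one_smul] at h
  have h1 := weakD_grad1 v k (dd l φ) (hφ.deriv l) ((tsupport_dd_subset φ l).trans hs)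
  simp only [dd_comm hφ.smooth k l] at h1
  rw [IsTest.coe_toTestFunction] at h
  exact neg_eq_iff_eq_neg.1 (h1.symm.trans h)

lemma isEnergy_field (v : weightedSobolev 2 1) :
    IsEnergy (wDeriv 1 (v : JetL2 2) (idx0 2)) (grad1 v) where
  mem0 := by rw [rho_inv_smul_wDeriv]; exact Lp.memLp _
  mem1 k := by rw [grad1_eq]; exact Lp.memLp _
  weak := weakD_grad1 v

lemma memLp_rho_smul_grad2 (v : weightedSobolev 2 1) (l k : Fin 3) :
    MemLp (fun x => rho x • grad2 v l k x) 2 halfVol := by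
  rw [rho_smul_grad2]; exact Lp.memLp _

lemma memLp_grad2 (v : weightedSobolev 2 1) (l k : Fin 3) : MemLp (grad2 v l k) 2 halfVol :=
  memLp_of_memLp_rho_smul (memLp_rho_smul_grad2 v l k)

lemma norm_le_card_mul {m : ℕ} (h : JetL2 m) {c : ℝ} (hc : ∀ κ, ‖h κ‖ ≤ c) :
    ‖h‖ ≤ Fintype.card (MultiIdx m) * c := by
  have h1 : ‖h‖ ≤ ∑ κ, ‖h κ‖ := by
    rw [PiLp.norm_eq_of_L2]
    refine Real.sqrt_le_iff.2 ⟨Finset.sum_nonneg fun _ _ => norm_nonneg _, ?_⟩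
    exact Finset.sum_sq_le_sq_sum_of_nonneg fun _ _ => norm_nonneg _
  refine h1.trans ((Finset.sum_le_sum fun κ _ => hc κ).trans ?_)
  simp

/-- Fields of finite energy with weighted second derivatives belong to `H²_1`. -/
lemma exists_weightedSobolev {v : E3 → E3} {D : Fin 3 → E3 → E3} {D₂ : Fin 3 → Fin 3 → E3 → E3}
    (hv : IsEnergy v D) (hsym : ∀ l k, D₂ l k = D₂ k l) (hW : ∀ l k, WeakD l (D k) (D₂ l k))
    (hm : ∀ l k, MemLp (fun x => rho x • D₂ l k x) 2 halfVol) :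
    ∃ w : weightedSobolev 2 1, wDeriv 1 (w : JetL2 2) (idx0 2) =ᵐ[halfVol] v ∧
      (∀ k, grad1 w k =ᵐ[halfVol] D k) ∧ ∀ l k, grad2 w l k =ᵐ[halfVol] D₂ l k := by
  have hJ : ∀ κ : MultiIdx 2, ∃ j : Lp E3 2 halfVol,
      (κ = idx0 2 → (j : E3 → E3) =ᵐ[halfVol] fun x => (rho x)⁻¹ • v x) ∧
      (∀ k, κ = idx1 k → (j : E3 → E3) =ᵐ[halfVol] D k) ∧
      ∀ l k, κ = idx2 l k → (j : E3 → E3) =ᵐ[halfVol] fun x => rho x • D₂ l k x := by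
    have n01 : ∀ k, idx0 2 ≠ idx1 k := by decide
    have n02 : ∀ l k, idx0 2 ≠ idx2 l k := by decide
    have n12 : ∀ i l k, idx1 i ≠ idx2 l k := by decide
    have i1 : ∀ k k', idx1 k = idx1 k' → k = k' := by decide
    -- `idx2 l k` and `idx2 k l` are the same multi-index, so the jet has one entry for both; this
    -- is where the symmetry of `D₂` is needed.
    have i2 : ∀ l k l' k', idx2 l k = idx2 l' k' → (l = l' ∧ k = k') ∨ (l = k' ∧ k = l') := by
      decide
    intro κ
    rcases multiIdx_two_cases κ with rfl | ⟨k, rfl⟩ | ⟨l, k, rfl⟩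
    · exact ⟨hv.mem0.toLp, fun _ => hv.mem0.coeFn_toLp, fun k h => (n01 k h).elim,
        fun l k h => (n02 l k h).elim⟩
    · refine ⟨(hv.mem1 k).toLp, fun h => (n01 k h.symm).elim, fun k' h => ?_,
        fun i l h => (n12 k i l h).elim⟩
      rw [← i1 k k' h]
      exact (hv.mem1 k).coeFn_toLp
    · refine ⟨(hm l k).toLp, fun h => (n02 l k h.symm).elim, fun i h => (n12 i l k h.symm).elim,
        fun l' k' h => ?_⟩
      rcases i2 l k l' k' h with ⟨rfl, rfl⟩ | ⟨rfl, rfl⟩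
      · exact (hm l k).coeFn_toLp
      · exact (hm l k).coeFn_toLp.trans (Eventually.of_forall fun x => by simp only [hsym l k])
  choose J hJ0 hJ1 hJ2 using hJ
  let w : JetL2 2 := WithLp.toLp 2 J
  have e0 : wDeriv 1 w (idx0 2) =ᵐ[halfVol] v := by
    filter_upwards [hJ0 _ rfl] with x hx
    rw [wDeriv_idx0]
    simp only [w, hx]
    rw [smul_smul, mul_inv_cancel₀ (rho_pos x).ne', one_smul]
  have e1 : ∀ k, wDeriv 1 w (idx1 k) =ᵐ[halfVol] D k := fun k => by
    filter_upwards [hJ1 _ k rfl] with x hx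
    rw [wDeriv_idx1]
    exact hx
  have e2 : ∀ l k, wDeriv 1 w (idx2 l k) =ᵐ[halfVol] D₂ l k := fun l k => by
    filter_upwards [hJ2 _ l k rfl] with x hx
    rw [wDeriv_idx2]
    simp only [w, hx]
    rw [smul_smul, inv_mul_cancel₀ (rho_pos x).ne', one_smul]
  have hcongr : ∀ (φ : E3 → ℝ) {f g : E3 → E3}, f =ᵐ[halfVol] g →
      ∫ x, φ x • f x ∂halfVol = ∫ x, φ x • g x ∂halfVol := fun φ f g hfg =>
    integral_congr_ae (hfg.mono fun x hx => by simp only [hx])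
  refine ⟨⟨w, fun κ φ => ?_⟩, e0, e1, e2⟩
  have hφ := isTest_coe φ
  have hs : tsupport φ ⊆ lowerHalf := φ.tsupport_subset
  rcases multiIdx_two_cases κ with rfl | ⟨k, rfl⟩ | ⟨l, k, rfl⟩
  · rw [len_idx0, pow_zero, one_smul]
    rfl
  · rw [len_idx1, coe_testDeriv_idx1, hcongr _ e0, hcongr _ (e1 k), hv.weak k φ hφ hs, pow_one,
      neg_one_smul]
  · rw [len_idx2, coe_testDeriv_idx2, hcongr _ e0, hcongr _ (e2 l k), neg_one_sq, one_smul,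
      ← neg_neg (∫ x, φ x • D₂ l k x ∂halfVol), ← hW l k φ hφ hs,
      ← hv.weak k (dd l φ) (hφ.deriv l) ((tsupport_dd_subset _ l).trans hs)]
    simp only [dd_comm hφ.smooth k l]

end Jets

/-! ### Zero traction and Green's formula. -/

section Traction

variable {M K α₀ β₀ : ℝ} {lam mu : E3 → ℝ}

lemma divStress_congr {D D' : Fin 3 → E3 → E3} {D₂ D₂' : Fin 3 → Fin 3 → E3 → E3} {x : E3}
    (h : ∀ k, D k x = D' k x) (h₂ : ∀ l k, D₂ l k x = D₂' l k x) :
    divStress lam mu D D₂ x = divStress lam mu D' D₂' x := by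
  simp only [divStress, dStress, stress, strain, h, h₂]

lemma memLp_rho_smul_divStress (h : IsLameMedium M K α₀ β₀ lam mu) {D : Fin 3 → E3 → E3}
    {D₂ : Fin 3 → Fin 3 → E3 → E3} (hD : ∀ k, MemLp (D k) 2 halfVol)
    (hD₂ : ∀ l k, MemLp (fun x => rho x • D₂ l k x) 2 halfVol) :
    MemLp (fun x => rho x • divStress lam mu D D₂ x) 2 halfVol := by
  obtain ⟨hl, hm, hp⟩ := h.coeffs
  have hb : ∀ l, IsBddCoeff (fun x => rho x * pd l lam x) ∧ IsBddCoeff fun x => rho x * pd l mu x := by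
    intro l
    have key : ∀ x, ∀ p : ℝ, |p| ≤ |K| * (rho x)⁻¹ → ‖rho x * p‖ ≤ |K| := by
      intro x p hp
      rw [Real.norm_eq_abs, abs_mul, abs_of_pos (rho_pos x)]
      refine (mul_le_mul_of_nonneg_left hp (rho_pos x).le).trans (le_of_eq ?_)
      rw [mul_left_comm, mul_inv_cancel₀ (rho_pos x).ne', mul_one]
    refine ⟨⟨continuous_rho.aestronglyMeasurable.mul (hp l).1.1, |K|, ?_⟩,
      ⟨continuous_rho.aestronglyMeasurable.mul (hp l).2.1, |K|, ?_⟩⟩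
    · filter_upwards [h.ae_abs_pd_le] with x hx using key x _ (hx l).1
    · filter_upwards [h.ae_abs_pd_le] with x hx using key x _ (hx l).2
  refine MemLp.of_eval_piLp fun i => ?_
  refine (memLp_finsetSum Finset.univ fun j _ => (memLp_stress (hb j).1 (hb j).2 hD i j).add
    (memLp_stress hl hm (hD₂ j) i j)).ae_eq (Eventually.of_forall fun x => ?_)
  simp only [divStress, dStress, stress, strain, PiLp.smul_apply, smul_eq_mul, Finset.mul_sum,
    Pi.add_apply]
  refine Finset.sum_congr rfl fun j _ => ?_
  simp only [Fin.sum_univ_three]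
  split_ifs <;> ring

/-- A Gauss formula without boundary term, for test functions that are free on the boundary, is what
zero trace means. -/
lemma HasWeak.hasTrace {w dw : E3 → ℝ} (h : HasWeak univ 2 w dw) : HasTrace w dw fun _ => 0 := by
  intro φ
  have hφ := isTest_coe φ
  simp only [coe_lineDeriv, mul_zero, integral_zero]
  rw [integral_add ((hφ.deriv 2).memLp.integrable_mul_half h.memLp)
    (hφ.memLp.integrable_mul_half h.memLp'), h.gauss φ hφ (subset_univ _), neg_add_cancel]

lemma hasWeak_univ_of_hasTrace {w dw : E3 → ℝ} (hw : MemLp w 2 halfVol) (hdw : MemLp dw 2 halfVol)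
    (h : HasTrace w dw fun _ => 0) : HasWeak univ 2 w dw := by
  refine ⟨hw, hdw, fun φ hφ _ => ?_⟩
  have e := h (hφ.toTestFunction (Ω := ⊤) (subset_univ _))
  simp only [coe_lineDeriv, mul_zero, integral_zero, IsTest.coe_toTestFunction] at e
  rw [integral_add ((hφ.deriv 2).memLp.integrable_mul_half hw) (hφ.memLp.integrable_mul_half hdw)]
    at e
  linarith

/-- The normal stress of a weak solution has zero trace. -/
lemma IsWeakSol.hasWeak_univ (h : IsLameMedium M K α₀ β₀ lam mu) {D : Fin 3 → E3 → E3}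
    {D₂ : Fin 3 → Fin 3 → E3 → E3} {g : E3 → E3} (hs : IsWeakSol lam mu D g)
    (hg : MemLp g 2 halfVol) (hD : ∀ k, MemLp (D k) 2 halfVol)
    (hD₂ : ∀ l k, MemLp (D₂ l k) 2 halfVol) (hW : ∀ l k, WeakD l (D k) (D₂ l k))
    (hdiv : ∀ᵐ x ∂halfVol, divStress lam mu D D₂ x = g x) (i : Fin 3) :
    HasWeak univ 2 (stress lam mu D i 2) (dStress lam mu D D₂ 2 i 2) := by
  -- Tangential derivatives of `D` can be tested up to the boundary, so `S = univ` is allowed; the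
  -- equation then identifies the result with the derivative from the product rule.
  refine (hs.hasWeak_stress h hg hD isOpen_univ (T := D₂) (fun k hk l i =>
    HasWeak.univ_of_tangential hk (D := fun m x => D₂ m l x i)
      fun m => (hW m l).coord (hD l) (hD₂ m l) i) i).congr (ae_eq_refl _) ?_
  filter_upwards [hdiv] with x hx
  rw [← hx]
  simp only [divStress, Fin.sum_univ_three]
  ring

lemma IsTest.dd_apply {φ : E3 → E3} (h : IsTest φ) (k i : Fin 3) (x : E3) :
    dd k (fun x => φ x i) x = dd k φ x i := by
  have := ((EuclideanSpace.proj (𝕜 := ℝ) i).hasFDerivAt.comp x (h.differentiable x).hasFDerivAt).fderiv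
  exact congrArg (fun L : E3 →L[ℝ] ℝ => L (stdBasis k)) this

lemma IsTest.weakD_vec {φ : E3 → E3} (h : IsTest φ) (k : Fin 3) : WeakD k φ (dd k φ) := by
  refine weakD_of_coord fun i => ⟨(h.coord i).memLp, ((h.deriv k).coord i).memLp, fun θ hθ hs => ?_⟩
  simp only [← h.dd_apply]
  exact (h.coord i).weakD k θ hθ hs

/-- Green's formula: a regular field with zero traction is a weak solution. -/
lemma isWeakSol_of_hasWeak_univ (h : IsLameMedium M K α₀ β₀ lam mu) {D : Fin 3 → E3 → E3}
    {D₂ : Fin 3 → Fin 3 → E3 → E3} (hD : ∀ k, MemLp (D k) 2 halfVol)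
    (hD₂ : ∀ l k, MemLp (fun x => rho x • D₂ l k x) 2 halfVol)
    (hW : ∀ l k, WeakD l (D k) (D₂ l k))
    (ht : ∀ i, HasWeak univ 2 (stress lam mu D i 2) (dStress lam mu D D₂ 2 i 2)) :
    IsWeakSol lam mu D (divStress lam mu D D₂) := by
  obtain ⟨hl, hm, -⟩ := h.coeffs
  set g := divStress lam mu D D₂ with hgdef
  have hgρ : MemLp (fun x => rho x • g x) 2 halfVol := memLp_rho_smul_divStress h hD hD₂
  have hD₂' : ∀ l k, MemLp (D₂ l k) 2 halfVol := fun l k => memLp_of_memLp_rho_smul (hD₂ l k)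
  -- The tangential columns never have a boundary term; the normal column has none by the traction
  -- hypothesis.
  have hU : ∀ i j, HasWeak univ j (stress lam mu D i j) (dStress lam mu D D₂ j i j) := by
    intro i j
    by_cases hj : j = 2
    · subst hj; exact ht i
    · exact HasWeak.stress h isOpen_univ (fun l i => HasWeak.univ_of_tangential hj
        (D := fun m x => D₂ m l x i) fun m => (hW m l).coord (hD l) (hD₂' m l) i) i j
  have htest : ∀ φ : E3 → E3, IsTest φ →
      ∫ x, form lam mu D (fun k => dd k φ) x ∂halfVol = -∫ x, inner ℝ (g x) (φ x) ∂halfVol := by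
    intro φ hφ
    have e1 : ∀ x, form lam mu D (fun k => dd k φ) x
        = ∑ i, ∑ j, dd j (fun x => φ x i) x * stress lam mu D i j x := fun x => by
      simp only [form, hφ.dd_apply, mul_comm]
    have e2 : ∀ x, inner ℝ (g x) (φ x) = ∑ i, ∑ j, φ x i * dStress lam mu D D₂ j i j x := fun x => by
      simp only [hgdef, divStress, PiLp.inner_apply, ← Finset.mul_sum]
      simp
    have i1 : ∀ i j, Integrable (fun x => dd j (fun x => φ x i) x * stress lam mu D i j x) halfVol :=
      fun i j => ((hφ.coord i).deriv j).memLp.integrable_mul_half (hU i j).memLp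
    have i2 : ∀ i j, Integrable (fun x => φ x i * dStress lam mu D D₂ j i j x) halfVol :=
      fun i j => (hφ.coord i).memLp.integrable_mul_half (hU i j).memLp'
    simp only [e1, e2]
    rw [integral_finsetSum _ fun i _ => integrable_finsetSum _ fun j _ => i1 i j,
      integral_finsetSum _ fun i _ => integrable_finsetSum _ fun j _ => i2 i j,
      ← Finset.sum_neg_distrib]
    refine Finset.sum_congr rfl fun i _ => ?_
    rw [integral_finsetSum _ fun j _ => i1 i j, integral_finsetSum _ fun j _ => i2 i j,
      ← Finset.sum_neg_distrib]
    exact Finset.sum_congr rfl fun j _ => (hU i j).gauss _ (hφ.coord i) (subset_univ _)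
  intro u E hu
  rw [← sub_eq_zero, sub_neg_eq_add, ← abs_nonpos_iff]
  -- Green's formula passes from test fields to finite energy by density; `27 = 9 · 3` accounts for
  -- the form bound and the errors of three gradient components.
  set A := 27 * |M| * (∑ k, nrm (D k)) + nrm fun x => rho x • g x with hA
  have hS0 : 0 ≤ ∑ k, nrm (D k) := Finset.sum_nonneg fun k _ => nrm_nonneg _
  have hA0 : 0 ≤ A := add_nonneg (by positivity) (nrm_nonneg _)
  refine le_of_forall_pos_le_add fun ε hε => ?_
  obtain ⟨φ, hφ, h1, h2⟩ := hu.exists_near (ε := ε / (A + 1)) (by positivity)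
  have hφE := (hφ.isEnergy hφ.weakD_vec).sub hu
  have e1 : ∫ x, form lam mu D (fun k => dd k φ) x ∂halfVol = ∫ x, form lam mu D E x ∂halfVol
      + ∫ x, form lam mu D (fun k x => dd k φ x - E k x) x ∂halfVol := by
    rw [← integral_add (integrable_form hl hm hD hu.mem1) (integrable_form hl hm hD hφE.mem1)]
    refine integral_congr_ae (Eventually.of_forall fun x => ?_)
    simp only [← form_add_right]
    exact form_congr (fun _ => rfl) fun k => by simp only [add_sub_cancel]
  have e2 : ∫ x, inner ℝ (g x) (φ x) ∂halfVol = ∫ x, inner ℝ (g x) (u x) ∂halfVol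
      + ∫ x, inner ℝ (g x) (φ x - u x) ∂halfVol := by
    have i1 := integrable_inner hgρ hu.mem0
    have i2 := integrable_inner hgρ hφE.mem0
    replace i2 := i2.congr (Eventually.of_forall fun x => (inner_eq_inner_rho g
      (fun x => φ x - u x) x).symm)
    simp only [← inner_eq_inner_rho] at i1
    rw [← integral_add i1 i2]
    refine integral_congr_ae (Eventually.of_forall fun x => ?_)
    simp only [← inner_add_right, add_sub_cancel]
  have b1 := h.abs_integral_form_le hD hφE.mem1
  have b2 := abs_integral_inner_le hgρ hφE.mem0
  have b3 : ∑ k, nrm (fun x => dd k φ x - E k x) ≤ 3 * (ε / (A + 1)) := by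
    refine (Finset.sum_le_sum fun k _ => h2 k).trans (by simp)
  have b4 := mul_le_mul_of_nonneg_left b3 hS0
  have b5 := mul_le_mul_of_nonneg_left h1 (nrm_nonneg fun x => rho x • g x)
  have b6 := mul_le_mul_of_nonneg_left b4 (show 0 ≤ 9 * |M| by positivity)
  have b7 : A * (ε / (A + 1)) ≤ ε := by
    rw [mul_div_assoc', div_le_iff₀ (by positivity)]
    nlinarith
  have e3 := htest φ hφ
  rw [e1, e2] at e3
  have e4 : ∫ x, form lam mu D E x ∂halfVol + ∫ x, inner ℝ (g x) (u x) ∂halfVol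
      = -(∫ x, form lam mu D (fun k x => dd k φ x - E k x) x ∂halfVol)
        + -∫ x, inner ℝ (g x) (φ x - u x) ∂halfVol := by linarith
  rw [e4, zero_add]
  refine (abs_add_le _ _).trans ?_
  rw [abs_neg, abs_neg]
  have e5 : A * (ε / (A + 1)) = 9 * |M| * ((∑ k, nrm (D k)) * (3 * (ε / (A + 1))))
      + nrm (fun x => rho x • g x) * (ε / (A + 1)) := by rw [hA]; ring
  linarith

end Traction

/-! ### The weighted Lamé operator: a priori estimate and range. -/

section LameOperator

variable {M K α₀ β₀ : ℝ} {lam mu : E3 → ℝ}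

lemma memLp_rho_smul_lameOp (h : IsLameMedium M K α₀ β₀ lam mu) (v : weightedSobolev 2 1) :
    MemLp (fun x => rho x • lameOp lam mu v x) 2 halfVol :=
  memLp_rho_smul_divStress h (isEnergy_field v).mem1 (memLp_rho_smul_grad2 v)

/-- Traction-free elements of `H²_1` are weak solutions. -/
lemma IsTractionFree.isWeakSol (h : IsLameMedium M K α₀ β₀ lam mu) {v : weightedSobolev 2 1}
    (hv : IsTractionFree lam mu v) : IsWeakSol lam mu (grad1 v) (lameOp lam mu v) := by
  obtain ⟨hl, hm, hp⟩ := h.coeffs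
  have hD := (isEnergy_field v).mem1
  exact isWeakSol_of_hasWeak_univ h hD (memLp_rho_smul_grad2 v) (weakD_grad2 v) fun i =>
    hasWeak_univ_of_hasTrace (memLp_stress hl hm hD i 2)
      ((memLp_stress (hp 2).1 (hp 2).2 hD i 2).add (memLp_stress hl hm (memLp_grad2 v 2) i 2)) (hv i)

/-- The a priori estimate in `H²_1`. -/
theorem exists_norm_le_lameOp (M K : ℝ) {α₀ β₀ : ℝ} (hα₀ : 0 < α₀) (hβ₀ : 0 < β₀) :
    ∃ C : ℝ, 0 ≤ C ∧ ∀ {lam mu : E3 → ℝ}, IsLameMedium M K α₀ β₀ lam mu →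
      ∀ v : weightedSobolev 2 1, IsTractionFree lam mu v →
        ‖v‖ ≤ C * nrm fun x => rho x • lameOp lam mu v x := by
  obtain ⟨C₁, hC₁, hreg⟩ := exists_second_derivatives M K hα₀ hβ₀
  set c := 52488 / min (2 * α₀) β₀ with hc
  have hmin := lt_min (show 0 < 2 * α₀ by linarith) hβ₀
  have hc0 : 0 ≤ c := by positivity
  refine ⟨Fintype.card (MultiIdx 2) * (2 * c + C₁), by positivity, fun {lam mu} h v hv => ?_⟩
  have hs := hv.isWeakSol h
  have hE := isEnergy_field v
  have hg := memLp_rho_smul_lameOp h v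
  obtain ⟨D₂, -, hW, hD₂, -⟩ := hreg h hE hs hg
  set n := nrm fun x => rho x • lameOp lam mu v x with hn
  have hn0 : 0 ≤ n := nrm_nonneg _
  have hcn : 0 ≤ c * n := by positivity
  have hC₁n : 0 ≤ C₁ * n := by positivity
  have hen : ∑ k, nrm (grad1 v k) ≤ c * n := hs.energy_le h hα₀ hβ₀ hE hg
  -- The estimated second derivatives come from the regularity theorem; uniqueness identifies them
  -- with those stored in `v`.
  have h2 : ∀ l k, grad2 v l k =ᵐ[halfVol] D₂ l k := by
    intro l k
    have : ∀ᵐ x ∂halfVol, ∀ i, grad2 v l k x i = D₂ l k x i := ae_all_iff.2 fun i =>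
      ((weakD_grad2 v l k).coord (hE.mem1 k) (memLp_grad2 v l k) i).unique
        ((hW l k).coord (hE.mem1 k) (memLp_of_memLp_rho_smul (hD₂ l k).1) i)
    exact this.mono fun x hx => by ext i; exact hx i
  rw [mul_assoc]
  refine norm_le_card_mul (v : JetL2 2) fun κ => ?_
  rw [← nrm_eq_norm]
  rcases multiIdx_two_cases κ with rfl | ⟨k, rfl⟩ | ⟨l, k, rfl⟩
  · rw [← rho_inv_smul_wDeriv]
    have := hE.hardy
    linarith
  · rw [← grad1_eq]
    have := Finset.single_le_sum (fun k _ => nrm_nonneg (grad1 v k)) (Finset.mem_univ k)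
    linarith
  · rw [← rho_smul_grad2, nrm_congr ((h2 l k).mono fun x hx => by
      show rho x • grad2 v l k x = rho x • D₂ l k x
      rw [hx])]
    have := (hD₂ l k).2
    linarith

/-- The Lamé operator maps the traction-free space onto the fields `g` with `ϱ g ∈ L²`. -/
theorem exists_lameOp_eq (h : IsLameMedium M K α₀ β₀ lam mu) (hα₀ : 0 < α₀) (hβ₀ : 0 < β₀)
    {g : E3 → E3} (hg : MemLp (fun x => rho x • g x) 2 halfVol) :
    ∃ v : tractionFree h, lameOp lam mu (v : weightedSobolev 2 1) =ᵐ[halfVol] g := by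
  obtain ⟨C, -, hreg⟩ := exists_second_derivatives M K hα₀ hβ₀
  obtain ⟨u, D, hu, hs⟩ := exists_isWeakSol h hα₀ hβ₀ hg
  obtain ⟨D₂, hsym, hW, hD₂, hdiv⟩ := hreg h hu hs hg
  obtain ⟨v, -, hv1, hv2⟩ := exists_weightedSobolev hu hsym hW fun l k => (hD₂ l k).1
  have hv1' := ae_all_iff.2 hv1
  have hv2' := ae_all_iff.2 fun l => ae_all_iff.2 (hv2 l)
  refine ⟨⟨v, fun i => ?_⟩, ?_⟩
  · refine ((hs.hasWeak_univ h (memLp_of_memLp_rho_smul hg) hu.mem1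
      (fun l k => memLp_of_memLp_rho_smul (hD₂ l k).1) hW hdiv i).congr ?_ ?_).hasTrace
    · filter_upwards [hv1'] with x hx
      simp only [stress, strain, hx]
    · filter_upwards [hv1', hv2'] with x hx hx2
      simp only [dStress, stress, strain, hx, hx2]
  · filter_upwards [hdiv, hv1', hv2'] with x hx hx1 hx2
    rw [← hx]
    exact divStress_congr hx1 hx2

/-- Test fields with support in the open half space are traction-free elements of `H²_1`. -/
theorem exists_tractionFree_eq_test (h : IsLameMedium M K α₀ β₀ lam mu) (φ : 𝓓(lowerHalf, E3)) :
    ∃ v : tractionFree h, wDeriv 1 (v : JetL2 2) (idx0 2) =ᵐ[halfVol] φ ∧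
      lameOp lam mu (v : weightedSobolev 2 1) =ᵐ[halfVol] lameOpTest lam mu φ := by
  have hφ := isTest_coe φ
  have hs : tsupport φ ⊆ lowerHalf := φ.tsupport_subset
  obtain ⟨v, hv0, hv1, hv2⟩ := exists_weightedSobolev (D₂ := fun l k => dd l (dd k φ))
    (hφ.isEnergy hφ.weakD_vec) (fun l k => funext fun x => dd_comm hφ.smooth l k x)
    (fun l k => (hφ.deriv k).weakD_vec l)
    fun l k => (IsTest.smul contDiff_rho ((hφ.deriv k).deriv l)).memLp
  have hv1' := ae_all_iff.2 hv1
  have hv2' := ae_all_iff.2 fun l => ae_all_iff.2 (hv2 l)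
  -- `dd l φ` is compactly supported in the open half space, so `φ` and `θ` exchange roles and `θ`
  -- needs no support condition.
  have hU : ∀ l i, HasWeak univ 2 (fun x => dd l φ x i) fun x => dd 2 (dd l φ) x i := by
    intro l i
    have hl := (hφ.deriv l).coord i
    refine ⟨hl.memLp, (((hφ.deriv l).deriv 2).coord i).memLp, fun θ hθ _ => ?_⟩
    have hsl : tsupport (fun x => dd l φ x i) ⊆ lowerHalf := by
      refine (closure_mono fun x hx => ?_).trans ((tsupport_dd_subset φ l).trans hs)
      exact fun h0 => hx (by show dd l φ x i = 0; rw [h0]; rfl)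
    have e := hθ.weakD 2 _ hl hsl
    simp only [smul_eq_mul, (hφ.deriv l).dd_apply] at e
    rw [eq_neg_iff_add_eq_zero, add_comm, ← eq_neg_iff_add_eq_zero] at e
    simpa only [mul_comm] using e
  refine ⟨⟨v, fun i => ?_⟩, hv0, ?_⟩
  · refine ((HasWeak.stress h isOpen_univ hU i 2).congr ?_ ?_).hasTrace
    · filter_upwards [hv1'] with x hx
      simp only [stress, strain, hx]
    · filter_upwards [hv1', hv2'] with x hx hx2
      simp only [dStress, stress, strain, hx, hx2]
  · filter_upwards [hv1', hv2'] with x hx1 hx2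
    simp only [lameOpTest, coe_lineDeriv]
    exact divStress_congr hx1 hx2

lemma divStress_add {D D' D'' : Fin 3 → E3 → E3} {D₂ D₂' D₂'' : Fin 3 → Fin 3 → E3 → E3} {x : E3}
    (h : ∀ k, D'' k x = D k x + D' k x) (h₂ : ∀ l k, D₂'' l k x = D₂ l k x + D₂' l k x) :
    divStress lam mu D'' D₂'' x = divStress lam mu D D₂ x + divStress lam mu D' D₂' x := by
  ext i
  simp only [divStress, PiLp.add_apply, ← Finset.sum_add_distrib, dStress]
  refine Finset.sum_congr rfl fun j _ => ?_
  rw [stress_add _ _ _ _ _ i j x h, stress_add _ _ _ _ _ i j x (h₂ j)]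
  ring

lemma divStress_smul {c : ℝ} {D D' : Fin 3 → E3 → E3} {D₂ D₂' : Fin 3 → Fin 3 → E3 → E3} {x : E3}
    (h : ∀ k, D' k x = c • D k x) (h₂ : ∀ l k, D₂' l k x = c • D₂ l k x) :
    divStress lam mu D' D₂' x = c • divStress lam mu D D₂ x := by
  ext i
  simp only [divStress, PiLp.smul_apply, smul_eq_mul, Finset.mul_sum, dStress]
  refine Finset.sum_congr rfl fun j _ => ?_
  rw [stress_smul _ _ _ _ _ i j x h, stress_smul _ _ _ _ _ i j x (h₂ j)]
  ring

/-- The weighted Lamé operator `v ↦ ϱ div (ℂ ∇̂v)` from the traction-free space to `L²`. -/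
def weightedLameOp (h : IsLameMedium M K α₀ β₀ lam mu) : tractionFree h →ₗ[ℝ] Lp E3 2 halfVol where
  toFun v := (memLp_rho_smul_lameOp h v).toLp
  map_add' a b := by
    rw [← MemLp.toLp_add, MemLp.toLp_eq_toLp_iff]
    have h1 : ∀ᵐ x ∂halfVol, ∀ k, grad1 ((a + b : tractionFree h) : weightedSobolev 2 1) k x
        = grad1 (a : weightedSobolev 2 1) k x + grad1 (b : weightedSobolev 2 1) k x :=
      ae_all_iff.2 fun k => wDeriv_add 1 (a : JetL2 2) (b : JetL2 2) (idx1 k)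
    have h2 : ∀ᵐ x ∂halfVol, ∀ l k, grad2 ((a + b : tractionFree h) : weightedSobolev 2 1) l k x
        = grad2 (a : weightedSobolev 2 1) l k x + grad2 (b : weightedSobolev 2 1) l k x :=
      ae_all_iff.2 fun l => ae_all_iff.2 fun k =>
        wDeriv_add 1 (a : JetL2 2) (b : JetL2 2) (idx2 l k)
    filter_upwards [h1, h2] with x hx1 hx2
    simp only [Pi.add_apply, lameOp]
    rw [divStress_add hx1 hx2, smul_add]
  map_smul' c a := by
    rw [RingHom.id_apply, ← MemLp.toLp_const_smul, MemLp.toLp_eq_toLp_iff]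
    have h1 : ∀ᵐ x ∂halfVol, ∀ k, grad1 ((c • a : tractionFree h) : weightedSobolev 2 1) k x
        = c • grad1 (a : weightedSobolev 2 1) k x :=
      ae_all_iff.2 fun k => wDeriv_smul 1 c (a : JetL2 2) (idx1 k)
    have h2 : ∀ᵐ x ∂halfVol, ∀ l k, grad2 ((c • a : tractionFree h) : weightedSobolev 2 1) l k x
        = c • grad2 (a : weightedSobolev 2 1) l k x :=
      ae_all_iff.2 fun l => ae_all_iff.2 fun k => wDeriv_smul 1 c (a : JetL2 2) (idx2 l k)
    filter_upwards [h1, h2] with x hx1 hx2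
    simp only [Pi.smul_apply, lameOp]
    rw [divStress_smul hx1 hx2, smul_comm]

lemma weightedLameOp_coe (h : IsLameMedium M K α₀ β₀ lam mu) (v : tractionFree h) :
    (weightedLameOp h v : E3 → E3) =ᵐ[halfVol] fun x => rho x • lameOp lam mu v x :=
  (memLp_rho_smul_lameOp h v).coeFn_toLp

lemma norm_weightedLameOp (h : IsLameMedium M K α₀ β₀ lam mu) (v : tractionFree h) :
    ‖weightedLameOp h v‖ = nrm fun x => rho x • lameOp lam mu v x := by
  rw [← nrm_eq_norm, nrm_congr (weightedLameOp_coe h v)]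

/-- Given `y ∈ L²`, solve with right-hand side `ϱ⁻¹ y`. This is what makes very weak solutions
unique. -/
lemma weightedLameOp_surjective (h : IsLameMedium M K α₀ β₀ lam mu) (hα₀ : 0 < α₀) (hβ₀ : 0 < β₀) :
    Function.Surjective (weightedLameOp h) := by
  intro y
  have e : ∀ x, rho x • ((rho x)⁻¹ • (y : E3 → E3) x) = (y : E3 → E3) x := fun x => by
    rw [smul_smul, mul_inv_cancel₀ (rho_pos x).ne', one_smul]
  obtain ⟨v, hv⟩ := exists_lameOp_eq h hα₀ hβ₀ (g := fun x => (rho x)⁻¹ • (y : E3 → E3) x)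
    (by simp only [e]; exact Lp.memLp y)
  refine ⟨v, Lp.ext ?_⟩
  filter_upwards [weightedLameOp_coe h v, hv] with x h1 h2
  rw [h1, h2, e]

instance : Unique (MultiIdx 0) where
  default := idx0 0
  uniq _ := Subtype.ext (funext fun _ => Subsingleton.elim (α := Fin 1) _ _)

/-- `H⁰_{-1}` is isometric to `L²` through multiplication by `ϱ⁻¹`. -/
lemma exists_weightedSobolev_zero (y : Lp E3 2 halfVol) :
    ∃ u : weightedSobolev 0 (-1), (u : JetL2 0) (idx0 0) = y ∧ ‖u‖ = ‖y‖ := by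
  refine ⟨⟨WithLp.toLp 2 fun _ => y, fun κ φ => ?_⟩, rfl, ?_⟩
  · obtain rfl : κ = idx0 0 := Unique.uniq _ κ
    rw [len_idx0, pow_zero, one_smul]
    rfl
  · change ‖(WithLp.toLp 2 fun _ => y : JetL2 0)‖ = ‖y‖
    rw [PiLp.norm_eq_of_L2]
    simp

lemma weightedSobolev_zero_ext {u u' : weightedSobolev 0 (-1)}
    (h : (u : JetL2 0) (idx0 0) = (u' : JetL2 0) (idx0 0)) : u = u' := by
  refine Subtype.ext (PiLp.ext fun κ => ?_)
  obtain rfl : κ = idx0 0 := Unique.uniq _ κ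
  exact h

/-- The field of `u` is `ϱ` times its jet entry, and the factor `ϱ` is moved to the Lamé operator.
-/
lemma pairing_lameOp (h : IsLameMedium M K α₀ β₀ lam mu) (u : weightedSobolev 0 (-1))
    (v : tractionFree h) :
    pairing u (lameOp lam mu v) = inner ℝ ((u : JetL2 0) (idx0 0)) (weightedLameOp h v) := by
  rw [L2.inner_def, pairing]
  refine integral_congr_ae ?_
  filter_upwards [weightedLameOp_coe h v] with x hx
  rw [hx, wDeriv, len_idx0, show (-((-1 : ℝ) - (0 : ℕ) + (0 : ℕ))) = 1 by norm_num, Real.rpow_one,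
    inner_smul_left, inner_smul_right]
  rfl

lemma abs_dual_apply_le {V : Type*} [NormedAddCommGroup V] [NormedSpace ℝ V] (W : Submodule ℝ V)
    (f : StrongDual ℝ W) (v : W) : |f v| ≤ ‖f‖ * ‖v‖ := f.le_opNorm v

end LameOperator

end HalfSpaceElasticity

end

/-! ### The theorem, by transposition. -/

theorem mainTheorem7 (M K α₀ β₀ : ℝ) (hα₀ : 0 < α₀) (hβ₀ : 0 < β₀) :
    ∃ C : ℝ, 0 < C ∧ ∀ (lam mu : HalfSpaceElasticity.E3 → ℝ)
      (h : HalfSpaceElasticity.IsLameMedium M K α₀ β₀ lam mu)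
      (f : StrongDual ℝ (HalfSpaceElasticity.tractionFree h)),
      ∃ u : HalfSpaceElasticity.weightedSobolev 0 (-1),
        HalfSpaceElasticity.IsVeryWeakSolution h f u ∧ ‖u‖ ≤ C * ‖f‖ ∧
        ∀ u' : HalfSpaceElasticity.weightedSobolev 0 (-1),
          HalfSpaceElasticity.IsVeryWeakSolution h f u' → u' = u := by
  obtain ⟨C, hC, hest⟩ := HalfSpaceElasticity.exists_norm_le_lameOp M K hα₀ hβ₀
  -- The a priori constant is only known to be nonnegative; adding `1` makes it positive.
  refine ⟨C + 1, by positivity, fun lam mu h f => ?_⟩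
  -- By the a priori estimate `|f v| ≤ ‖f‖ ‖v‖ ≤ C ‖f‖ ‖A v‖`, so `f` is represented through the
  -- weighted Lamé operator `A`.
  obtain ⟨y, hy, hf⟩ := HalfSpaceElasticity.exists_riesz (HalfSpaceElasticity.weightedLameOp h)
    (f : HalfSpaceElasticity.tractionFree h →ₗ[ℝ] ℝ) (C := C * ‖f‖) (by positivity) fun v => by
      rw [HalfSpaceElasticity.norm_weightedLameOp, mul_comm C, mul_assoc]
      exact (HalfSpaceElasticity.abs_dual_apply_le _ f v).trans
        (mul_le_mul_of_nonneg_left (hest h _ v.2) (norm_nonneg f))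
  obtain ⟨u, hu, hnu⟩ := HalfSpaceElasticity.exists_weightedSobolev_zero y
  have hpair : ∀ v : HalfSpaceElasticity.tractionFree h,
      HalfSpaceElasticity.pairing u (HalfSpaceElasticity.lameOp lam mu v) = f v := fun v => by
    rw [HalfSpaceElasticity.pairing_lameOp h, hu]
    exact (hf v).symm
  refine ⟨u, ⟨fun φ => ?_, fun v => sub_eq_zero.2 (hpair v).symm⟩, ?_, fun u' hu' => ?_⟩
  · obtain ⟨v, hv, hL⟩ := HalfSpaceElasticity.exists_tractionFree_eq_test h φ
    refine ⟨v, hv, ?_⟩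
    rw [← hpair v]
    refine MeasureTheory.integral_congr_ae ?_
    filter_upwards [hL] with x hx
    rw [hx]
  · rw [hnu]
    exact hy.trans (mul_le_mul_of_nonneg_right (by linarith) (norm_nonneg f))
  -- Two solutions have the same inner product with every `A v`, hence with every element of `L²`.
  · refine HalfSpaceElasticity.weightedSobolev_zero_ext (ext_inner_right ℝ fun z => ?_)
    obtain ⟨v, rfl⟩ := HalfSpaceElasticity.weightedLameOp_surjective h hα₀ hβ₀ z
    rw [← HalfSpaceElasticity.pairing_lameOp, ← HalfSpaceElasticity.pairing_lameOp, hpair v]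
    exact (sub_eq_zero.1 (hu'.boundary v)).symm
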